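/- For a finite simple graph $H$ let $|H|$ be its number of vertices, $\alpha(H)$ the largest size of an independent set in $H$, and $nH$ the vertex-disjoint union of $n$ copies of $H$. The Ramsey number $r(G)$ is the least $N$ such that every colouring of the edges of the complete graph $K_N$ with the two colours red and blue contains a monochromatic copy of $G$. Given a red/blue colouring of the edges of a complete graph, an $H$-tie is a set of $2|H|-\alpha(H)$ vertices that contains both a red copy of $H$ and a blue copy of $H$. **Theorem.** There is an absolute constant $C>0$ such that the following holds for every $k\ge 1$, every $k$-vertex graph $H$ without isolated vertices, and every integer $n\ge 2^{Ck}$. There exists a colouring of the edges of $K_{r(nH)-1}$ with the colours red and blue, without a monochromatic copy of $nH$, whose vertex set can be partitioned into three (possibly empty) sets $R$, $B$, $E$ such that: 1. all edges inside $R$ are red and all edges inside $B$ are blue; 2. all edges between $R$ and $B$ have the same colour, all edges between $R$ and $E$ are blue, and all edges between $B$ and $E$ are red; 3. no $H$-tie contains a vertex of $E$. -/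

import Mathlib

open scoped SimpleGraph

/-- The two colours. -/
inductive Colour where
  | red
  | blue

/-- A `2`-colouring of the edges of the complete graph on the vertex set `W`. -/
abbrev TwoColouring (W : Type*) := SimpleGraph.TopEdgeLabeling W Colour

/-- The graph formed by the red edges. -/
abbrev TwoColouring.redGraph {W : Type*} (c : TwoColouring W) : SimpleGraph W :=
  SimpleGraph.EdgeLabeling.labelGraph c Colour.red

/-- The graph formed by the blue edges. -/
abbrev TwoColouring.blueGraph {W : Type*} (c : TwoColouring W) : SimpleGraph W :=
  SimpleGraph.EdgeLabeling.labelGraph c Colour.blue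

/-- There is a monochromatic (red or blue) copy of `G`, not necessarily induced. -/
def TwoColouring.HasMonochromatic {W V : Type*} (c : TwoColouring W) (G : SimpleGraph V) : Prop :=
  G ⊑ c.redGraph ∨ G ⊑ c.blueGraph

/-- The graph `nH`: the vertex disjoint union of `n` copies of `H`. The vertex `(i, v)` is the
vertex `v` of the `i`-th copy. -/
def copies {V : Type*} (n : ℕ) (H : SimpleGraph V) : SimpleGraph (Fin n × V) where
  Adj x y := x.1 = y.1 ∧ H.Adj x.2 y.2
  symm := ⟨fun _ _ h => ⟨h.1.symm, h.2.symm⟩⟩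
  loopless := ⟨fun _ h => H.loopless.irrefl _ h.2⟩

/-- The Ramsey number `r(G)`: the least `N` such that every `2`-colouring of the edges of `K_N`
contains a monochromatic copy of `G`. -/
noncomputable def ramseyNumber {V : Type*} (G : SimpleGraph V) : ℕ :=
  sInf {N : ℕ | ∀ c : TwoColouring (Fin N), c.HasMonochromatic G}

/-- `S` is an `H`-tie: it consists of `2|H| - α(H)` vertices and contains both a red copy of `H`
and a blue copy of `H`. The truncated subtraction is harmless, since `α(H) ≤ |H|`. -/
def TwoColouring.IsTie {W V : Type*} [Fintype V] (c : TwoColouring W) (H : SimpleGraph V)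
    (S : Finset W) : Prop :=
  S.card = 2 * Fintype.card V - H.indepNum ∧
    H ⊑ c.redGraph.induce (S : Set W) ∧ H ⊑ c.blueGraph.induce (S : Set W)

/-! Write k = |H|, i = α(H), κ = 2k - i. The model is a red clique on kn - 1 vertices and a blue one
on (k - i)n - 1 vertices, with blue edges in between: a blue copy of H has at most i vertices in the
red clique. Hence r(nH) ≥ κn - 1. A tie has κ vertices and yields one copy in each colour, so
deleting a tie from an extremal colouring costs exactly as much as lowering n by one.

Stability. Delete a maximal family of disjoint ties outside a set S. The rest L is tie-free, and up
to a constant it is packed by copies in a single colour (`pack_of_tie_free`), at only k < κ vertices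
per copy. Therefore (`card_bound_of_pack`) no S can hold substantially more than |S|/κ copies in
both colours at once, and if S reaches this rate, L is bounded. Ramsey arguments supply such an S: a
red pool X and a blue pool Y with mostly blue edges in between, up to exchanging the colours
(`Extremal.hasPairs`, `Extremal.exists_blue_pools`). Apart from deleted ties only few vertices
remain; by their degrees to the pools they join the red side R, the blue side B or the exceptional
set E (`Extremal.exists_frame`).

Idealisation. Recolour R, B, E to the ideal pattern `st`, leaving the edges inside E alone. This
creates no larger packing (`Frame.pack_red`, `Frame.pack_blue`): the few copies meeting E are
re-embedded greedily, the others are counted. The count allows no loss, so clique packings that are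
perfect up to divisibility are needed; they come from an absorption argument (`pack_cliques_exact`).

Elimination. In the ideal pattern, k new vertices in R and k - i in B raise the avoided number of
copies by one (`Balanced.succ`), so the vertices of deleted ties can be put back. If a tie meets E,
it is deleted and its κ vertices are put back into R and B: the order and n are unchanged and E has
shrunk (`Balanced.sdiff_tie`). When this stops, no tie meets E. -/

namespace MultiRamsey

open scoped Classical
open Finset

/-! ### Packings by disjoint vertex sets -/

variable {W V : Type*}

/-- `A` is the vertex set of a (not necessarily induced) copy of `H` in `G`. -/
def IsCopy (G : SimpleGraph W) (H : SimpleGraph V) (A : Finset W) : Prop :=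
  ∃ f : V → W, Function.Injective f ∧ (∀ u v, H.Adj u v → G.Adj (f u) (f v)) ∧
    ∀ w, w ∈ A ↔ ∃ v, f v = w

/-- `A` contains no clique of `G` with `k` vertices. -/
def NoClique (G : SimpleGraph W) (k : ℕ) (A : Finset W) : Prop :=
  ∀ B ⊆ A, ¬ G.IsNClique k B

/-- A family of disjoint non-empty sets with property `P`. -/
structure IsPacking (P : Finset W → Prop) (F : Finset (Finset W)) : Prop where
  nonempty : ∀ A ∈ F, A.Nonempty
  prop : ∀ A ∈ F, P A
  disj : ∀ A ∈ F, ∀ B ∈ F, A ≠ B → Disjoint A B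

/-- `S` contains `m` disjoint non-empty sets with property `P`. -/
def Pack (P : Finset W → Prop) (S : Finset W) (m : ℕ) : Prop :=
  ∃ F, IsPacking P F ∧ F.biUnion id ⊆ S ∧ F.card = m

theorem IsPacking.subset {P : Finset W → Prop} {F F' : Finset (Finset W)} (h : IsPacking P F)
    (hF : F' ⊆ F) : IsPacking P F' :=
  ⟨fun A hA => h.1 A (hF hA), fun A hA => h.2 A (hF hA), fun A hA B hB => h.3 A (hF hA) B (hF hB)⟩

theorem IsPacking.empty (P : Finset W → Prop) : IsPacking P ∅ := ⟨by simp, by simp, by simp⟩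

theorem IsPacking.imp {P Q : Finset W → Prop} {F : Finset (Finset W)} (h : IsPacking P F)
    (hPQ : ∀ A, P A → Q A) : IsPacking Q F := ⟨h.1, fun A hA => hPQ A (h.2 A hA), h.3⟩

theorem subset_biUnion_id {F : Finset (Finset W)} {A : Finset W} (hA : A ∈ F) :
    A ⊆ F.biUnion id := Finset.subset_biUnion_of_mem id hA

theorem IsPacking.card_biUnion {P : Finset W → Prop} {F : Finset (Finset W)} (h : IsPacking P F) :
    (F.biUnion id).card = ∑ A ∈ F, A.card :=
  Finset.card_biUnion fun A hA B hB hAB => h.3 A hA B hB hAB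

theorem IsPacking.card_biUnion_eq {P : Finset W → Prop} {F : Finset (Finset W)}
    (h : IsPacking P F) {q : ℕ} (hq : ∀ A ∈ F, A.card = q) :
    (F.biUnion id).card = q * F.card := by
  rw [h.card_biUnion, Finset.sum_congr rfl hq, Finset.sum_const, smul_eq_mul, mul_comm]

theorem IsPacking.union {P : Finset W → Prop} {F F' : Finset (Finset W)} (h : IsPacking P F)
    (h' : IsPacking P F') (hd : Disjoint (F.biUnion id) (F'.biUnion id)) :
    IsPacking P (F ∪ F') ∧ (F ∪ F').card = F.card + F'.card := by
  have hdis : ∀ A ∈ F, ∀ B ∈ F', Disjoint A B := fun A hA B hB =>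
    Disjoint.mono (subset_biUnion_id hA) (subset_biUnion_id hB) hd
  refine ⟨⟨?_, ?_, ?_⟩, ?_⟩
  · intro A hA
    rcases Finset.mem_union.1 hA with hA | hA
    exacts [h.1 A hA, h'.1 A hA]
  · intro A hA
    rcases Finset.mem_union.1 hA with hA | hA
    exacts [h.2 A hA, h'.2 A hA]
  · intro A hA B hB hAB
    rcases Finset.mem_union.1 hA with hA | hA <;> rcases Finset.mem_union.1 hB with hB | hB
    exacts [h.3 A hA B hB hAB, hdis A hA B hB, (hdis B hB A hA).symm, h'.3 A hA B hB hAB]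
  · apply Finset.card_union_of_disjoint
    rw [Finset.disjoint_left]
    intro A hA hA'
    have := hdis A hA A hA'
    rw [disjoint_self] at this
    exact (h.1 A hA).ne_empty this

theorem Pack.zero (P : Finset W → Prop) (S : Finset W) : Pack P S 0 :=
  ⟨∅, IsPacking.empty P, by simp, rfl⟩

theorem IsPacking.pack {P : Finset W → Prop} {F : Finset (Finset W)} (h : IsPacking P F) :
    Pack P (F.biUnion id) F.card := ⟨F, h, Finset.Subset.refl _, rfl⟩

theorem Pack.one {P : Finset W → Prop} {A : Finset W} (hA : A.Nonempty) (hP : P A) : Pack P A 1 :=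
  ⟨{A}, ⟨by simpa, by simpa, by simp⟩, by simp, by simp⟩

theorem Pack.mono {P : Finset W → Prop} {S T : Finset W} {m : ℕ} (h : Pack P S m) (hST : S ⊆ T) :
    Pack P T m := by
  obtain ⟨F, h1, h2, h3⟩ := h
  exact ⟨F, h1, h2.trans hST, h3⟩

theorem Pack.imp {P Q : Finset W → Prop} {S : Finset W} {m : ℕ} (h : Pack P S m)
    (hPQ : ∀ A, P A → Q A) : Pack Q S m := by
  obtain ⟨F, h1, h2, h3⟩ := h
  exact ⟨F, h1.imp hPQ, h2, h3⟩

theorem Pack.le {P : Finset W → Prop} {S : Finset W} {m m' : ℕ} (h : Pack P S m) (hm : m' ≤ m) :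
    Pack P S m' := by
  obtain ⟨F, h1, h2, h3⟩ := h
  obtain ⟨F', hF', hc⟩ := Finset.exists_subset_card_eq (h3 ▸ hm)
  exact ⟨F', h1.subset hF', (Finset.biUnion_subset_biUnion_of_subset_left _ hF').trans h2, hc⟩

theorem Pack.add {P : Finset W → Prop} {S T : Finset W} {m m' : ℕ} (h : Pack P S m)
    (h' : Pack P T m') (hd : Disjoint S T) : Pack P (S ∪ T) (m + m') := by
  obtain ⟨F, h1, h2, h3⟩ := h
  obtain ⟨F', h1', h2', h3'⟩ := h'
  obtain ⟨h4, h5⟩ := h1.union h1' (Disjoint.mono h2 h2' hd)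
  refine ⟨F ∪ F', h4, ?_, by rw [h5, h3, h3']⟩
  rw [Finset.union_biUnion]
  exact Finset.union_subset_union h2 h2'

theorem Pack.add' {P : Finset W → Prop} {S T U : Finset W} {m m' m₀ : ℕ} (h : Pack P S m)
    (h' : Pack P T m') (hd : Disjoint S T) (hS : S ⊆ U) (hT : T ⊆ U) (hm : m₀ ≤ m + m') :
    Pack P U m₀ :=
  ((h.add h' hd).mono (Finset.union_subset hS hT)).le hm

theorem exists_maximal_packing (P : Finset W → Prop) (A : Finset W) :
    ∃ F, IsPacking P F ∧ F.biUnion id ⊆ A ∧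
      ∀ B ⊆ A \ F.biUnion id, B.Nonempty → ¬ P B := by
  induction hn : A.card using Nat.strong_induction_on generalizing A with
  | _ n ih =>
    by_cases h : ∃ B ⊆ A, B.Nonempty ∧ P B
    · obtain ⟨B, hBA, hB, hPB⟩ := h
      have hlt : (A \ B).card < n := by
        rw [← hn]
        apply Finset.card_lt_card
        rw [Finset.ssubset_iff_of_subset Finset.sdiff_subset]
        obtain ⟨b, hb⟩ := hB
        exact ⟨b, hBA hb, by simp [hb]⟩
      obtain ⟨F, h1, h2, h3⟩ := ih _ hlt (A \ B) rfl
      have hd : Disjoint (F.biUnion id) (({B} : Finset (Finset W)).biUnion id) := by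
        simp only [Finset.singleton_biUnion, id]
        exact Finset.disjoint_of_subset_left h2 Finset.sdiff_disjoint
      obtain ⟨h4, -⟩ := h1.union (F' := {B}) ⟨by simpa, by simpa, by simp⟩ hd
      refine ⟨F ∪ {B}, h4, ?_, ?_⟩
      · rw [Finset.union_biUnion]
        refine Finset.union_subset (h2.trans Finset.sdiff_subset) (by simpa using hBA)
      · intro C hC
        apply h3
        refine hC.trans ?_
        intro x hx
        simp only [Finset.union_biUnion, Finset.singleton_biUnion, id, Finset.mem_sdiff,
          Finset.mem_union, not_or] at hx
        simp only [Finset.mem_sdiff]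
        exact ⟨⟨hx.1, hx.2.2⟩, hx.2.1⟩
    · push Not at h
      exact ⟨∅, IsPacking.empty P, by simp, fun B hB hB' => h B (by simpa using hB) hB'⟩

/-! ### Ramsey's theorem and greedy covers by cliques -/

theorem NoClique.subset {G : SimpleGraph W} {k : ℕ} {A B : Finset W} (h : NoClique G k A)
    (hB : B ⊆ A) : NoClique G k B := fun C hC => h C (hC.trans hB)

theorem isNClique_of_subset {G : SimpleGraph W} {l : ℕ} {A B : Finset W} (h : G.IsNClique l A)
    (hB : B ⊆ A) {k : ℕ} (hk : B.card = k) : G.IsNClique k B :=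
  ⟨h.1.subset (by exact_mod_cast hB), hk⟩

theorem isNClique_insert' {G : SimpleGraph W} {l : ℕ} {B : Finset W} (h : G.IsNClique l B)
    {v : W} (hv : ∀ b ∈ B, G.Adj v b) : G.IsNClique (l + 1) (insert v B) := by
  have hvB : v ∉ B := fun h => (hv v h).ne rfl
  refine ⟨?_, by rw [Finset.card_insert_of_notMem hvB, h.2]⟩
  rw [Finset.coe_insert, SimpleGraph.isClique_insert]
  exact ⟨h.1, fun b hb _ => hv b hb⟩

/-- A quantitative form of Ramsey's theorem for two colours. -/
theorem ramsey (G : SimpleGraph W) : ∀ (s a b : ℕ), a + b = s → ∀ A : Finset W,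
    2 ^ (a + b) ≤ A.card → (∃ B ⊆ A, G.IsNClique a B) ∨ ∃ B ⊆ A, Gᶜ.IsNClique b B := by
  intro s
  induction s with
  | zero =>
    intro a b hab A _
    left
    have : a = 0 := by omega
    exact ⟨∅, by simp, by simp [this]⟩
  | succ s ih =>
    intro a b hab A hA
    rcases Nat.eq_zero_or_pos a with rfl | ha
    · exact Or.inl ⟨∅, by simp, by simp⟩
    rcases Nat.eq_zero_or_pos b with rfl | hb
    · exact Or.inr ⟨∅, by simp, by simp⟩
    have hne : A.Nonempty := by
      rw [← Finset.card_pos]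
      exact lt_of_lt_of_le (by positivity) hA
    obtain ⟨v, hv⟩ := hne
    have hsum : (A.filter (fun w => G.Adj v w)).card + (A.filter (fun w => Gᶜ.Adj v w)).card + 1
        = A.card := by
      rw [← Finset.card_union_of_disjoint]
      · rw [← Finset.card_erase_add_one hv]
        congr 2
        ext w
        simp only [Finset.mem_union, Finset.mem_filter, SimpleGraph.compl_adj, Finset.mem_erase]
        constructor
        · rintro (⟨h1, h2⟩ | ⟨h1, h2, h3⟩)
          · exact ⟨h2.ne', h1⟩
          · exact ⟨fun h => h2 h.symm, h1⟩
        · rintro ⟨h1, h2⟩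
          by_cases h : G.Adj v w
          · exact Or.inl ⟨h2, h⟩
          · exact Or.inr ⟨h2, fun h => h1 h.symm, h⟩
      · rw [Finset.disjoint_filter]
        intro w _ h1 h2
        exact h2.2 h1
    have hpow : 2 ^ (a + b) = 2 * 2 ^ s := by rw [hab, pow_succ, mul_comm]
    have hcase : 2 ^ s ≤ (A.filter (fun w => G.Adj v w)).card ∨
        2 ^ s ≤ (A.filter (fun w => Gᶜ.Adj v w)).card := by
      by_contra h
      push Not at h
      omega
    rcases hcase with h | h
    · rcases ih (a - 1) b (by omega) _ (by rwa [show a - 1 + b = s by omega]) with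
        ⟨B, hB, hBc⟩ | ⟨B, hB, hBc⟩
      · left
        refine ⟨insert v B, Finset.insert_subset hv (hB.trans (Finset.filter_subset _ _)), ?_⟩
        have := isNClique_insert' hBc (v := v) (fun b hb => (Finset.mem_filter.1 (hB hb)).2)
        rwa [Nat.sub_add_cancel ha] at this
      · exact Or.inr ⟨B, hB.trans (Finset.filter_subset _ _), hBc⟩
    · rcases ih a (b - 1) (by omega) _ (by rwa [show a + (b - 1) = s by omega]) with
        ⟨B, hB, hBc⟩ | ⟨B, hB, hBc⟩
      · exact Or.inl ⟨B, hB.trans (Finset.filter_subset _ _), hBc⟩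
      · right
        refine ⟨insert v B, Finset.insert_subset hv (hB.trans (Finset.filter_subset _ _)), ?_⟩
        have := isNClique_insert' hBc (v := v) (fun b hb => (Finset.mem_filter.1 (hB hb)).2)
        rwa [Nat.sub_add_cancel hb] at this

theorem NoClique.exists_clique {G : SimpleGraph W} {k : ℕ} {A : Finset W}
    (h : NoClique Gᶜ k A) (q : ℕ) (hA : 2 ^ (q + k) ≤ A.card) : ∃ B ⊆ A, G.IsNClique q B := by
  rcases ramsey G _ q k rfl A hA with h' | ⟨B, hB, hBc⟩
  · exact h'
  · exact absurd hBc (h B hB)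

theorem NoClique.exists_clique' {G : SimpleGraph W} {k : ℕ} {A : Finset W}
    (h : NoClique G k A) (q : ℕ) (hA : 2 ^ (q + k) ≤ A.card) : ∃ B ⊆ A, Gᶜ.IsNClique q B := by
  apply NoClique.exists_clique _ q hA
  rwa [compl_compl]

/-- A set without large cliques of the complement can be covered by disjoint `q`-cliques, up to
few vertices. -/
theorem NoClique.exists_cover {G : SimpleGraph W} {k : ℕ} {A : Finset W}
    (h : NoClique Gᶜ k A) {q : ℕ} (hq : 1 ≤ q) :
    ∃ F, IsPacking (G.IsNClique q) F ∧ F.biUnion id ⊆ A ∧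
      (A \ F.biUnion id).card < 2 ^ (q + k) := by
  obtain ⟨F, h1, h2, h3⟩ := exists_maximal_packing (G.IsNClique q) A
  refine ⟨F, h1, h2, ?_⟩
  by_contra hc
  push Not at hc
  obtain ⟨B, hB, hBc⟩ := (h.subset Finset.sdiff_subset).exists_clique q hc
  refine h3 B hB ?_ hBc
  rw [← Finset.card_pos, hBc.2]
  exact hq

theorem IsPacking.card_cliques {G : SimpleGraph W} {q : ℕ} {F : Finset (Finset W)}
    (h : IsPacking (G.IsNClique q) F) : (F.biUnion id).card = q * F.card :=
  h.card_biUnion_eq fun A hA => (h.2 A hA).2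

theorem NoClique.pack {G : SimpleGraph W} {k : ℕ} {A : Finset W}
    (h : NoClique Gᶜ k A) {q : ℕ} (hq : 1 ≤ q) {m : ℕ} (hm : q * m + 2 ^ (q + k) ≤ A.card + q) :
    Pack (G.IsNClique q) A m := by
  obtain ⟨F, h1, h2, h3⟩ := h.exists_cover hq
  refine (h1.pack.mono h2).le ?_
  have h4 := Finset.card_sdiff_add_card_eq_card h2
  rw [h1.card_cliques] at h4
  by_contra hlt
  push Not at hlt
  have : q * (F.card + 1) ≤ q * m := Nat.mul_le_mul_left _ hlt
  rw [mul_add] at this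
  omega

theorem Pack.biUnion {ι : Type*} {P : Finset W → Prop} (s : Finset ι) (S : ι → Finset W)
    (m : ι → ℕ) (h : ∀ j ∈ s, Pack P (S j) (m j))
    (hd : ∀ j ∈ s, ∀ j' ∈ s, j ≠ j' → Disjoint (S j) (S j')) :
    Pack P (s.biUnion S) (∑ j ∈ s, m j) := by
  induction s using Finset.induction_on with
  | empty => simpa using Pack.zero P ∅
  | insert a s ha ih =>
    rw [Finset.biUnion_insert, Finset.sum_insert ha]
    refine (h a (Finset.mem_insert_self _ _)).add
      (ih (fun j hj => h j (Finset.mem_insert_of_mem hj)) fun j hj j' hj' =>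
        hd j (Finset.mem_insert_of_mem hj) j' (Finset.mem_insert_of_mem hj')) ?_
    rw [Finset.disjoint_biUnion_right]
    intro j hj
    exact hd a (Finset.mem_insert_self _ _) j (Finset.mem_insert_of_mem hj)
      (fun h => ha (h ▸ hj))

/-! ### Perfect clique packings by absorption -/

theorem exists_injective_choice {ι α : Type*} [Fintype ι] (S : ι → Finset α)
    (h : ∀ j, Fintype.card ι ≤ (S j).card) : ∃ f : ι → α, Function.Injective f ∧ ∀ j, f j ∈ S j := by
  rw [← Finset.all_card_le_biUnion_card_iff_exists_injective]
  intro s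
  rcases s.eq_empty_or_nonempty with rfl | ⟨j, hj⟩
  · simp
  · exact (Finset.card_le_univ s).trans ((h j).trans
      (Finset.card_le_card (Finset.subset_biUnion_of_mem S hj)))

theorem card_filter_adj_add {G : SimpleGraph W} {v : W} {K : Finset W} (hv : v ∉ K) :
    (K.filter (G.Adj v)).card + (K.filter (Gᶜ.Adj v)).card = K.card := by
  rw [← Finset.card_union_of_disjoint]
  · congr 1
    ext w
    simp only [Finset.mem_union, Finset.mem_filter, SimpleGraph.compl_adj]
    constructor
    · rintro (h | h) <;> exact h.1
    · intro hw
      have : v ≠ w := fun h => hv (h ▸ hw)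
      tauto
  · rw [Finset.disjoint_filter]
    exact fun w _ h1 h2 => h2.2 h1

theorem isNClique_pack_one {G : SimpleGraph W} {q : ℕ} (hq : 1 ≤ q) {A : Finset W}
    (h : G.IsNClique q A) : Pack (G.IsNClique q) A 1 := by
  refine Pack.one ?_ h
  rw [← Finset.card_pos, h.2]
  exact hq

/-- A `2q`-clique splits into two `q`-cliques. -/
theorem pack_double_clique {G : SimpleGraph W} {q : ℕ} (hq : 1 ≤ q) {K : Finset W}
    (hK : G.IsNClique (2 * q) K) : Pack (G.IsNClique q) K 2 := by
  obtain ⟨C, hC, hCc⟩ := Finset.exists_subset_card_eq (show q ≤ K.card by rw [hK.2]; omega)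
  refine Pack.add' (isNClique_pack_one hq (isNClique_of_subset hK hC hCc))
    (isNClique_pack_one hq (isNClique_of_subset hK (Finset.sdiff_subset (s := K) (t := C)) ?_))
    Finset.disjoint_sdiff hC Finset.sdiff_subset le_rfl
  rw [Finset.card_sdiff_of_subset hC, hK.2, hCc]
  omega

/-- A vertex of a `2q`-clique can be exchanged for any vertex with `q` neighbours in it. -/
theorem pack_swap {G : SimpleGraph W} {q : ℕ} (hq : 1 ≤ q) {K : Finset W}
    (hK : G.IsNClique (2 * q) K) {w z : W} (hw : w ∉ K) (hz : z ∈ K)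
    (hN : q ≤ (K.filter (G.Adj w)).card) : Pack (G.IsNClique q) (insert w (K.erase z)) 2 := by
  have h1 : q - 1 ≤ ((K.filter (G.Adj w)).erase z).card :=
    (Nat.sub_le_sub_right hN 1).trans Finset.pred_card_le_card_erase
  obtain ⟨C, hC, hCc⟩ := Finset.exists_subset_card_eq h1
  have hCK : C ⊆ K.erase z := hC.trans (Finset.erase_subset_erase _ (Finset.filter_subset _ _))
  have hCK' : C ⊆ K := hCK.trans (Finset.erase_subset _ _)
  have hA : G.IsNClique q (insert w C) := by
    have := isNClique_insert' (isNClique_of_subset hK hCK' hCc) (v := w)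
      fun b hb => (Finset.mem_filter.1 (Finset.mem_of_mem_erase (hC hb))).2
    rwa [Nat.sub_add_cancel hq] at this
  have hB : G.IsNClique q (K.erase z \ C) := by
    refine isNClique_of_subset hK (Finset.sdiff_subset.trans (Finset.erase_subset _ _)) ?_
    rw [Finset.card_sdiff_of_subset hCK, Finset.card_erase_of_mem hz, hK.2, hCc]
    omega
  refine Pack.add' (isNClique_pack_one hq hA) (isNClique_pack_one hq hB) ?_
    (Finset.insert_subset_insert _ hCK) (Finset.sdiff_subset.trans (Finset.subset_insert _ _)) le_rfl
  rw [Finset.disjoint_insert_left]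
  exact ⟨fun h => hw (Finset.mem_of_mem_erase (Finset.mem_sdiff.1 h).1), Finset.disjoint_sdiff⟩

/-- A block with fewer than q neighbours of `v` contains at least q non-neighbours. The blocks are
disjoint and `v` has at most |X|/16 non-neighbours, so few blocks refuse `v`. -/
theorem bad_blocks_le {G : SimpleGraph W} {q : ℕ} {F : Finset (Finset W)} {X : Finset W}
    (hF : IsPacking (G.IsNClique (2 * q)) F) (hFX : F.biUnion id ⊆ X) {v : W}
    (hv : v ∉ F.biUnion id) (hdeg : 16 * (X.filter (Gᶜ.Adj v)).card ≤ X.card) :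
    16 * q * (F.filter fun K => (K.filter (G.Adj v)).card < q).card ≤ X.card := by
  set B := F.filter fun K => (K.filter (G.Adj v)).card < q with hB
  have hBF : B ⊆ F := Finset.filter_subset _ _
  have h1 : ∀ K ∈ B, q ≤ (K.filter (Gᶜ.Adj v)).card := by
    intro K hK
    have hKF := hBF hK
    have h2 := card_filter_adj_add (G := G) (v := v) (K := K)
      (fun h => hv (subset_biUnion_id hKF h))
    rw [(hF.2 K hKF).2] at h2
    have := (Finset.mem_filter.1 hK).2
    omega
  have h2 : B.card * q ≤ (B.biUnion fun K => K.filter (Gᶜ.Adj v)).card := by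
    rw [Finset.card_biUnion]
    · exact Finset.card_nsmul_le_sum _ _ _ h1
    · intro K hK K' hK' hne
      exact (hF.3 K (hBF hK) K' (hBF hK') hne).mono (Finset.filter_subset _ _)
        (Finset.filter_subset _ _)
  have h3 : (B.biUnion fun K => K.filter (Gᶜ.Adj v)).card ≤ (X.filter (Gᶜ.Adj v)).card := by
    apply Finset.card_le_card
    intro x hx
    simp only [Finset.mem_biUnion, Finset.mem_filter] at hx ⊢
    obtain ⟨K, hK, hx1, hx2⟩ := hx
    exact ⟨hFX (subset_biUnion_id (hBF hK) hx1), hx2⟩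
  calc 16 * q * B.card = 16 * (B.card * q) := by ring
    _ ≤ 16 * (X.filter (Gᶜ.Adj v)).card := Nat.mul_le_mul_left _ (h2.trans h3)
    _ ≤ X.card := hdeg

/-- Double count the non-edges between `T` and the bad blocks: each of the 2q vertices of a bad
block has at least q non-neighbours in `T`, whereas each of the 2q vertices of `T` has at most
|X|/16. -/
theorem bad_blocks_for_target_le {G : SimpleGraph W} {q : ℕ} (hq : 1 ≤ q)
    {F : Finset (Finset W)} {X : Finset W}
    (hF : IsPacking (G.IsNClique (2 * q)) F) (hFX : F.biUnion id ⊆ X) {T : Finset W}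
    (hT : T ∈ F) (hdeg : ∀ v ∈ X, 16 * (X.filter (Gᶜ.Adj v)).card ≤ X.card) :
    16 * q * (F.filter fun K => K ≠ T ∧ ∀ z ∈ K, (T.filter (G.Adj z)).card < q).card
      ≤ X.card := by
  set B := F.filter fun K => K ≠ T ∧ ∀ z ∈ K, (T.filter (G.Adj z)).card < q with hB
  have hBF : B ⊆ F := Finset.filter_subset _ _
  have hBU : B.biUnion id ⊆ X := (Finset.biUnion_subset_biUnion_of_subset_left _ hBF).trans hFX
  have hTX : T ⊆ X := (subset_biUnion_id hT).trans hFX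
  have h1 : ∀ z ∈ B.biUnion id, q ≤ (T.filter (Gᶜ.Adj z)).card := by
    intro z hz
    obtain ⟨K, hK, hzK⟩ := Finset.mem_biUnion.1 hz
    have hK' := Finset.mem_filter.1 hK
    have h2 := card_filter_adj_add (G := G) (v := z) (K := T)
      (Finset.disjoint_left.1 (hF.3 K hK'.1 T hT hK'.2.1) hzK)
    rw [(hF.2 T hT).2] at h2
    have := hK'.2.2 z hzK
    omega
  have h2 : (B.biUnion id).card = 2 * q * B.card := (hF.subset hBF).card_cliques
  have h3 : (B.biUnion id).card * q ≤ ∑ z ∈ B.biUnion id, (T.filter (Gᶜ.Adj z)).card :=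
    Finset.card_nsmul_le_sum _ _ _ h1
  have h4 : ∑ z ∈ B.biUnion id, (T.filter (Gᶜ.Adj z)).card
      = ∑ u ∈ T, ((B.biUnion id).filter (fun z => Gᶜ.Adj z u)).card :=
    Finset.sum_card_bipartiteAbove_eq_sum_card_bipartiteBelow _
  have h5 : 16 * ∑ u ∈ T, ((B.biUnion id).filter (fun z => Gᶜ.Adj z u)).card ≤ T.card * X.card := by
    rw [Finset.mul_sum]
    refine Finset.sum_le_card_nsmul _ _ _ ?_
    intro u hu
    refine le_trans (Nat.mul_le_mul_left _ (Finset.card_le_card ?_)) (hdeg u (hTX hu))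
    intro z hz
    rw [Finset.mem_filter] at hz ⊢
    exact ⟨hBU hz.1, hz.2.symm⟩
  rw [(hF.2 T hT).2] at h5
  rw [h2] at h3
  have h6 : 2 * q * (16 * q * B.card) ≤ 2 * q * X.card := by
    calc 2 * q * (16 * q * B.card) = 16 * (2 * q * B.card * q) := by ring
      _ ≤ 16 * ∑ z ∈ B.biUnion id, (T.filter (Gᶜ.Adj z)).card := Nat.mul_le_mul_left _ h3
      _ ≤ 2 * q * X.card := by rw [h4]; exact h5
  exact Nat.le_of_mul_le_mul_left h6 (by omega)

/-- `q` uncovered vertices can be absorbed by rearranging a few of the covering cliques. -/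
theorem pack_gather {G : SimpleGraph W} {k q : ℕ} (hq : 1 ≤ q) {X : Finset W}
    (hfree : NoClique Gᶜ k X) (hdeg : ∀ v ∈ X, 16 * (X.filter (Gᶜ.Adj v)).card ≤ X.card)
    {I : Finset (Finset W)} (hI : IsPacking (G.IsNClique (2 * q)) I) (hIX : I.biUnion id ⊆ X)
    (hIr : 2 ^ (q + k) ≤ I.card) (hIc : 2 * X.card + 32 * q * q ≤ 16 * q * I.card)
    {L : Finset W} (hLX : L ⊆ X) (hLI : Disjoint L (I.biUnion id)) (hL : L.card = q) :
    ∃ J ⊆ I, J.card = 2 * q ∧ Pack (G.IsNClique q) (L ∪ J.biUnion id) (2 * J.card + 1) := by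
  -- One representative per block, with an arbitrary value outside `I`. There are enough
  -- representatives to contain a q-clique `Q`, which will be the additional clique.
  have hrep : ∀ K : Finset W, ∃ z, K ∈ I → z ∈ K := by
    intro K
    by_cases hK : K ∈ I
    · obtain ⟨z, hz⟩ := hI.1 K hK
      exact ⟨z, fun _ => hz⟩
    · obtain ⟨K', hK'⟩ := Finset.card_pos.1 (lt_of_lt_of_le (by positivity) hIr)
      obtain ⟨z, -⟩ := hI.1 K' hK'
      exact ⟨z, fun h => absurd h hK⟩
  choose ρ hρ using hrep
  have hρinj : Set.InjOn ρ I := by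
    intro K hK K' hK' h
    by_contra hne
    exact Finset.disjoint_left.1 (hI.3 K hK K' hK' hne) (hρ K hK) (h ▸ hρ K' hK')
  have hρX : I.image ρ ⊆ X := by
    intro x hx
    obtain ⟨K, hK, rfl⟩ := Finset.mem_image.1 hx
    exact hIX (subset_biUnion_id hK (hρ K hK))
  obtain ⟨Q, hQ, hQc⟩ := (hfree.subset hρX).exists_clique q
    (by rw [Finset.card_image_of_injOn hρinj]; exact hIr)
  -- enumerate the vertices of `L`, and the cliques whose representatives form `Q`
  have eL : Fin q ≃ L := (Fintype.equivFinOfCardEq (by simpa using hL)).symm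
  have eQ : Fin q ≃ Q := (Fintype.equivFinOfCardEq (by simpa using hQc.2)).symm
  have hblock : ∀ j : Fin q, ∃ K ∈ I, ρ K = eQ j := fun j => by
    simpa using hQ (eQ j).2
  choose K hKI hKρ using hblock
  have hKinj : Function.Injective K := by
    intro j j' h
    have h1 : (eQ j : W) = eQ j' := by rw [← hKρ, ← hKρ, h]
    exact eQ.injective (Subtype.ext h1)
  have hLmem : ∀ j, (eL j : W) ∉ I.biUnion id := fun j => Finset.disjoint_left.1 hLI (eL j).2
  -- The blocks usable as an intermediate stop for j: the j-th leftover vertex can enter `K'`, and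
  -- some vertex of `K'` can enter `K j`. A direct swap into `K j` might be impossible.
  let S : Fin q → Finset (Finset W) := fun j => I.filter fun K' =>
    K' ∉ Finset.univ.image K ∧ q ≤ (K'.filter (G.Adj (eL j))).card ∧
      ∃ z ∈ K', q ≤ ((K j).filter (G.Adj z)).card
  have hS : ∀ j, Fintype.card (Fin q) ≤ (S j).card := by
    intro j
    rw [Fintype.card_fin]
    set B1 := I.filter fun K' => (K'.filter (G.Adj (eL j))).card < q with hB1
    set B2 := I.filter fun K' => K' ≠ K j ∧ ∀ z ∈ K', ((K j).filter (G.Adj z)).card < q with hB2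
    have h1 : 16 * q * B1.card ≤ X.card :=
      bad_blocks_le hI hIX (hLmem j) (hdeg _ (hLX (eL j).2))
    have h2 : 16 * q * B2.card ≤ X.card := bad_blocks_for_target_le hq hI hIX (hKI j) hdeg
    have h3 : I ⊆ S j ∪ (Finset.univ.image K ∪ (B1 ∪ B2)) := by
      intro K' hK'
      by_contra h
      simp only [Finset.mem_union, not_or] at h
      obtain ⟨ha, hb, hc, hd⟩ := h
      apply ha
      refine Finset.mem_filter.2 ⟨hK', hb, ?_, ?_⟩
      · by_contra hlt
        exact hc (Finset.mem_filter.2 ⟨hK', by omega⟩)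
      · by_contra hlt
        push Not at hlt
        exact hd (Finset.mem_filter.2 ⟨hK', fun h => hb (h ▸ by simp), hlt⟩)
    have h4 : I.card ≤ (S j).card + (q + (B1.card + B2.card)) := by
      refine (Finset.card_le_card h3).trans ((Finset.card_union_le _ _).trans ?_)
      refine Nat.add_le_add_left ((Finset.card_union_le _ _).trans (Nat.add_le_add ?_
        (Finset.card_union_le _ _))) _
      simpa using Finset.card_image_le (s := (Finset.univ : Finset (Fin q))) (f := K)
    by_contra hlt
    have h5 : 16 * q * I.card ≤ 16 * q * ((S j).card + (q + (B1.card + B2.card))) :=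
      Nat.mul_le_mul_left _ h4
    have h6 : 16 * q * ((S j).card + 1) ≤ 16 * q * q := Nat.mul_le_mul_left _ (by omega)
    have h7 : 16 * q * ((S j).card + (q + (B1.card + B2.card)))
        = 16 * q * (S j).card + 16 * q * q + 16 * q * B1.card + 16 * q * B2.card := by ring
    have h8 : 16 * q * ((S j).card + 1) = 16 * q * (S j).card + 16 * q := by ring
    have h9 : 32 * q * q = 16 * q * q + 16 * q * q := by ring
    omega
  obtain ⟨K', hK'inj, hK'⟩ := exists_injective_choice S hS
  have hK'I : ∀ j, K' j ∈ I := fun j => (Finset.mem_filter.1 (hK' j)).1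
  have hK'ne : ∀ j j', K' j ≠ K j' := fun j j' h =>
    (Finset.mem_filter.1 (hK' j)).2.1 (h ▸ by simp)
  have hK'L := fun j => (Finset.mem_filter.1 (hK' j)).2.2.1
  have hK'z := fun j => (Finset.mem_filter.1 (hK' j)).2.2.2
  choose z hz hzK using hK'z
  have hQK : ∀ j, (eQ j : W) ∈ K j := fun j => hKρ j ▸ hρ _ (hKI j)
  -- A chain of two swaps: the leftover vertex displaces `z j` from `K' j`, which displaces the
  -- representative from `K j`. The 4q vertices of `A j` split into four q-cliques, and the
  -- displaced representatives form `Q`.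
  let A : Fin q → Finset W := fun j => insert (eL j : W) (K' j ∪ (K j).erase (eQ j))
  have hA : ∀ j, Pack (G.IsNClique q) (A j) 4 := by
    intro j
    have hzKj : z j ∉ K j := Finset.disjoint_left.1 (hI.3 _ (hK'I j) _ (hKI j) (hK'ne j j)) (hz j)
    have hlK' : (eL j : W) ∉ K' j := fun h => hLmem j (subset_biUnion_id (hK'I j) h)
    have hlK : (eL j : W) ∉ K j := fun h => hLmem j (subset_biUnion_id (hKI j) h)
    have hdis := hI.3 _ (hK'I j) _ (hKI j) (hK'ne j j)
    refine Pack.add' (pack_swap hq (hI.2 _ (hK'I j)) hlK' (hz j) (hK'L j))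
      (pack_swap hq (hI.2 _ (hKI j)) hzKj (hQK j) (hzK j)) ?_ ?_ ?_ (by norm_num)
    · rw [Finset.disjoint_insert_left, Finset.disjoint_insert_right]
      refine ⟨?_, by simp, ?_⟩
      · rw [Finset.mem_insert, not_or]
        exact ⟨fun h => hlK' (h ▸ hz j), fun h => hlK (Finset.mem_of_mem_erase h)⟩
      · exact hdis.mono (Finset.erase_subset _ _) (Finset.erase_subset _ _)
    · exact Finset.insert_subset_insert _
        ((Finset.erase_subset _ _).trans Finset.subset_union_left)
    · refine Finset.insert_subset ?_ ?_
      · exact Finset.mem_insert_of_mem (Finset.mem_union_left _ (hz j))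
      · exact Finset.subset_union_right.trans (Finset.subset_insert _ _)
  have hmemA : ∀ j x, x ∈ A j → x = eL j ∨ x ∈ K' j ∨ (x ∈ K j ∧ x ≠ eQ j) := by
    intro j x hx
    simp only [A, Finset.mem_insert, Finset.mem_union, Finset.mem_erase] at hx
    tauto
  have hnot : ∀ {B C : Finset W} {x : W}, B ∈ I → C ∈ I → B ≠ C → x ∈ B → x ∈ C → False :=
    fun hB hC hne hx hx' => Finset.disjoint_left.1 (hI.3 _ hB _ hC hne) hx hx'
  have hAd : ∀ j ∈ (Finset.univ : Finset (Fin q)), ∀ j' ∈ (Finset.univ : Finset (Fin q)),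
      j ≠ j' → Disjoint (A j) (A j') := by
    intro j _ j' _ hne
    rw [Finset.disjoint_left]
    intro x hx hx'
    rcases hmemA j x hx with h | h | ⟨h, -⟩ <;> rcases hmemA j' x hx' with h' | h' | ⟨h', -⟩
    · exact hne (eL.injective (Subtype.ext (h.symm.trans h')))
    · exact hLmem j (h ▸ subset_biUnion_id (hK'I j') h')
    · exact hLmem j (h ▸ subset_biUnion_id (hKI j') h')
    · exact hLmem j' (h' ▸ subset_biUnion_id (hK'I j) h)
    · exact hnot (hK'I j) (hK'I j') (fun h => hne (hK'inj h)) h h'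
    · exact hnot (hK'I j) (hKI j') (hK'ne _ _) h h'
    · exact hLmem j' (h' ▸ subset_biUnion_id (hKI j) h)
    · exact hnot (hKI j) (hK'I j') (hK'ne _ _).symm h h'
    · exact hnot (hKI j) (hKI j') (fun h => hne (hKinj h)) h h'
  have hpack := Pack.biUnion Finset.univ A (fun _ => 4) (fun j _ => hA j) hAd
  have hJdis : Disjoint (Finset.univ.image K) (Finset.univ.image K') := by
    rw [Finset.disjoint_left]
    intro B hB hB'
    obtain ⟨j, -, rfl⟩ := Finset.mem_image.1 hB
    obtain ⟨j', -, h⟩ := Finset.mem_image.1 hB'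
    exact hK'ne _ _ h
  have hJc : (Finset.univ.image K ∪ Finset.univ.image K').card = 2 * q := by
    rw [Finset.card_union_of_disjoint hJdis, Finset.card_image_of_injective _ hKinj,
      Finset.card_image_of_injective _ hK'inj]
    simp only [Finset.card_univ, Fintype.card_fin]
    omega
  refine ⟨Finset.univ.image K ∪ Finset.univ.image K', ?_, hJc, ?_⟩
  · refine Finset.union_subset ?_ ?_
    · intro B hB
      obtain ⟨j, -, rfl⟩ := Finset.mem_image.1 hB
      exact hKI j
    · intro B hB
      obtain ⟨j, -, rfl⟩ := Finset.mem_image.1 hB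
      exact hK'I j
  · have hKU : ∀ j x, x ∈ K j →
        x ∈ L ∪ (Finset.univ.image K ∪ Finset.univ.image K').biUnion id := fun j x hx => by
      refine Finset.mem_union_right _ (Finset.mem_biUnion.2 ⟨K j, ?_, hx⟩)
      exact Finset.mem_union_left _ (Finset.mem_image_of_mem _ (Finset.mem_univ _))
    refine Pack.add' hpack (isNClique_pack_one hq hQc) ?_ ?_ ?_ ?_
    · rw [Finset.disjoint_left]
      intro x hx hxQ
      obtain ⟨j, -, hxj⟩ := Finset.mem_biUnion.1 hx
      obtain ⟨j', hj'⟩ := eQ.surjective ⟨x, hxQ⟩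
      have hxj' : (eQ j' : W) = x := by rw [hj']
      have hxK : x ∈ K j' := hxj' ▸ hQK j'
      rcases hmemA j x hxj with h | h | ⟨h, h'⟩
      · exact hLmem j (h ▸ subset_biUnion_id (hKI j') hxK)
      · exact hnot (hK'I j) (hKI j') (hK'ne _ _) h hxK
      · by_cases hjj : j = j'
        · exact h' (by rw [hjj, hxj'])
        · exact hnot (hKI j) (hKI j') (fun h => hjj (hKinj h)) h hxK
    · intro x hx
      obtain ⟨j, -, hxj⟩ := Finset.mem_biUnion.1 hx
      rcases hmemA j x hxj with h | h | ⟨h, -⟩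
      · exact Finset.mem_union_left _ (h ▸ (eL j).2)
      · refine Finset.mem_union_right _ (Finset.mem_biUnion.2 ⟨K' j, ?_, h⟩)
        exact Finset.mem_union_right _ (Finset.mem_image_of_mem _ (Finset.mem_univ _))
      · exact hKU j x h
    · intro x hxQ
      obtain ⟨j', hj'⟩ := eQ.surjective ⟨x, hxQ⟩
      have hxj' : (eQ j' : W) = x := by rw [hj']
      exact hKU j' x (hxj' ▸ hQK j')
    · rw [hJc]
      simp
      omega

/-- Each round absorbs q leftover vertices and uses up 2q blocks, which become 4q + 1 cliques. The
term 32ql in the hypothesis pays for this: losing 2q blocks lowers the right side by 32q², as does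
replacing l by l - q. Fewer than q leftovers are simply dropped. -/
theorem pack_absorb {G : SimpleGraph W} {k q : ℕ} (hq : 1 ≤ q) {X : Finset W}
    (hfree : NoClique Gᶜ k X) (hdeg : ∀ v ∈ X, 16 * (X.filter (Gᶜ.Adj v)).card ≤ X.card)
    (hX : 8 * q * 2 ^ (q + k) ≤ X.card) (l : ℕ) :
    ∀ (I : Finset (Finset W)) (L : Finset W), IsPacking (G.IsNClique (2 * q)) I →
      I.biUnion id ⊆ X → L ⊆ X → Disjoint L (I.biUnion id) → L.card = l →
      2 * X.card + 32 * q * q + 32 * q * l ≤ 16 * q * I.card →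
      ∀ m, q * m ≤ 2 * q * I.card + l → Pack (G.IsNClique q) (L ∪ I.biUnion id) m := by
  induction l using Nat.strong_induction_on with
  | _ l ih =>
    intro I L hI hIX hLX hLI hL hIc m hm
    by_cases hlq : l < q
    · have h1 := Pack.biUnion I id (fun _ => 2) (fun K hK => pack_double_clique hq (hI.2 K hK)) hI.3
      refine (h1.mono Finset.subset_union_right).le ?_
      rw [Finset.sum_const, smul_eq_mul]
      by_contra hlt
      have : q * (I.card * 2 + 1) ≤ q * m := Nat.mul_le_mul_left _ (by omega)
      have h2 : q * (I.card * 2 + 1) = 2 * q * I.card + q := by ring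
      omega
    · push Not at hlq
      obtain ⟨L0, hL0, hL0c⟩ := Finset.exists_subset_card_eq (hL ▸ hlq)
      have hIr : 2 ^ (q + k) ≤ I.card := by
        have h1 : 16 * q * 2 ^ (q + k) = 2 * (8 * q * 2 ^ (q + k)) := by ring
        have h2 : 16 * q * 2 ^ (q + k) ≤ 16 * q * I.card := by omega
        exact Nat.le_of_mul_le_mul_left h2 (by omega)
      obtain ⟨J, hJI, hJc, hJ⟩ := pack_gather hq hfree hdeg hI hIX hIr (by omega)
        (hL0.trans hLX) (hLI.mono_left hL0) hL0c
      have hcardI : (I \ J).card + 2 * q = I.card := by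
        rw [← hJc, Finset.card_sdiff_add_card_eq_card hJI]
      have hsub : (I \ J).biUnion id ⊆ I.biUnion id :=
        Finset.biUnion_subset_biUnion_of_subset_left _ Finset.sdiff_subset
      have hsubJ : J.biUnion id ⊆ I.biUnion id :=
        Finset.biUnion_subset_biUnion_of_subset_left _ hJI
      have hLc : (L \ L0).card = l - q := by rw [Finset.card_sdiff_of_subset hL0, hL, hL0c]
      have h2 := ih (l - q) (by omega) (I \ J) (L \ L0) (hI.subset Finset.sdiff_subset)
        (hsub.trans hIX) (Finset.sdiff_subset.trans hLX)
        (hLI.mono Finset.sdiff_subset hsub) hLc (by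
          have e1 : 16 * q * I.card = 16 * q * (I \ J).card + 32 * q * q := by rw [← hcardI]; ring
          have e2 : 32 * q * l = 32 * q * (l - q) + 32 * q * q := by
            rw [← mul_add, Nat.sub_add_cancel hlq]
          omega) (m - (4 * q + 1)) (by
          rw [Nat.mul_sub]
          have e1 : 2 * q * I.card = 2 * q * (I \ J).card + 4 * q * q := by rw [← hcardI]; ring
          have e2 : q * (4 * q + 1) = 4 * q * q + q := by ring
          omega)
      refine Pack.add' hJ h2 ?_ ?_ ?_ ?_
      · rw [Finset.disjoint_union_left, Finset.disjoint_union_right, Finset.disjoint_union_right]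
        refine ⟨⟨Finset.disjoint_sdiff, hLI.mono hL0 hsub⟩, ?_, ?_⟩
        · exact (hLI.mono Finset.sdiff_subset hsubJ).symm
        · rw [Finset.disjoint_biUnion_left]
          intro K hK
          rw [Finset.disjoint_biUnion_right]
          intro K' hK'
          rw [Finset.mem_sdiff] at hK'
          exact hI.3 K (hJI hK) K' hK'.1 (fun h => hK'.2 (h ▸ hK))
      · exact Finset.union_subset_union hL0 hsubJ
      · exact Finset.union_subset_union Finset.sdiff_subset hsub
      · rw [hJc]
        omega

/-- A large set in which every vertex has few non-neighbours, and without large independent sets,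
has a perfect packing by `q`-cliques, up to divisibility. -/
theorem pack_cliques_exact {G : SimpleGraph W} {k q : ℕ} (hq : 1 ≤ q) (hqk : q ≤ k) {X : Finset W}
    (hfree : NoClique Gᶜ k X) (hdeg : ∀ v ∈ X, 16 * (X.filter (Gᶜ.Adj v)).card ≤ X.card)
    (hX : 2 ^ (10 * k) ≤ X.card) {m : ℕ} (hm : q * m ≤ X.card) : Pack (G.IsNClique q) X m := by
  -- Blocks of size 2q leave room for swaps: a vertex can enter a block as soon as q of its 2q
  -- vertices are neighbours.
  obtain ⟨F, h1, h2, h3⟩ := hfree.exists_cover (q := 2 * q) (by omega)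
  have h4 := Finset.card_sdiff_add_card_eq_card h2
  rw [h1.card_cliques] at h4
  have hk2 : k ≤ 2 ^ k := Nat.lt_two_pow_self.le
  have hq2 : q ≤ 2 ^ k := hqk.trans hk2
  have hpow3 : (X \ F.biUnion id).card ≤ 2 ^ (3 * k) :=
    h3.le.trans (Nat.pow_le_pow_right (by norm_num) (by omega))
  have e4 : q * 2 ^ (3 * k) ≤ 2 ^ (4 * k) := by
    calc q * 2 ^ (3 * k) ≤ 2 ^ k * 2 ^ (3 * k) := Nat.mul_le_mul_right _ hq2
      _ = 2 ^ (4 * k) := by rw [← pow_add]; congr 1; ring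
  have e3 : q * 2 ^ (q + k) ≤ 2 ^ (4 * k) :=
    (Nat.mul_le_mul_left _ (Nat.pow_le_pow_right (by norm_num) (by omega))).trans e4
  have e5 : q * q ≤ 2 ^ (4 * k) :=
    (Nat.mul_le_mul_left q (hq2.trans (Nat.pow_le_pow_right (by norm_num) (by omega)))).trans e4
  have e6 : q * (X \ F.biUnion id).card ≤ 2 ^ (4 * k) := (Nat.mul_le_mul_left _ hpow3).trans e4
  have e7 : 2 ^ (4 * k) * 64 ≤ 2 ^ (10 * k) := by
    calc 2 ^ (4 * k) * 64 = 2 ^ (4 * k + 6) := by rw [pow_add]; norm_num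
      _ ≤ 2 ^ (10 * k) := Nat.pow_le_pow_right (by norm_num) (by omega)
  have e8 : (X \ F.biUnion id).card ≤ 2 ^ (4 * k) :=
    hpow3.trans (Nat.pow_le_pow_right (by norm_num) (by omega))
  have h5 := pack_absorb hq hfree hdeg (by
      have : 8 * q * 2 ^ (q + k) = 8 * (q * 2 ^ (q + k)) := by ring
      omega) _ F (X \ F.biUnion id) h1 h2 Finset.sdiff_subset Finset.sdiff_disjoint rfl (by
      have a1 : 16 * q * F.card = 8 * (2 * q * F.card) := by ring
      have a2 : 32 * q * q = 32 * (q * q) := by ring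
      have a3 : 32 * q * (X \ F.biUnion id).card = 32 * (q * (X \ F.biUnion id).card) := by ring
      omega) m (by omega)
  rwa [Finset.sdiff_union_of_subset h2] at h5

/-- Every vertex of `T` lies in its own `q`-clique whose other vertices are in `X \ D`. -/
theorem pack_attach_vertices {G : SimpleGraph W} {k q : ℕ} (hq : 1 ≤ q) (hqk : q ≤ k)
    {X D : Finset W} {Θ : ℕ} (hfree : NoClique Gᶜ k X) (T : Finset W) (hT : Disjoint T X)
    (hΘ : D.card + k * T.card + 2 ^ (2 * k) ≤ Θ)
    (hdeg : ∀ w ∈ T, Θ ≤ (X.filter (G.Adj w)).card) :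
    ∃ C ⊆ X \ D, C.card = (q - 1) * T.card ∧ Pack (G.IsNClique q) (T ∪ C) T.card := by
  induction T using Finset.induction_on with
  | empty => exact ⟨∅, by simp, by simp, Pack.zero _ _⟩
  | insert w T hw ih =>
    rw [Finset.card_insert_of_notMem hw] at hΘ ⊢
    rw [Finset.disjoint_insert_left] at hT
    obtain ⟨C, hC, hCc, hCp⟩ := ih hT.2 (by rw [mul_add] at hΘ; omega)
      fun w hw => hdeg w (Finset.mem_insert_of_mem hw)
    have h1 : 2 ^ (q + k) ≤ (X.filter (G.Adj w) \ (D ∪ C)).card := by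
      have h2 := Finset.le_card_sdiff (D ∪ C) (X.filter (G.Adj w))
      have h3 := hdeg w (Finset.mem_insert_self _ _)
      have h4 := Finset.card_union_le D C
      have h5 : (q - 1) * T.card ≤ k * T.card := Nat.mul_le_mul_right _ (by omega)
      have h6 : 2 ^ (q + k) ≤ 2 ^ (2 * k) := Nat.pow_le_pow_right (by norm_num) (by omega)
      rw [mul_add] at hΘ
      omega
    obtain ⟨B, hB, hBc⟩ := (hfree.subset (Finset.sdiff_subset.trans
      (Finset.filter_subset _ _))).exists_clique q h1
    obtain ⟨B', hB', hBc'⟩ := Finset.exists_subset_card_eq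
      (show q - 1 ≤ B.card by rw [hBc.2]; exact Nat.sub_le q 1)
    have hB'2 := hB'.trans hB
    have hclique : G.IsNClique q (insert w B') := by
      have := isNClique_insert' (isNClique_of_subset hBc hB' hBc') (v := w) fun b hb =>
        (Finset.mem_filter.1 (Finset.mem_sdiff.1 (hB'2 hb)).1).2
      rwa [Nat.sub_add_cancel hq] at this
    have hB'X : B' ⊆ X := fun x hx => (Finset.mem_filter.1 (Finset.mem_sdiff.1 (hB'2 hx)).1).1
    have hB'D : ∀ x ∈ B', x ∉ D ∧ x ∉ C := fun x hx => by
      simpa using (Finset.mem_sdiff.1 (hB'2 hx)).2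
    refine ⟨C ∪ B', ?_, ?_, ?_⟩
    · refine Finset.union_subset hC fun x hx => Finset.mem_sdiff.2 ⟨hB'X hx, (hB'D x hx).1⟩
    · rw [Finset.card_union_of_disjoint, hCc, hBc']
      · rw [mul_add, mul_one]
      · exact (Finset.disjoint_left.2 fun x hx => (hB'D x hx).2).symm
    · refine Pack.add' hCp (isNClique_pack_one hq hclique) ?_ ?_ ?_ le_rfl
      · rw [Finset.disjoint_insert_right]
        refine ⟨?_, ?_⟩
        · rw [Finset.mem_union, not_or]
          exact ⟨hw, fun h => hT.1 (Finset.mem_sdiff.1 (hC h)).1⟩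
        · rw [Finset.disjoint_union_left]
          exact ⟨hT.2.mono_right hB'X, (Finset.disjoint_left.2 fun x hx => (hB'D x hx).2).symm⟩
      · intro x hx
        simp only [Finset.mem_union, Finset.mem_insert] at hx ⊢
        tauto
      · intro x hx
        simp only [Finset.mem_union, Finset.mem_insert] at hx ⊢
        tauto

/-- The version of `pack_cliques_exact` in which some vertices of `X` are deleted, some vertices
with many neighbours in `X` are added, and some disjoint cliques are added. -/
theorem pack_cliques_with_extras {G : SimpleGraph W} {k q : ℕ} (hq : 1 ≤ q) (hqk : q ≤ k)
    {X D T : Finset W} {F : Finset (Finset W)} {Θ : ℕ} (hfree : NoClique Gᶜ k X)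
    (hX : ∀ v ∈ X, 32 * (X.filter (Gᶜ.Adj v)).card ≤ X.card) (hD : D ⊆ X)
    (hT : Disjoint T X) (hΘ : D.card + k * T.card + 2 ^ (2 * k) ≤ Θ)
    (hdeg : ∀ w ∈ T, Θ ≤ (X.filter (G.Adj w)).card) (hXΘ : 2 * Θ ≤ X.card)
    (hXk : 2 * 2 ^ (10 * k) ≤ X.card) (hF : IsPacking (G.IsNClique q) F)
    (hFX : Disjoint X (F.biUnion id)) (hFT : Disjoint T (F.biUnion id)) {m : ℕ}
    (hm : q * m ≤ (X \ D).card + T.card + (F.biUnion id).card) :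
    Pack (G.IsNClique q) ((X \ D) ∪ T ∪ F.biUnion id) m := by
  obtain ⟨C, hC, hCc, hCp⟩ := pack_attach_vertices hq hqk hfree T hT hΘ hdeg
  have hCX : C ⊆ X := hC.trans Finset.sdiff_subset
  have hX' : X \ (D ∪ C) ⊆ X := Finset.sdiff_subset
  have h1 : (X \ D).card = X.card - D.card := Finset.card_sdiff_of_subset hD
  have h2 : (X \ (D ∪ C)).card + C.card = (X \ D).card := by
    rw [show X \ (D ∪ C) = (X \ D) \ C by ext x; simp; tauto, Finset.card_sdiff_add_card_eq_card hC]
  have h3 := Finset.card_le_card hD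
  have h4 : (q - 1) * T.card ≤ k * T.card := Nat.mul_le_mul_right _ (by omega)
  have h0 : 0 < 2 ^ (2 * k) := by positivity
  -- At least half of `X` survives, so the bound 1/32 on the proportion of non-neighbours turns into
  -- the 1/16 required for exact packing.
  have h5 : X.card ≤ 2 * (X \ (D ∪ C)).card := by omega
  have h6 : (q - 1) * T.card + T.card = q * T.card := by
    rw [← Nat.succ_mul, Nat.succ_eq_add_one, Nat.sub_add_cancel hq]
  have h7 := hF.card_cliques
  have hexact := pack_cliques_exact hq hqk (hfree.subset hX') (fun v hv => by
    have h8 := hX v (hX' hv)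
    have h9 : ((X \ (D ∪ C)).filter (Gᶜ.Adj v)).card ≤ (X.filter (Gᶜ.Adj v)).card :=
      Finset.card_le_card (Finset.filter_subset_filter _ hX')
    omega) (by omega) (m := (X \ (D ∪ C)).card / q) (Nat.mul_div_le _ _)
  have hCX' : Disjoint C (X \ (D ∪ C)) :=
    (Finset.sdiff_disjoint.mono_right Finset.subset_union_right).symm
  have hadd := hexact.add hCp (by
    rw [Finset.disjoint_union_right]
    exact ⟨(hT.mono_right hX').symm, hCX'.symm⟩)
  refine Pack.add' hadd hF.pack ?_ ?_ Finset.subset_union_right ?_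
  · rw [Finset.disjoint_union_left, Finset.disjoint_union_left]
    exact ⟨hFX.mono_left hX', hFT, hFX.mono_left hCX⟩
  · refine Finset.Subset.trans ?_ Finset.subset_union_left
    intro x hx
    simp only [Finset.mem_union, Finset.mem_sdiff] at hx ⊢
    rcases hx with hx | hx | hx
    · exact Or.inl ⟨hx.1, fun h => hx.2 (Or.inl h)⟩
    · exact Or.inr hx
    · exact Or.inl (Finset.mem_sdiff.1 (hC hx))
  · have h8 : (X \ (D ∪ C)).card < q * ((X \ (D ∪ C)).card / q + 1) :=
      Nat.lt_mul_div_succ _ (by omega)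
    rw [h7] at hm
    by_contra hlt
    have h9 : q * ((X \ (D ∪ C)).card / q + T.card + F.card + 1) ≤ q * m :=
      Nat.mul_le_mul_left _ (by omega)
    have h10 : q * ((X \ (D ∪ C)).card / q + T.card + F.card + 1)
      = q * ((X \ (D ∪ C)).card / q + 1) + q * T.card + q * F.card := by ring
    omega

/-! ### Copies of H -/

section Copies

theorem IsCopy.card [Fintype V] {G : SimpleGraph W} {H : SimpleGraph V} {A : Finset W}
    (h : IsCopy G H A) : A.card = Fintype.card V := by
  obtain ⟨f, hf, -, hA⟩ := h
  have : A = Finset.univ.map ⟨f, hf⟩ := by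
    ext w
    simp [hA]
  rw [this, Finset.card_map, Finset.card_univ]

theorem IsCopy.nonempty [Nonempty V] {G : SimpleGraph W} {H : SimpleGraph V} {A : Finset W}
    (h : IsCopy G H A) : A.Nonempty := by
  obtain ⟨f, hf, -, hA⟩ := h
  exact ⟨f (Classical.arbitrary V), (hA _).2 ⟨_, rfl⟩⟩

theorem isCopy_of_clique [Fintype V] {G : SimpleGraph W} (H : SimpleGraph V) {A : Finset W}
    (h : G.IsNClique (Fintype.card V) A) : IsCopy G H A := by
  have e : V ≃ A := Fintype.equivOfCardEq (by simpa using h.2.symm)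
  refine ⟨fun v => e v, fun u v huv => e.injective (Subtype.ext huv), ?_, ?_⟩
  · intro u v huv
    refine h.1 (e u).2 (e v).2 fun he => huv.ne (e.injective (Subtype.ext he))
  · intro w
    constructor
    · intro hw
      obtain ⟨v, hv⟩ := e.surjective ⟨w, hw⟩
      exact ⟨v, congrArg Subtype.val hv⟩
    · rintro ⟨v, rfl⟩
      exact (e v).2

/-- A maximum independent set of H is sent to `I`, where no edges are needed; all other edges are
supplied by the clique `Q` and the join. -/
theorem isCopy_of_join [Fintype V] {G : SimpleGraph W} (H : SimpleGraph V) {I Q : Finset W}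
    (hIQ : Disjoint I Q) (hI : I.card = H.indepNum)
    (hQ : G.IsNClique (Fintype.card V - H.indepNum) Q) (hadj : ∀ x ∈ I, ∀ y ∈ Q, G.Adj x y) :
    IsCopy G H (I ∪ Q) := by
  obtain ⟨J, hJ⟩ := H.exists_isNIndepSet_indepNum
  have e1 : J ≃ I := Fintype.equivOfCardEq (by simp [hJ.2, hI])
  have e2 : (Jᶜ : Finset V) ≃ Q := Fintype.equivOfCardEq (by
    rw [Fintype.card_coe, Fintype.card_coe, Finset.card_compl, hJ.2, hQ.2])
  let f : V → W := fun v => if h : v ∈ J then e1 ⟨v, h⟩ else e2 ⟨v, Finset.mem_compl.2 h⟩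
  have hf1 : ∀ v (h : v ∈ J), f v = e1 ⟨v, h⟩ := fun v h => by simp [f, h]
  have hf2 : ∀ v (h : v ∉ J), f v = e2 ⟨v, Finset.mem_compl.2 h⟩ := fun v h => by simp [f, h]
  have hf1' : ∀ v, v ∈ J → f v ∈ I := fun v h => by rw [hf1 v h]; exact (e1 _).2
  have hf2' : ∀ v, v ∉ J → f v ∈ Q := fun v h => by rw [hf2 v h]; exact (e2 _).2
  have hinj : Function.Injective f := by
    intro u v huv
    by_cases hu : u ∈ J <;> by_cases hv : v ∈ J
    · rw [hf1 u hu, hf1 v hv] at huv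
      exact congrArg Subtype.val (e1.injective (Subtype.ext huv))
    · exact absurd (hf2' v hv) (Finset.disjoint_left.1 hIQ (huv ▸ hf1' u hu))
    · exact absurd (hf2' u hu) (Finset.disjoint_left.1 hIQ (huv ▸ hf1' v hv))
    · rw [hf2 u hu, hf2 v hv] at huv
      exact congrArg Subtype.val (e2.injective (Subtype.ext huv))
  refine ⟨f, hinj, ?_, ?_⟩
  · intro u v huv
    by_cases hu : u ∈ J <;> by_cases hv : v ∈ J
    · exact absurd huv (hJ.1 hu hv huv.ne)
    · exact hadj _ (hf1' u hu) _ (hf2' v hv)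
    · exact (hadj _ (hf1' v hv) _ (hf2' u hu)).symm
    · exact hQ.1 (hf2' u hu) (hf2' v hv) fun h => huv.ne (hinj h)
  · intro w
    rw [Finset.mem_union]
    constructor
    · rintro (hw | hw)
      · obtain ⟨v, hv⟩ := e1.surjective ⟨w, hw⟩
        exact ⟨v, by rw [hf1 v v.2, hv]⟩
      · obtain ⟨v, hv⟩ := e2.surjective ⟨w, hw⟩
        exact ⟨v, by rw [hf2 v (Finset.mem_compl.1 v.2), hv]⟩
    · rintro ⟨v, rfl⟩
      by_cases hv : v ∈ J
      exacts [Or.inl (hf1' v hv), Or.inr (hf2' v hv)]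

theorem IsCopy.image {W' : Type*} {G : SimpleGraph W} {G' : SimpleGraph W'} {H : SimpleGraph V}
    {A : Finset W} (h : IsCopy G H A) (φ : W → W') (hφ : Set.InjOn φ A)
    (hadj : ∀ x ∈ A, ∀ y ∈ A, G.Adj x y → G'.Adj (φ x) (φ y)) : IsCopy G' H (A.image φ) := by
  obtain ⟨f, hf, hfH, hA⟩ := h
  have hmem : ∀ v, f v ∈ A := fun v => (hA _).2 ⟨v, rfl⟩
  refine ⟨φ ∘ f, fun u v huv => hf (hφ (hmem u) (hmem v) huv), fun u v huv =>
    hadj _ (hmem u) _ (hmem v) (hfH u v huv), ?_⟩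
  intro w
  rw [Finset.mem_image]
  constructor
  · rintro ⟨a, ha, rfl⟩
    obtain ⟨v, rfl⟩ := (hA a).1 ha
    exact ⟨v, rfl⟩
  · rintro ⟨v, rfl⟩
    exact ⟨f v, hmem v, rfl⟩

theorem IsCopy.congr {G G' : SimpleGraph W} {H : SimpleGraph V} {A : Finset W}
    (h : IsCopy G H A) (hadj : ∀ x ∈ A, ∀ y ∈ A, G.Adj x y → G'.Adj x y) : IsCopy G' H A := by
  have := h.image id Function.injective_id.injOn (G' := G') hadj
  rwa [Finset.image_id] at this

theorem IsCopy.card_indep_le [Fintype V] {G : SimpleGraph W} {H : SimpleGraph V} {A S : Finset W}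
    (h : IsCopy G H A) (hS : S ⊆ A) (hind : ∀ x ∈ S, ∀ y ∈ S, ¬ G.Adj x y) :
    S.card ≤ H.indepNum := by
  obtain ⟨f, hf, hfH, hA⟩ := h
  have h1 : (Finset.univ.filter fun v => f v ∈ S).card ≤ H.indepNum := by
    apply SimpleGraph.IsIndepSet.card_le_indepNum
    intro u hu v hv _ huv
    simp only [Finset.coe_filter, Finset.mem_univ, true_and, Set.mem_ofPred_eq] at hu hv
    exact hind _ hu _ hv (hfH u v huv)
  refine le_trans (le_of_eq ?_) h1
  symm
  apply Finset.card_nbij f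
  · intro v hv
    simpa using hv
  · exact hf.injOn
  · intro w hw
    obtain ⟨v, rfl⟩ := (hA w).1 (hS hw)
    exact ⟨v, by simpa using hw, rfl⟩

theorem IsCopy.exists_adj {G : SimpleGraph W} {H : SimpleGraph V} (hH : ∀ v, ¬ H.IsIsolated v)
    {A : Finset W} (h : IsCopy G H A) {x : W} (hx : x ∈ A) : ∃ y ∈ A, G.Adj x y := by
  obtain ⟨f, hf, hfH, hA⟩ := h
  obtain ⟨v, rfl⟩ := (hA x).1 hx
  have := hH v
  unfold SimpleGraph.IsIsolated at this
  push Not at this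
  obtain ⟨u, hu⟩ := this
  exact ⟨f u, (hA _).2 ⟨u, rfl⟩, hfH _ _ hu⟩

theorem indepNum_lt_card [Fintype V] [Nonempty V] {H : SimpleGraph V}
    (hH : ∀ v, ¬ H.IsIsolated v) : H.indepNum < Fintype.card V := by
  obtain ⟨J, hJ⟩ := H.exists_isNIndepSet_indepNum
  rw [← hJ.2, Finset.card_lt_iff_ne_univ]
  rintro rfl
  have v : V := Classical.arbitrary V
  have := hH v
  unfold SimpleGraph.IsIsolated at this
  push Not at this
  obtain ⟨u, hu⟩ := this
  exact hJ.1 (Finset.mem_coe.2 (Finset.mem_univ v)) (Finset.mem_coe.2 (Finset.mem_univ u)) hu.ne hu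

end Copies

/-! ### Ties and tie-free sets -/

/-- `S` is an `H`-tie for the red graph `G` and the blue graph `Gᶜ`. -/
def IsTieSet [Fintype V] (G : SimpleGraph W) (H : SimpleGraph V) (S : Finset W) : Prop :=
  S.card = 2 * Fintype.card V - H.indepNum ∧ (∃ A ⊆ S, IsCopy G H A) ∧ ∃ A ⊆ S, IsCopy Gᶜ H A

theorem IsTieSet.compl [Fintype V] {G : SimpleGraph W} {H : SimpleGraph V} {S : Finset W}
    (h : IsTieSet G H S) : IsTieSet Gᶜ H S := by
  refine ⟨h.1, h.2.2, ?_⟩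
  rw [compl_compl]
  exact h.2.1

/-- A vertex set can be made uniform towards a small set. -/
theorem exists_uniform (G : SimpleGraph W) (P Z : Finset W) : ∃ Z' ⊆ Z, ∃ Q ⊆ P,
    Z.card ≤ 2 ^ P.card * Z'.card ∧ ∀ z ∈ Z', ∀ p ∈ P, G.Adj p z ↔ p ∈ Q := by
  have h1 : ∀ z ∈ Z, (P.filter fun p => G.Adj p z) ∈ P.powerset := fun z _ =>
    Finset.mem_powerset.2 (Finset.filter_subset _ _)
  have hsum := Finset.card_eq_sum_card_fiberwise h1
  by_contra hcon
  push Not at hcon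
  -- Pigeonhole over the 2^|P| adjacency patterns; the `+ 1` keeps the inequality strict through the
  -- summation.
  have h2 : ∀ Q ∈ P.powerset,
      2 ^ P.card * (Z.filter fun z => (P.filter fun p => G.Adj p z) = Q).card + 1 ≤ Z.card := by
    intro Q hQ
    by_contra hlt
    push Not at hlt
    obtain ⟨z, hz, p, hp, h⟩ := hcon
      (Z.filter fun z => (P.filter fun p => G.Adj p z) = Q) (Finset.filter_subset _ _) Q
      (Finset.mem_powerset.1 hQ) (by omega)
    have h3 := (Finset.mem_filter.1 hz).2
    have h4 : G.Adj p z ↔ p ∈ Q := by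
      rw [← h3, Finset.mem_filter]
      exact ⟨fun h => ⟨hp, h⟩, fun h => h.2⟩
    tauto
  have h3 := Finset.sum_le_card_nsmul _ _ _ h2
  rw [Finset.sum_add_distrib, ← Finset.mul_sum, ← hsum, Finset.card_powerset] at h3
  simp only [Finset.sum_const, Finset.card_powerset, smul_eq_mul, mul_one] at h3
  have : 0 < 2 ^ P.card := by positivity
  omega

/-- The red clique `X` and k - α(H) vertices of the blue clique `Y` suffice: `X` is a red copy, and
α(H) of its vertices joined to the chosen part of `Y` carry a blue one. The overlap in α(H) vertices
gives the size 2k - α(H). -/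
theorem isTieSet_of_complete [Fintype V] {G : SimpleGraph W} {H : SimpleGraph V}
    (hα : H.indepNum ≤ Fintype.card V) {X Y : Finset W} (hX : G.IsNClique (Fintype.card V) X)
    (hY : Gᶜ.IsNClique (Fintype.card V) Y) (hXY : Disjoint X Y)
    (hadj : ∀ x ∈ X, ∀ y ∈ Y, Gᶜ.Adj x y) : ∃ S ⊆ X ∪ Y, IsTieSet G H S := by
  obtain ⟨I, hI, hIc⟩ := Finset.exists_subset_card_eq (hX.2 ▸ hα)
  obtain ⟨Q, hQ, hQc⟩ := Finset.exists_subset_card_eq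
    (show Fintype.card V - H.indepNum ≤ Y.card by rw [hY.2]; exact Nat.sub_le _ _)
  refine ⟨X ∪ Q, Finset.union_subset_union_right hQ, ?_,
    ⟨X, Finset.subset_union_left, isCopy_of_clique H hX⟩,
    ⟨I ∪ Q, Finset.union_subset_union_left hI, ?_⟩⟩
  · rw [Finset.card_union_of_disjoint (hXY.mono_right hQ), hX.2, hQc]
    omega
  · exact isCopy_of_join H (hXY.mono hI hQ) hIc (isNClique_of_subset hY hQ hQc)
      fun x hx y hy => hadj x (hI hx) y (hQ hy)

theorem isTieSet_of_complete' [Fintype V] {G : SimpleGraph W} {H : SimpleGraph V}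
    (hα : H.indepNum ≤ Fintype.card V) {X Y : Finset W} (hX : G.IsNClique (Fintype.card V) X)
    (hY : Gᶜ.IsNClique (Fintype.card V) Y) (hXY : Disjoint X Y)
    (hadj : ∀ x ∈ X, ∀ y ∈ Y, G.Adj x y) : ∃ S ⊆ X ∪ Y, IsTieSet G H S := by
  obtain ⟨S, hS, hT⟩ := isTieSet_of_complete (G := Gᶜ) hα hY (by rwa [compl_compl]) hXY.symm
    (by rw [compl_compl]; exact fun y hy x hx => (hadj x hx y hy).symm)
  refine ⟨S, by rwa [Finset.union_comm], ?_⟩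
  have := hT.compl
  rwa [compl_compl] at this

/-- A clique of size `2k` is half complete to every uniform set outside it. -/
theorem exists_half {G : SimpleGraph W} {k : ℕ} {P Q Z : Finset W} (hP : P.card = 2 * k)
    (hPZ : Disjoint P Z) (hunif : ∀ z ∈ Z, ∀ p ∈ P, G.Adj p z ↔ p ∈ Q) :
    ∃ P' ⊆ P, P'.card = k ∧
      ((∀ p ∈ P', ∀ z ∈ Z, G.Adj p z) ∨ ∀ p ∈ P', ∀ z ∈ Z, Gᶜ.Adj p z) := by
  have h1 := Finset.card_inter_add_card_sdiff P Q
  by_cases h : k ≤ (P ∩ Q).card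
  · obtain ⟨P', hP', hc⟩ := Finset.exists_subset_card_eq h
    refine ⟨P', hP'.trans Finset.inter_subset_left, hc, Or.inl fun p hp z hz => ?_⟩
    have := Finset.mem_inter.1 (hP' hp)
    exact (hunif z hz p this.1).2 this.2
  · obtain ⟨P', hP', hc⟩ := Finset.exists_subset_card_eq (show k ≤ (P \ Q).card by omega)
    refine ⟨P', hP'.trans Finset.sdiff_subset, hc, Or.inr fun p hp z hz => ?_⟩
    have := Finset.mem_sdiff.1 (hP' hp)
    refine ⟨fun he => Finset.disjoint_left.1 hPZ this.1 (he ▸ hz), fun h => ?_⟩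
    exact this.2 ((hunif z hz p this.1).1 h)

/-- Pass to vertices of `A` that all see the at most 4k vertices of `P ∪ Q` alike, at the price of a
factor 2^(4k). Ramsey's theorem needs 2^(2k) of them for a k-clique; half of the 2k-clique of the
opposite colour is joined to it in a single colour, and this makes a tie. -/
theorem exists_isTieSet [Fintype V] [Nonempty V] {G : SimpleGraph W} {H : SimpleGraph V}
    (hα : H.indepNum ≤ Fintype.card V) {A P Q : Finset W}
    (hA : 2 ^ (7 * Fintype.card V) ≤ A.card) (hPA : P ⊆ A) (hQA : Q ⊆ A)
    (hP : G.IsNClique (2 * Fintype.card V) P) (hQ : Gᶜ.IsNClique (2 * Fintype.card V) Q) :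
    ∃ S ⊆ A, IsTieSet G H S := by
  set k := Fintype.card V with hk
  have hk1 : 1 ≤ k := Fintype.card_pos
  obtain ⟨Z, hZ, R, -, hZc, hZu⟩ := exists_uniform G (P ∪ Q) (A \ (P ∪ Q))
  have hZA : Z ⊆ A := hZ.trans Finset.sdiff_subset
  have hZP : Disjoint P Z := Finset.disjoint_sdiff.mono Finset.subset_union_left hZ
  have hZQ : Disjoint Q Z := Finset.disjoint_sdiff.mono Finset.subset_union_right hZ
  have hPQ : (P ∪ Q).card ≤ 4 * k := by
    have := Finset.card_union_le P Q
    rw [hP.2, hQ.2] at this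
    omega
  have hZlarge : 2 ^ (k + k) ≤ Z.card := by
    by_contra hlt
    push Not at hlt
    have h1 : 2 ^ (P ∪ Q).card * Z.card ≤ 2 ^ (4 * k) * 2 ^ (k + k) :=
      Nat.mul_le_mul (Nat.pow_le_pow_right (by norm_num) hPQ) hlt.le
    rw [← pow_add] at h1
    have h2 := Finset.le_card_sdiff (P ∪ Q) A
    have h3 : 2 ^ (7 * k) = 2 ^ (4 * k + (k + k)) * 2 ^ k := by rw [← pow_add]; congr 1; ring
    have h4 : k + 1 ≤ 2 ^ k := Nat.lt_two_pow_self
    have h5 : 4 * k < 2 ^ (4 * k) := Nat.lt_two_pow_self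
    have h6 : 2 ^ (4 * k) ≤ 2 ^ (4 * k + (k + k)) := Nat.pow_le_pow_right (by norm_num) (by omega)
    have h7 : 2 ^ (4 * k + (k + k)) * 2 ≤ 2 ^ (4 * k + (k + k)) * 2 ^ k :=
      Nat.mul_le_mul_left _ (by omega)
    omega
  rcases ramsey G _ k k rfl Z hZlarge with ⟨B, hB, hBc⟩ | ⟨B, hB, hBc⟩
  · obtain ⟨Q', hQ', hQ'c, h⟩ := exists_half (G := G) hQ.2 (hZQ.mono_right hB)
      (fun z hz p hp => hZu z (hB hz) p (Finset.mem_union_right _ hp))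
    have hQ'c' := isNClique_of_subset hQ hQ' hQ'c
    have hd : Disjoint B Q' := (hZQ.mono hQ' hB).symm
    have hsub : B ∪ Q' ⊆ A := Finset.union_subset (hB.trans hZA) (hQ'.trans hQA)
    rcases h with h | h
    · obtain ⟨S, hS, hT⟩ := isTieSet_of_complete' (H := H) hα hBc hQ'c' hd
        fun x hx y hy => (h y hy x hx).symm
      exact ⟨S, hS.trans hsub, hT⟩
    · obtain ⟨S, hS, hT⟩ := isTieSet_of_complete (H := H) hα hBc hQ'c' hd
        fun x hx y hy => (h y hy x hx).symm
      exact ⟨S, hS.trans hsub, hT⟩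
  · obtain ⟨P', hP', hP'c, h⟩ := exists_half (G := G) hP.2 (hZP.mono_right hB)
      (fun z hz p hp => hZu z (hB hz) p (Finset.mem_union_left _ hp))
    have hP'c' := isNClique_of_subset hP hP' hP'c
    have hd : Disjoint P' B := hZP.mono hP' hB
    have hsub : P' ∪ B ⊆ A := Finset.union_subset (hP'.trans hPA) (hB.trans hZA)
    rcases h with h | h
    · obtain ⟨S, hS, hT⟩ := isTieSet_of_complete' (H := H) hα hP'c' hBc hd h
      exact ⟨S, hS.trans hsub, hT⟩
    · obtain ⟨S, hS, hT⟩ := isTieSet_of_complete (H := H) hα hP'c' hBc hd h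
      exact ⟨S, hS.trans hsub, hT⟩

/-- Without large blue cliques, red k-cliques can be removed greedily until a bounded remainder is
left. -/
theorem pack_copies_of_noClique [Fintype V] [Nonempty V] {G : SimpleGraph W} (H : SimpleGraph V)
    {L : Finset W} (h : NoClique Gᶜ (2 * Fintype.card V) L) :
    ∃ ν, Pack (IsCopy G H) L ν ∧ L.card ≤ Fintype.card V * ν + 2 ^ (7 * Fintype.card V) := by
  set k := Fintype.card V with hk
  have hk1 : 1 ≤ k := Fintype.card_pos
  obtain ⟨F, h1, h2, h3⟩ := h.exists_cover (q := k) hk1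
  refine ⟨F.card, (h1.imp fun A hA => isCopy_of_clique H hA).pack.mono h2, ?_⟩
  have h4 := Finset.card_sdiff_add_card_eq_card h2
  rw [h1.card_cliques] at h4
  have h5 : 2 ^ (k + 2 * k) ≤ 2 ^ (7 * k) := Nat.pow_le_pow_right (by norm_num) (by omega)
  omega

/-- In one of the colours, a tie-free set can be packed by copies of `H` up to few vertices. -/
theorem pack_of_tie_free [Fintype V] [Nonempty V] {G : SimpleGraph W} {H : SimpleGraph V}
    (hα : H.indepNum ≤ Fintype.card V) {L : Finset W} (hL : ∀ S ⊆ L, ¬ IsTieSet G H S) :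
    ∃ ν, (Pack (IsCopy G H) L ν ∨ Pack (IsCopy Gᶜ H) L ν) ∧
      L.card ≤ Fintype.card V * ν + 2 ^ (7 * Fintype.card V) := by
  by_cases hlarge : 2 ^ (7 * Fintype.card V) ≤ L.card
  · by_cases h1 : NoClique G (2 * Fintype.card V) L
    · obtain ⟨ν, h2, h3⟩ := pack_copies_of_noClique (G := Gᶜ) H (by rwa [compl_compl])
      exact ⟨ν, Or.inr h2, h3⟩
    · unfold NoClique at h1
      push Not at h1
      obtain ⟨P, hP, hPc⟩ := h1
      have h2 : NoClique Gᶜ (2 * Fintype.card V) L := by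
        intro Q hQ hQc
        obtain ⟨S, hS, hT⟩ := exists_isTieSet (H := H) hα hlarge hP hQ hPc hQc
        exact hL S hS hT
      obtain ⟨ν, h3, h4⟩ := pack_copies_of_noClique (G := G) H h2
      exact ⟨ν, Or.inl h3, h4⟩
  · exact ⟨0, Or.inl (Pack.zero _ _), by omega⟩

/-! ### Counting in extremal colourings -/

/-- Removing as many disjoint ties as possible outside a set `S` of vertices. -/
theorem exists_reduct [Fintype W] [Fintype V] [Nonempty V] {G : SimpleGraph W} {H : SimpleGraph V}
    {n : ℕ} (hG : ¬ Pack (IsCopy G H) Finset.univ n) (hG' : ¬ Pack (IsCopy Gᶜ H) Finset.univ n)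
    (S : Finset W) : ∃ (L : Finset W) (s : ℕ), Disjoint S L ∧ s < n ∧
      S.card + L.card + (2 * Fintype.card V - H.indepNum) * s = Fintype.card W ∧
      (∀ T ⊆ L, ¬ IsTieSet G H T) ∧
      (∀ ν, Pack (IsCopy G H) (S ∪ L) ν → ν + s < n) ∧
      ∀ ν, Pack (IsCopy Gᶜ H) (S ∪ L) ν → ν + s < n := by
  obtain ⟨F, h1, h2, h3⟩ := exists_maximal_packing (IsTieSet G H) (Finset.univ \ S)
  -- Every deleted tie supplies one copy in each colour, so both bounds outside the ties drop by
  -- their number.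
  have hpackG : Pack (IsCopy G H) (F.biUnion id) F.card := by
    have := Pack.biUnion (P := IsCopy G H) F id (fun _ => 1) (fun T hT => by
      obtain ⟨A, hA, hAc⟩ := (h1.2 T hT).2.1
      exact (Pack.one hAc.nonempty hAc).mono hA) h1.3
    simpa using this
  have hpackG' : Pack (IsCopy Gᶜ H) (F.biUnion id) F.card := by
    have := Pack.biUnion (P := IsCopy Gᶜ H) F id (fun _ => 1) (fun T hT => by
      obtain ⟨A, hA, hAc⟩ := (h1.2 T hT).2.2
      exact (Pack.one hAc.nonempty hAc).mono hA) h1.3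
    simpa using this
  have hd : Disjoint (S ∪ (Finset.univ \ S) \ F.biUnion id) (F.biUnion id) := by
    rw [Finset.disjoint_union_left]
    exact ⟨Finset.disjoint_sdiff.mono_right h2, Finset.sdiff_disjoint⟩
  have key : ∀ G' : SimpleGraph W, ¬ Pack (IsCopy G' H) Finset.univ n →
      Pack (IsCopy G' H) (F.biUnion id) F.card →
      ∀ ν, Pack (IsCopy G' H) (S ∪ (Finset.univ \ S) \ F.biUnion id) ν → ν + F.card < n := by
    intro G' hG' hF ν hν
    by_contra hlt
    exact hG' (Pack.add' hν hF hd (Finset.subset_univ _) (Finset.subset_univ _) (by omega))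
  refine ⟨(Finset.univ \ S) \ F.biUnion id, F.card, ?_, ?_, ?_, ?_, key G hG hpackG,
    key Gᶜ hG' hpackG'⟩
  · exact Finset.disjoint_sdiff.mono_right Finset.sdiff_subset
  · simpa using key G hG hpackG 0 (Pack.zero _ _)
  · rw [← h1.card_biUnion_eq fun A hA => (h1.2 A hA).1, add_assoc,
      Finset.card_sdiff_add_card_eq_card h2, add_comm,
      Finset.card_sdiff_add_card_eq_card (Finset.subset_univ _), Finset.card_univ]
  · intro T hT hTie
    refine h3 T hT ?_ hTie
    obtain ⟨A, hA, hAc⟩ := hTie.2.1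
    exact hAc.nonempty.mono hA

/-- Let μ be the number of copies packed into `L` in its better colour, so |L| ≤ kμ + 2^(7k). As `S`
holds ν copies in either colour, ν + μ + s < n, and the lower bound on N gives κ(ν + μ) ≤ |S| + |L|
with κ = 2k - α(H). Eliminating μ and using κ ≥ k + 1 leaves |L| with coefficient at least 1. -/
theorem card_bound_of_pack [Fintype V] [Nonempty V] {G : SimpleGraph W} {H : SimpleGraph V}
    (hα : H.indepNum < Fintype.card V) {N n s ν : ℕ} {S L : Finset W}
    (hN : (2 * Fintype.card V - H.indepNum) * n ≤ N + 2) (hSL : Disjoint S L)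
    (hcard : S.card + L.card + (2 * Fintype.card V - H.indepNum) * s = N)
    (hties : ∀ T ⊆ L, ¬ IsTieSet G H T)
    (hred : ∀ ν, Pack (IsCopy G H) (S ∪ L) ν → ν + s < n)
    (hblue : ∀ ν, Pack (IsCopy Gᶜ H) (S ∪ L) ν → ν + s < n)
    (hSr : Pack (IsCopy G H) S ν) (hSb : Pack (IsCopy Gᶜ H) S ν) :
    L.card + Fintype.card V * ((2 * Fintype.card V - H.indepNum) * ν) ≤
      Fintype.card V * S.card +
        (2 * Fintype.card V - H.indepNum) * 2 ^ (7 * Fintype.card V) := by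
  obtain ⟨μ, hμ, hLμ⟩ := pack_of_tie_free hα.le hties
  set k := Fintype.card V
  set κ := 2 * k - H.indepNum with hκ
  have hkκ : k + 1 ≤ κ := by omega
  set D := 2 ^ (7 * k)
  have h1 : ν + μ + s < n := by
    rcases hμ with hμ | hμ
    · exact hred _ (hSr.add hμ hSL)
    · exact hblue _ (hSb.add hμ hSL)
  have h2 : κ * (ν + μ + s + 1) ≤ κ * n := Nat.mul_le_mul_left _ h1
  have h3 : κ * (ν + μ + s + 1) = κ * ν + κ * μ + κ * s + κ := by ring
  have hk1 : 1 ≤ k := Fintype.card_pos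
  have h4 : κ * ν + κ * μ ≤ S.card + L.card := by omega
  have h5 : k * (κ * ν + κ * μ) ≤ k * (S.card + L.card) := Nat.mul_le_mul_left _ h4
  have h6 : κ * L.card ≤ κ * (k * μ + D) := Nat.mul_le_mul_left _ hLμ
  have h7 : (k + 1) * L.card ≤ κ * L.card := Nat.mul_le_mul_right _ hkκ
  have h8 : k * (κ * ν + κ * μ) = k * (κ * ν) + κ * (k * μ) := by ring
  rw [mul_add] at h5 h6
  rw [add_mul] at h7
  have h9 : k * (κ * ν) + κ * (k * μ) ≤ k * S.card + k * L.card := by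
    calc _ = k * (κ * ν) + k * (κ * μ) := by ring
      _ ≤ _ := by rw [← mul_add k S.card]; exact h5
  omega

/-- A colouring without a monochromatic copy of `nH` on almost `(2|H| - α(H)) n` vertices. -/
structure Extremal [Fintype W] [Fintype V] (G : SimpleGraph W) (H : SimpleGraph V) (n : ℕ) :
    Prop where
  red : ¬ Pack (IsCopy G H) Finset.univ n
  blue : ¬ Pack (IsCopy Gᶜ H) Finset.univ n
  card : (2 * Fintype.card V - H.indepNum) * n ≤ Fintype.card W + 2
  indep : H.indepNum < Fintype.card V

theorem Extremal.compl [Fintype W] [Fintype V] {G : SimpleGraph W} {H : SimpleGraph V} {n : ℕ}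
    (h : Extremal G H n) : Extremal Gᶜ H n :=
  ⟨h.blue, by rw [compl_compl]; exact h.red, h.card, h.indep⟩

theorem Extremal.reduct [Fintype W] [Fintype V] [Nonempty V] {G : SimpleGraph W}
    {H : SimpleGraph V} {n : ℕ} (h : Extremal G H n) (S : Finset W) :
    ∃ (L : Finset W) (s : ℕ), Disjoint S L ∧ s < n ∧
      S.card + L.card + (2 * Fintype.card V - H.indepNum) * s = Fintype.card W ∧
      (∀ ν, Pack (IsCopy G H) (S ∪ L) ν → ν + s < n) ∧
      (∀ ν, Pack (IsCopy Gᶜ H) (S ∪ L) ν → ν + s < n) ∧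
      ∀ ν, Pack (IsCopy G H) S ν → Pack (IsCopy Gᶜ H) S ν →
        L.card + Fintype.card V * ((2 * Fintype.card V - H.indepNum) * ν) ≤
          Fintype.card V * S.card +
            (2 * Fintype.card V - H.indepNum) * 2 ^ (7 * Fintype.card V) := by
  obtain ⟨L, s, h1, h2, h3, h4, h5, h6⟩ := exists_reduct h.red h.blue S
  exact ⟨L, s, h1, h2, h3, h5, h6, fun ν hr hb =>
    card_bound_of_pack h.indep h.card h1 h3 h4 h5 h6 hr hb⟩

/-- The form used for contradictions: no set beats the rate of one copy in both colours per κ = 2k -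
α(H) vertices by more than an additive constant. -/
theorem Extremal.gain [Fintype W] [Fintype V] [Nonempty V] {G : SimpleGraph W}
    {H : SimpleGraph V} {n : ℕ} (h : Extremal G H n) {S : Finset W} {ν : ℕ}
    (hr : Pack (IsCopy G H) S ν) (hb : Pack (IsCopy Gᶜ H) S ν) :
    Fintype.card V * ((2 * Fintype.card V - H.indepNum) * ν) ≤ Fintype.card V * S.card +
      (2 * Fintype.card V - H.indepNum) * 2 ^ (7 * Fintype.card V) := by
  obtain ⟨L, s, -, -, -, -, -, h6⟩ := h.reduct S
  have := h6 ν hr hb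
  omega

/-- There is a large vertex set without a large red clique. -/
theorem Extremal.exists_pool [Fintype W] [Fintype V] [Nonempty V] {G : SimpleGraph W}
    {H : SimpleGraph V} {n : ℕ} (h : Extremal G H n) (hk : 2 ≤ Fintype.card V) :
    ∃ A : Finset W, NoClique G (Fintype.card V) A ∧ n ≤ A.card := by
  obtain ⟨F, h1, h2, h3⟩ := exists_maximal_packing (G.IsNClique (Fintype.card V)) Finset.univ
  refine ⟨Finset.univ \ F.biUnion id, fun B hB hBc => h3 B hB ?_ hBc, ?_⟩
  · rw [← Finset.card_pos, hBc.2]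
    omega
  · have hFn : F.card < n := by
      by_contra hlt
      push Not at hlt
      exact h.red (((h1.imp fun A hA => isCopy_of_clique H hA).pack.mono h2).le hlt)
    have h4 := Finset.card_sdiff_add_card_eq_card h2
    rw [h1.card_cliques, Finset.card_univ] at h4
    have h5 := h.card
    have h6 := h.indep
    set k := Fintype.card V
    -- Fewer than n red k-cliques cover at most k(n - 1) vertices, whereas κ ≥ k + 1 forces about (k
    -- + 1)n vertices in total.
    have h7 : (k + 1) * n ≤ (2 * k - H.indepNum) * n := Nat.mul_le_mul_right _ (by omega)
    have h8 : k * (F.card + 1) ≤ k * n := Nat.mul_le_mul_left _ hFn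
    have h9 : (k + 1) * n = k * n + n := by ring
    have h10 : k * (F.card + 1) = k * F.card + k := by ring
    omega

/-! ### Pairs of cliques and the two pools -/

/-- `T` consists of a red clique in `A` and a blue clique in `B` with all edges between them
blue. -/
def IsPair (G : SimpleGraph W) (k : ℕ) (A B T : Finset W) : Prop :=
  ∃ X Y, X ∪ Y = T ∧ Disjoint X Y ∧ X ⊆ A ∧ Y ⊆ B ∧ G.IsNClique k X ∧ Gᶜ.IsNClique k Y ∧
    ∀ x ∈ X, ∀ y ∈ Y, Gᶜ.Adj x y

/-- Take a blue 2k-clique in `B`, a large part of `A` uniform towards it, and a red k-clique in that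
part. Half of the blue clique is joined to it in one colour; if that colour is red, the roles of the
colours and of the pools are exchanged. -/
theorem exists_isPair {G : SimpleGraph W} {k : ℕ} (hk : 1 ≤ k) {A B : Finset W}
    (hA : NoClique Gᶜ k A) (hB : NoClique G k B) (hAc : 2 ^ (5 * k) ≤ A.card)
    (hBc : 2 ^ (5 * k) ≤ B.card) : ∃ T ⊆ A ∪ B, IsPair G k A B T ∨ IsPair Gᶜ k B A T := by
  obtain ⟨Y', hY', hY'c⟩ := hB.exists_clique' (2 * k)
    (le_trans (Nat.pow_le_pow_right (by norm_num) (by omega)) hBc)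
  obtain ⟨Z, hZ, R, -, hZc, hZu⟩ := exists_uniform G Y' (A \ Y')
  rw [hY'c.2] at hZc
  have hZlarge : 2 ^ (k + k) ≤ Z.card := by
    by_contra hlt
    push Not at hlt
    have h1 : 2 ^ (2 * k) * Z.card ≤ 2 ^ (2 * k) * 2 ^ (k + k) := Nat.mul_le_mul_left _ hlt.le
    have h2 := Finset.le_card_sdiff Y' A
    rw [hY'c.2] at h2
    rw [← pow_add] at h1
    have h3 : 2 ^ (5 * k) = 2 ^ (2 * k + (k + k)) * 2 ^ k := by rw [← pow_add]; congr 1; ring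
    have h4 : k + 1 ≤ 2 ^ k := Nat.lt_two_pow_self
    have h5 : 2 * k + (k + k) < 2 ^ (2 * k + (k + k)) := Nat.lt_two_pow_self
    have h6 : 2 ^ (2 * k + (k + k)) * 2 ≤ 2 ^ (2 * k + (k + k)) * 2 ^ k :=
      Nat.mul_le_mul_left _ (by omega)
    omega
  have hZA : Z ⊆ A := hZ.trans Finset.sdiff_subset
  obtain ⟨X, hX, hXc⟩ := (hA.subset hZA).exists_clique k hZlarge
  have hd : Disjoint Y' X := Finset.disjoint_sdiff.mono_right (hX.trans hZ)
  obtain ⟨Y, hY, hYc, h⟩ := exists_half (G := G) hY'c.2 hd fun z hz => hZu z (hX hz)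
  have hYc' := isNClique_of_subset hY'c hY hYc
  refine ⟨X ∪ Y, Finset.union_subset_union (hX.trans hZA) (hY.trans hY'), ?_⟩
  rcases h with h | h
  · refine Or.inr ⟨Y, X, Finset.union_comm _ _, hd.mono_left hY, hY.trans hY', hX.trans hZA, hYc',
      by rwa [compl_compl], ?_⟩
    rw [compl_compl]
    exact h
  · exact Or.inl ⟨X, Y, rfl, (hd.mono_left hY).symm, hX.trans hZA, hY.trans hY', hXc, hYc',
      fun x hx y hy => (h y hy x hx).symm⟩

/-- `M` disjoint pairs of a red and a blue clique, all whose edges in between are blue. -/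
def HasPairs (G : SimpleGraph W) (k M : ℕ) : Prop :=
  ∃ A B F, NoClique Gᶜ k A ∧ NoClique G k B ∧ IsPacking (IsPair G k A B) F ∧ F.card = M

/-- As long as fewer than 2M pairs are removed, both pools stay large enough for another one. Half
of the pairs agree in the colour of their connecting edges. -/
theorem Extremal.hasPairs [Fintype W] [Fintype V] [Nonempty V] {G : SimpleGraph W}
    {H : SimpleGraph V} {n M : ℕ} (h : Extremal G H n) (hk : 2 ≤ Fintype.card V)
    (hn : 2 ^ (5 * Fintype.card V) + 4 * Fintype.card V * M ≤ n) :
    HasPairs G (Fintype.card V) M ∨ HasPairs Gᶜ (Fintype.card V) M := by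
  obtain ⟨B, hB, hBn⟩ := h.exists_pool hk
  obtain ⟨A, hA, hAn⟩ := h.compl.exists_pool hk
  set k := Fintype.card V
  obtain ⟨F, h1, h2, h3⟩ := exists_maximal_packing
    (fun T => IsPair G k A B T ∨ IsPair Gᶜ k B A T) (A ∪ B)
  have hFc : (F.biUnion id).card = (k + k) * F.card := by
    apply h1.card_biUnion_eq
    intro T hT
    rcases h1.2 T hT with ⟨X, Y, rfl, hd, -, -, hX, hY, -⟩ | ⟨X, Y, rfl, hd, -, -, hX, hY, -⟩ <;>
      rw [Finset.card_union_of_disjoint hd, hX.2, hY.2]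
  have hF : 2 * M ≤ F.card := by
    by_contra hlt
    have h4 : (k + k) * F.card ≤ (k + k) * (2 * M) := Nat.mul_le_mul_left _ (by omega)
    have h5 : (k + k) * (2 * M) = 4 * k * M := by ring
    have h6 := Finset.le_card_sdiff (F.biUnion id) A
    have h7 := Finset.le_card_sdiff (F.biUnion id) B
    obtain ⟨T, hT, hTp⟩ := exists_isPair (G := G) (k := k) (by omega)
      (hA.subset (Finset.sdiff_subset (t := F.biUnion id)))
      (hB.subset (Finset.sdiff_subset (t := F.biUnion id))) (by omega) (by omega)
    refine h3 T ?_ ?_ ?_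
    · rwa [Finset.union_sdiff_distrib]
    · rcases hTp with ⟨X, Y, rfl, -, -, -, hX, -⟩ | ⟨X, Y, rfl, -, -, -, hX, -⟩ <;>
      · rw [← Finset.card_pos]
        exact lt_of_lt_of_le (by rw [hX.2]; omega) (Finset.card_le_card Finset.subset_union_left)
    · rcases hTp with ⟨X, Y, e, hd, hX, hY, h⟩ | ⟨X, Y, e, hd, hX, hY, h⟩
      · exact Or.inl ⟨X, Y, e, hd, hX.trans Finset.sdiff_subset, hY.trans Finset.sdiff_subset, h⟩
      · exact Or.inr ⟨X, Y, e, hd, hX.trans Finset.sdiff_subset, hY.trans Finset.sdiff_subset, h⟩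
  have hsplit := Finset.card_filter_add_card_filter_not (s := F) (fun T => IsPair G k A B T)
  by_cases hc : M ≤ (F.filter fun T => IsPair G k A B T).card
  · left
    obtain ⟨F', hF', hc'⟩ := Finset.exists_subset_card_eq hc
    have hsub : F' ⊆ F := hF'.trans (Finset.filter_subset _ _)
    exact ⟨A, B, F', hA, hB, ⟨fun T hT => h1.1 T (hsub hT),
      fun T hT => (Finset.mem_filter.1 (hF' hT)).2, (h1.subset hsub).3⟩, hc'⟩
  · right
    obtain ⟨F', hF', hc'⟩ := Finset.exists_subset_card_eq
      (show M ≤ (F.filter fun T => ¬ IsPair G k A B T).card by omega)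
    have hsub : F' ⊆ F := hF'.trans (Finset.filter_subset _ _)
    exact ⟨B, A, F', by rwa [compl_compl], hA, ⟨fun T hT => h1.1 T (hsub hT),
      fun T hT => (h1.2 T (hsub hT)).resolve_left (Finset.mem_filter.1 (hF' hT)).2,
      (h1.subset hsub).3⟩, hc'⟩

/-- From many pairs of cliques one obtains large sets `X` and `Y`, without large blue and red
cliques respectively, such that every vertex of `Y` sends few red edges to `X`. -/
theorem Extremal.exists_blue_pools [Fintype W] [Fintype V] [Nonempty V] {G : SimpleGraph W}
    {H : SimpleGraph V} {n M : ℕ} (h : Extremal G H n)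
    (hM : Fintype.card V * 2 ^ (9 * Fintype.card V) + 2 ^ (2 * Fintype.card V) ≤ M)
    (hP : HasPairs G (Fintype.card V) (M + 2 ^ (9 * Fintype.card V))) :
    ∃ X Y : Finset W, Disjoint X Y ∧ NoClique Gᶜ (Fintype.card V) X ∧
      NoClique G (Fintype.card V) Y ∧ X.card = Fintype.card V * M ∧
      Y.card ≤ (Fintype.card V - H.indepNum) * M ∧
      (Fintype.card V - H.indepNum) * M ≤
        Y.card + Fintype.card V * 2 ^ (9 * Fintype.card V) ∧
      ∀ y ∈ Y, (X.filter (G.Adj y)).card < 2 ^ (12 * Fintype.card V) := by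
  obtain ⟨A, B, F, hA, hB, hF, hFc⟩ := hP
  have hi := h.indep
  have hk1 : 1 ≤ Fintype.card V := Fintype.card_pos
  have hgain := fun (S : Finset W) (ν : ℕ) (hr : Pack (IsCopy G H) S ν)
    (hb : Pack (IsCopy Gᶜ H) S ν) => h.gain hr hb
  have hcopy : ∀ A, G.IsNClique (Fintype.card V) A → IsCopy G H A := fun A hA =>
    isCopy_of_clique H hA
  have hcopy' : ∀ A, Gᶜ.IsNClique (Fintype.card V) A → IsCopy Gᶜ H A := fun A hA =>
    isCopy_of_clique H hA
  have hjoin := fun (I Q : Finset W) (hIQ : Disjoint I Q) (hI : I.card = H.indepNum)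
    (hQ : Gᶜ.IsNClique (Fintype.card V - H.indepNum) Q) (hadj : ∀ x ∈ I, ∀ y ∈ Q, Gᶜ.Adj x y) =>
    isCopy_of_join H hIQ hI hQ hadj
  set k := Fintype.card V with hk
  set i := H.indepNum
  set g := 2 ^ (9 * k) with hg
  have hgpos : 0 < 2 ^ (9 * k) := by positivity
  have h2pos : 0 < 2 ^ (2 * k) := by positivity
  have hchoose : ∀ T : Finset W, ∃ X Y : Finset W, T ∈ F → X ∪ Y = T ∧ Disjoint X Y ∧ X ⊆ A ∧
      Y ⊆ B ∧ G.IsNClique k X ∧ Gᶜ.IsNClique k Y ∧ ∀ x ∈ X, ∀ y ∈ Y, Gᶜ.Adj x y := by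
    intro T
    by_cases hT : T ∈ F
    · obtain ⟨X, Y, h⟩ := hF.2 T hT
      exact ⟨X, Y, fun _ => h⟩
    · exact ⟨∅, ∅, fun h => absurd h hT⟩
  choose X Y hXY using hchoose
  have hsubs : ∀ T, ∃ Q ⊆ Y T, ∃ I ⊆ X T, T ∈ F → Q.card = k - i ∧ I.card = i := by
    intro T
    by_cases hT : T ∈ F
    · obtain ⟨-, -, -, -, h1, h2, -⟩ := hXY T hT
      obtain ⟨Q, hQ, hQc⟩ := Finset.exists_subset_card_eq
        (show k - i ≤ (Y T).card by rw [h2.2]; exact Nat.sub_le _ _)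
      obtain ⟨I, hI, hIc⟩ := Finset.exists_subset_card_eq
        (show i ≤ (X T).card by rw [h1.2]; exact hi.le)
      exact ⟨Q, hQ, I, hI, fun _ => ⟨hQc, hIc⟩⟩
    · exact ⟨∅, by simp, ∅, by simp, fun h => absurd h hT⟩
  choose Q hQY I hIX hQI using hsubs
  have hXT : ∀ T ∈ F, X T ⊆ T := fun T hT => by
    conv_rhs => rw [← (hXY T hT).1]
    exact Finset.subset_union_left
  have hYT : ∀ T ∈ F, Y T ⊆ T := fun T hT => by
    conv_rhs => rw [← (hXY T hT).1]
    exact Finset.subset_union_right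
  have hQT : ∀ T ∈ F, Q T ⊆ T := fun T hT => (hQY T).trans (hYT T hT)
  obtain ⟨F1, hF1, hF1c⟩ := Finset.exists_subset_card_eq (show M ≤ F.card by omega)
  have hF2c : (F \ F1).card = g := by rw [Finset.card_sdiff_of_subset hF1]; omega
  have hdisj : ∀ P P' : Finset W → Finset W, (∀ T ∈ F, P T ⊆ T) → (∀ T ∈ F, P' T ⊆ T) →
      ∀ T ∈ F, ∀ T' ∈ F, T ≠ T' → Disjoint (P T) (P' T') :=
    fun P P' hP hP' T hT T' hT' hne => (hF.3 T hT T' hT' hne).mono (hP T hT) (hP' T' hT')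
  have hne2 : ∀ {T T'}, T ∈ F1 → T' ∈ F \ F1 → T ≠ T' := fun hT hT' he =>
    (Finset.mem_sdiff.1 hT').2 (he ▸ hT)
  set X0 := F1.biUnion X with hX0
  set Y0 := F1.biUnion Q with hY0
  set Z := (F \ F1).biUnion Y with hZ
  have hX0A : X0 ⊆ A := Finset.biUnion_subset.2 fun T hT => (hXY T (hF1 hT)).2.2.1
  have hY0B : Y0 ⊆ B := Finset.biUnion_subset.2 fun T hT =>
    (hQY T).trans (hXY T (hF1 hT)).2.2.2.1
  have hX0c : X0.card = k * M := by
    rw [hX0, Finset.card_biUnion fun T hT T' hT' hne =>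
      hdisj X X hXT hXT T (hF1 hT) T' (hF1 hT') hne,
      Finset.sum_congr rfl fun T hT => (hXY T (hF1 hT)).2.2.2.2.1.2, Finset.sum_const, hF1c,
      smul_eq_mul, mul_comm]
  have hY0c : Y0.card = (k - i) * M := by
    rw [hY0, Finset.card_biUnion fun T hT T' hT' hne =>
      hdisj Q Q hQT hQT T (hF1 hT) T' (hF1 hT') hne,
      Finset.sum_congr rfl fun T hT => (hQI T (hF1 hT)).1, Finset.sum_const, hF1c,
      smul_eq_mul, mul_comm]
  have hZc : Z.card = k * g := by
    rw [hZ, Finset.card_biUnion fun T hT T' hT' hne =>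
      hdisj Y Y hYT hYT T (Finset.sdiff_subset hT) T' (Finset.sdiff_subset hT') hne,
      Finset.sum_congr rfl fun T hT => (hXY T (Finset.sdiff_subset hT)).2.2.2.2.2.1.2,
      Finset.sum_const, hF2c, smul_eq_mul, mul_comm]
  have hXYd : Disjoint X0 Y0 := by
    rw [hX0, hY0, Finset.disjoint_biUnion_left]
    intro T hT
    rw [Finset.disjoint_biUnion_right]
    intro T' hT'
    by_cases he : T = T'
    · subst he
      exact (hXY T (hF1 hT)).2.1.mono_right (hQY T)
    · exact hdisj X Q hXT hQT T (hF1 hT) T' (hF1 hT') he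
  have hZd : Disjoint (X0 ∪ Y0) Z := by
    rw [hZ, Finset.disjoint_biUnion_right]
    intro T' hT'
    rw [Finset.disjoint_union_left, hX0, hY0, Finset.disjoint_biUnion_left,
      Finset.disjoint_biUnion_left]
    exact ⟨fun T hT => hdisj X Y hXT hYT T (hF1 hT) T' (Finset.sdiff_subset hT') (hne2 hT hT'),
      fun T hT => hdisj Q Y hQT hYT T (hF1 hT) T' (Finset.sdiff_subset hT') (hne2 hT hT')⟩
  set bad := Y0.filter fun y => 2 ^ (12 * k) ≤ (X0.filter (G.Adj y)).card with hbad
  -- Otherwise kg bad vertices of `Y0` each enter a red k-clique with k - 1 vertices of `X0`, which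
  -- yields about g red copies beyond the M in `X0`; `Z` yields g additional blue copies.
  have hbadc : bad.card ≤ k * g := by
    by_contra hlt
    push Not at hlt
    obtain ⟨T, hT, hTc⟩ := Finset.exists_subset_card_eq hlt.le
    have hTY : T ⊆ Y0 := hT.trans (Finset.filter_subset _ _)
    have hTX : Disjoint T X0 := (hXYd.mono_right hTY).symm
    have hk2 : k ≤ 2 ^ k := Nat.lt_two_pow_self.le
    have hkk : k * (k * g) ≤ 2 ^ (11 * k) := by
      calc k * (k * g) ≤ 2 ^ k * (2 ^ k * 2 ^ (9 * k)) :=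
            Nat.mul_le_mul hk2 (Nat.mul_le_mul_right _ hk2)
        _ = 2 ^ (11 * k) := by rw [← pow_add, ← pow_add]; congr 1; ring
    have h12 : 2 ^ (11 * k) * 2 ≤ 2 ^ (12 * k) := by
      rw [← pow_succ]
      exact Nat.pow_le_pow_right (by norm_num) (by omega)
    have h22 : 2 ^ (2 * k) ≤ 2 ^ (11 * k) := Nat.pow_le_pow_right (by norm_num) (by omega)
    obtain ⟨C, hC, hCc, hCp⟩ := pack_attach_vertices (G := G) (D := ∅) (Θ := 2 ^ (12 * k)) hk1
      (le_refl k) (hA.subset hX0A) T hTX (by rw [hTc, Finset.card_empty]; omega)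
      fun w hw => (Finset.mem_filter.1 (hT hw)).2
    rw [Finset.sdiff_empty] at hC
    have hm0 : (k - 1) * g + 2 ^ (2 * k) ≤ M := by
      have : (k - 1) * g ≤ k * g := Nat.mul_le_mul_right _ (by omega)
      omega
    -- The number of red k-cliques still guaranteed in `X0` after k(k - 1)g of its vertices are
    -- spent on bad vertices; 2^(2k) is the Ramsey remainder.
    set m := M - ((k - 1) * g + 2 ^ (2 * k)) with hm
    have hkm : k * m + (k * ((k - 1) * g) + k * 2 ^ (2 * k)) = k * M := by
      rw [← mul_add, ← mul_add, hm, Nat.sub_add_cancel hm0]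
    have hpow : 2 ^ (2 * k) ≤ k * 2 ^ (2 * k) := Nat.le_mul_of_pos_left _ hk1
    have hXC : (X0 \ C).card + k * ((k - 1) * g) = k * M := by
      have := Finset.card_sdiff_add_card_eq_card hC
      rw [hCc, hTc, hX0c] at this
      rw [← this]
      ring
    have hp1 : Pack (G.IsNClique k) (X0 \ C) m := by
      refine (hA.subset (Finset.sdiff_subset.trans hX0A)).pack hk1 ?_
      rw [← two_mul]
      omega
    have hkg : k * g = (k - 1) * g + g := by
      rw [← Nat.succ_mul, Nat.succ_eq_add_one, Nat.sub_add_cancel hk1]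
    have hsum : k * g + m + 2 ^ (2 * k) = M + g := by omega
    have hred : Pack (IsCopy G H) (X0 ∪ Y0 ∪ Z) (k * g + m) := by
      refine Pack.add' (hCp.imp hcopy) (hp1.imp hcopy) ?_ ?_ ?_ (by rw [hTc])
      · rw [Finset.disjoint_union_left]
        exact ⟨hTX.mono_right Finset.sdiff_subset, Finset.disjoint_sdiff⟩
      · refine Finset.Subset.trans ?_ Finset.subset_union_left
        exact Finset.union_subset (hTY.trans Finset.subset_union_right)
          (hC.trans Finset.subset_union_left)
      · exact Finset.sdiff_subset.trans (Finset.subset_union_left.trans Finset.subset_union_left)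
    have hblue1 : Pack (IsCopy Gᶜ H) (X0 ∪ Y0) M := by
      have h1 := Pack.biUnion (P := IsCopy Gᶜ H) F1 (fun T => I T ∪ Q T) (fun _ => 1)
        (fun T hT => by
          have h2 := hXY T (hF1 hT)
          have h3 := hjoin (I T) (Q T) (h2.2.1.mono (hIX T) (hQY T)) (hQI T (hF1 hT)).2
            (isNClique_of_subset h2.2.2.2.2.2.1 (hQY T) (hQI T (hF1 hT)).1)
            fun x hx y hy => h2.2.2.2.2.2.2 x (hIX T hx) y (hQY T hy)
          exact Pack.one h3.nonempty h3)
        (fun T hT T' hT' hne => hdisj _ _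
          (fun T hT => Finset.union_subset ((hIX T).trans (hXT T hT)) (hQT T hT))
          (fun T hT => Finset.union_subset ((hIX T).trans (hXT T hT)) (hQT T hT))
          T (hF1 hT) T' (hF1 hT') hne)
      refine (h1.mono ?_).le (by simp [hF1c])
      refine Finset.biUnion_subset.2 fun T hT => Finset.union_subset_union ?_ ?_
      · exact (hIX T).trans (Finset.subset_biUnion_of_mem X hT)
      · exact Finset.subset_biUnion_of_mem Q hT
    have hblue2 : Pack (IsCopy Gᶜ H) Z g := by
      have h1 := Pack.biUnion (P := IsCopy Gᶜ H) (F \ F1) Y (fun _ => 1)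
        (fun T hT => by
          have h3 := hcopy' _ (hXY T (Finset.sdiff_subset hT)).2.2.2.2.2.1
          exact Pack.one h3.nonempty h3)
        (fun T hT T' hT' hne => hdisj Y Y hYT hYT T (Finset.sdiff_subset hT) T'
          (Finset.sdiff_subset hT') hne)
      exact h1.le (by simp [hF2c])
    have hblue : Pack (IsCopy Gᶜ H) (X0 ∪ Y0 ∪ Z) (k * g + m) :=
      (hblue1.add hblue2 hZd).le (by omega)
    -- There are M + g - 2^(2k) copies in each colour on only κM + kg vertices. The surplus is of
    -- order (k - i)g with g = 2^(9k), which exceeds the error terms of order 2^(2k) and 2^(7k).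
    have hfin := hgain _ _ hred hblue
    rw [Finset.card_union_of_disjoint hZd, Finset.card_union_of_disjoint hXYd, hX0c, hY0c,
      hZc] at hfin
    obtain ⟨j, hj⟩ : ∃ j, k = i + j + 1 := ⟨k - i - 1, by omega⟩
    have hκ : 2 * k - i = k + j + 1 := by omega
    have hki : k - i = j + 1 := by omega
    rw [hκ, hki] at hfin
    have e1 : k * ((k + j + 1) * (k * g + m)) + k * ((k + j + 1) * 2 ^ (2 * k))
        = k * ((k + j + 1) * (M + g)) := by rw [← hsum]; ring
    have e2 : k * ((k + j + 1) * (M + g)) = k * (k * M + (j + 1) * M + k * g)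
        + k * ((j + 1) * g) := by ring
    have e3 : k * ((j + 1) * g) ≤ k * ((k + j + 1) * 2 ^ (2 * k))
        + (k + j + 1) * 2 ^ (7 * k) := by omega
    have hle : k + j + 1 ≤ 2 * k := by omega
    have e4 : k * ((k + j + 1) * 2 ^ (2 * k)) ≤ k * (2 * k * 2 ^ (2 * k)) :=
      Nat.mul_le_mul_left _ (Nat.mul_le_mul_right _ hle)
    have e5 : (k + j + 1) * 2 ^ (7 * k) ≤ k * (2 * 2 ^ (7 * k)) := by
      calc _ ≤ 2 * k * 2 ^ (7 * k) := Nat.mul_le_mul_right _ hle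
        _ = _ := by ring
    have e6 : k * g ≤ k * ((j + 1) * g) := Nat.mul_le_mul_left _ (Nat.le_mul_of_pos_left _ (by omega))
    have e7 : k * g ≤ k * (2 * k * 2 ^ (2 * k) + 2 * 2 ^ (7 * k)) := by rw [mul_add k]; omega
    have e8 : g ≤ 2 * k * 2 ^ (2 * k) + 2 * 2 ^ (7 * k) := Nat.le_of_mul_le_mul_left e7 hk1
    have e9 : 2 * k * 2 ^ (2 * k) ≤ 2 ^ (7 * k) := by
      calc 2 * k * 2 ^ (2 * k) = k * 2 ^ (2 * k + 1) := by ring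
        _ ≤ 2 ^ k * 2 ^ (2 * k + 1) := Nat.mul_le_mul_right _ hk2
        _ = 2 ^ (3 * k + 1) := by rw [← pow_add]; congr 1; ring
        _ ≤ 2 ^ (7 * k) := Nat.pow_le_pow_right (by norm_num) (by omega)
    have e10 : 2 ^ (7 * k) * 4 ≤ g := by
      calc 2 ^ (7 * k) * 4 = 2 ^ (7 * k + 2) := by ring
        _ ≤ 2 ^ (9 * k) := Nat.pow_le_pow_right (by norm_num) (by omega)
    have : 0 < 2 ^ (7 * k) := by positivity
    omega
  refine ⟨X0, Y0 \ bad, hXYd.mono_right Finset.sdiff_subset, hA.subset hX0A,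
    hB.subset (Finset.sdiff_subset.trans hY0B), hX0c, ?_, ?_, ?_⟩
  · rw [← hY0c]
    exact Finset.card_le_card Finset.sdiff_subset
  · have := Finset.card_sdiff_add_card_eq_card (Finset.filter_subset
      (fun y => 2 ^ (12 * k) ≤ (X0.filter (G.Adj y)).card) Y0)
    rw [← hbad] at this
    omega
  · intro y hy
    rw [Finset.mem_sdiff, hbad, Finset.mem_filter, not_and, not_le] at hy
    exact hy.2 hy.1

/-! ### The ideal colouring and the replacement of copies -/

/-- The graph which agrees with `G` inside `E`, is complete inside `R` and between `B` and `E`, and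
has no other edges. -/
def st (G : SimpleGraph W) (R B E : Finset W) : SimpleGraph W where
  Adj x y := x ≠ y ∧ ((x ∈ R ∧ y ∈ R) ∨ (x ∈ B ∧ y ∈ E) ∨ (x ∈ E ∧ y ∈ B) ∨
    (x ∈ E ∧ y ∈ E ∧ G.Adj x y))
  symm := ⟨fun x y h => ⟨h.1.symm, by
    rcases h.2 with h | h | h | h
    · exact Or.inl ⟨h.2, h.1⟩
    · exact Or.inr (Or.inr (Or.inl ⟨h.2, h.1⟩))
    · exact Or.inr (Or.inl ⟨h.2, h.1⟩)
    · exact Or.inr (Or.inr (Or.inr ⟨h.2.1, h.1, h.2.2.symm⟩))⟩⟩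
  loopless := ⟨fun _ h => h.1 rfl⟩

theorem st_adj {G : SimpleGraph W} {R B E : Finset W} {x y : W} : (st G R B E).Adj x y ↔
    x ≠ y ∧ ((x ∈ R ∧ y ∈ R) ∨ (x ∈ B ∧ y ∈ E) ∨ (x ∈ E ∧ y ∈ B) ∨
      (x ∈ E ∧ y ∈ E ∧ G.Adj x y)) := Iff.rfl

theorem exists_image_eq {S C : Finset W} (h : S.card = C.card) :
    ∃ f : W → W, Set.InjOn f S ∧ S.image f = C := by
  have e := Finset.equivOfCardEq h
  refine ⟨fun x => if hx : x ∈ S then (e ⟨x, hx⟩ : W) else x, ?_, ?_⟩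
  · intro x hx y hy hxy
    simp only [Finset.mem_coe] at hx hy
    simp only [hx, hy, dif_pos] at hxy
    have := e.injective (Subtype.ext hxy)
    simpa using this
  · ext z
    simp only [Finset.mem_image]
    constructor
    · rintro ⟨x, hx, rfl⟩
      simp only [hx, dif_pos]
      exact (e ⟨x, hx⟩).2
    · intro hz
      refine ⟨e.symm ⟨z, hz⟩, (e.symm ⟨z, hz⟩).2, ?_⟩
      simp

/-- Only the sizes of the traces of `S` on `R` and `B` matter: they are moved to `C` and `C'`, while
`E` stays fixed pointwise. -/
theorem exists_transfer {R B E S C C' : Finset W} (hRB : Disjoint R B) (hRE : Disjoint R E)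
    (hBE : Disjoint B E) (hS : S ⊆ R ∪ B ∪ E) (hC : (S ∩ R).card = C.card)
    (hC' : (S ∩ B).card = C'.card) (hCC : Disjoint C C') (hCE : Disjoint C E)
    (hCE' : Disjoint C' E) :
    ∃ φ : W → W, Set.InjOn φ S ∧ (∀ x ∈ S, x ∈ E → φ x = x) ∧ (∀ x ∈ S, x ∈ R → φ x ∈ C) ∧
      (∀ x ∈ S, x ∈ B → φ x ∈ C') ∧ S.image φ = S ∩ E ∪ C ∪ C' := by
  obtain ⟨f, hf, hfC⟩ := exists_image_eq hC
  obtain ⟨g, hg, hgC⟩ := exists_image_eq hC'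
  set φ : W → W := fun x => if x ∈ E then x else if x ∈ R then f x else g x with hφ
  have hφE : ∀ x, x ∈ E → φ x = x := fun x hx => by simp [hφ, hx]
  have hφR : ∀ x, x ∈ R → φ x = f x := fun x hx => by
    simp [hφ, hx, Finset.disjoint_left.1 hRE hx]
  have hφB : ∀ x, x ∈ B → φ x = g x := fun x hx => by
    simp [hφ, Finset.disjoint_right.1 hRB hx, Finset.disjoint_left.1 hBE hx]
  have hmR : ∀ x ∈ S, x ∈ R → φ x ∈ C := fun x hx hxR => by
    rw [hφR x hxR, ← hfC]
    exact Finset.mem_image_of_mem f (Finset.mem_inter.2 ⟨hx, hxR⟩)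
  have hmB : ∀ x ∈ S, x ∈ B → φ x ∈ C' := fun x hx hxB => by
    rw [hφB x hxB, ← hgC]
    exact Finset.mem_image_of_mem g (Finset.mem_inter.2 ⟨hx, hxB⟩)
  have hcase : ∀ x ∈ S, x ∈ R ∨ x ∈ B ∨ x ∈ E := fun x hx => by
    have := hS hx
    simp only [Finset.mem_union] at this
    tauto
  refine ⟨φ, ?_, fun x _ hx => hφE x hx, hmR, hmB, ?_⟩
  · intro x hx y hy hxy
    simp only [Finset.mem_coe] at hx hy
    have d1 := Finset.disjoint_left.1 hCC
    have d2 := Finset.disjoint_left.1 hCE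
    have d3 := Finset.disjoint_left.1 hCE'
    rcases hcase x hx with h | h | h <;> rcases hcase y hy with h' | h' | h'
    · rw [hφR x h, hφR y h'] at hxy
      exact hf (by simp [hx, h]) (by simp [hy, h']) hxy
    · exact absurd (hxy ▸ hmB y hy h') (d1 (hmR x hx h))
    · exact absurd (by rw [hxy, hφE y h']; exact h') (d2 (hmR x hx h))
    · exact absurd (hxy ▸ hmB x hx h) (d1 (hmR y hy h'))
    · rw [hφB x h, hφB y h'] at hxy
      exact hg (by simp [hx, h]) (by simp [hy, h']) hxy
    · exact absurd (by rw [hxy, hφE y h']; exact h') (d3 (hmB x hx h))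
    · exact absurd (by rw [← hxy, hφE x h]; exact h) (d2 (hmR y hy h'))
    · exact absurd (by rw [← hxy, hφE x h]; exact h) (d3 (hmB y hy h'))
    · rwa [hφE x h, hφE y h'] at hxy
  · ext z
    simp only [Finset.mem_image, Finset.mem_union, Finset.mem_inter]
    constructor
    · rintro ⟨x, hx, rfl⟩
      rcases hcase x hx with h | h | h
      · exact Or.inl (Or.inr (hmR x hx h))
      · exact Or.inr (hmB x hx h)
      · rw [hφE x h]; exact Or.inl (Or.inl ⟨hx, h⟩)
    · rintro ((⟨h1, h2⟩ | h) | h)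
      · exact ⟨z, h1, hφE z h2⟩
      · rw [← hfC] at h
        obtain ⟨x, hx, rfl⟩ := Finset.mem_image.1 h
        exact ⟨x, (Finset.mem_inter.1 hx).1, hφR x (Finset.mem_inter.1 hx).2⟩
      · rw [← hgC] at h
        obtain ⟨x, hx, rfl⟩ := Finset.mem_image.1 h
        exact ⟨x, (Finset.mem_inter.1 hx).1, hφB x (Finset.mem_inter.1 hx).2⟩

/-- For each pair of classes other than `E` with itself there is an alternative: either the old
graph has no edges there, so none are required, or the new vertices provide all of them. -/
theorem IsCopy.replace {G G' : SimpleGraph W} {H : SimpleGraph V} {A R B E C C' : Finset W}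
    (h : IsCopy G H A) (hRB : Disjoint R B) (hRE : Disjoint R E)
    (hBE : Disjoint B E) (hS : A ⊆ R ∪ B ∪ E) (hC : (A ∩ R).card = C.card)
    (hC' : (A ∩ B).card = C'.card) (hCC : Disjoint C C') (hCE : Disjoint C E)
    (hCE' : Disjoint C' E)
    (aEE : ∀ x ∈ E, ∀ y ∈ E, G.Adj x y → G'.Adj x y)
    (aRR : (∀ x ∈ R, ∀ y ∈ R, ¬ G.Adj x y) ∨ ∀ x ∈ C, ∀ y ∈ C, x ≠ y → G'.Adj x y)
    (aBB : (∀ x ∈ B, ∀ y ∈ B, ¬ G.Adj x y) ∨ ∀ x ∈ C', ∀ y ∈ C', x ≠ y → G'.Adj x y)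
    (aRB : (∀ x ∈ R, ∀ y ∈ B, ¬ G.Adj x y) ∨ ∀ x ∈ C, ∀ y ∈ C', G'.Adj x y)
    (aRE : (∀ x ∈ R, ∀ y ∈ E, ¬ G.Adj x y) ∨ ∀ x ∈ C, ∀ y ∈ E, G'.Adj x y)
    (aBE : (∀ x ∈ B, ∀ y ∈ E, ¬ G.Adj x y) ∨ ∀ x ∈ C', ∀ y ∈ E, G'.Adj x y) :
    IsCopy G' H (A ∩ E ∪ C ∪ C') := by
  obtain ⟨φ, hφ, hE, hR, hB, him⟩ := exists_transfer hRB hRE hBE hS hC hC' hCC hCE hCE'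
  rw [← him]
  refine h.image φ hφ fun x hx y hy hxy => ?_
  have hne : φ x ≠ φ y := fun he => hxy.ne (hφ hx hy he)
  have hcase : ∀ x ∈ A, x ∈ R ∨ x ∈ B ∨ x ∈ E := fun x hx => by
    have := hS hx
    simp only [Finset.mem_union] at this
    tauto
  rcases hcase x hx with h | h | h <;> rcases hcase y hy with h' | h' | h'
  · exact aRR.elim (fun a => absurd hxy (a x h y h')) fun a =>
      a _ (hR x hx h) _ (hR y hy h') hne
  · exact aRB.elim (fun a => absurd hxy (a x h y h')) fun a => a _ (hR x hx h) _ (hB y hy h')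
  · exact aRE.elim (fun a => absurd hxy (a x h y h')) fun a => by
      rw [hE y hy h']; exact a _ (hR x hx h) _ h'
  · exact aRB.elim (fun a => absurd hxy.symm (a y h' x h)) fun a =>
      (a _ (hR y hy h') _ (hB x hx h)).symm
  · exact aBB.elim (fun a => absurd hxy (a x h y h')) fun a =>
      a _ (hB x hx h) _ (hB y hy h') hne
  · exact aBE.elim (fun a => absurd hxy (a x h y h')) fun a => by
      rw [hE y hy h']; exact a _ (hB x hx h) _ h'
  · exact aRE.elim (fun a => absurd hxy.symm (a y h' x h)) fun a => by
      rw [hE x hx h]; exact (a _ (hR y hy h') _ h).symm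
  · exact aBE.elim (fun a => absurd hxy.symm (a y h' x h)) fun a => by
      rw [hE x hx h]; exact (a _ (hB y hy h') _ h).symm
  · rw [hE x hx h, hE y hy h']; exact aEE x h y h' hxy

/-- Disjoint sets are replaced one after the other, keeping their traces on `E` and taking fresh
vertices from two pools. -/
theorem pack_replace {P P' : Finset W → Prop} {k : ℕ} {E S T : Finset W} (hST : Disjoint S T)
    (hSE : Disjoint S E) (hTE : Disjoint T E) (a b : Finset W → ℕ) (F : Finset (Finset W))
    (hF : IsPacking P F) (ha : ∀ A ∈ F, a A ≤ k) (hb : ∀ A ∈ F, b A ≤ k)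
    (hFE : ∀ A ∈ F, (A ∩ E).Nonempty) {N : ℕ} (hN : F.card ≤ N)
    (hstep : ∀ A ∈ F, ∀ D D' : Finset W, D.card ≤ k * N → D'.card ≤ k * N →
      ∃ C ⊆ S \ D, ∃ C' ⊆ T \ D', C.card = a A ∧ C'.card = b A ∧ P' (A ∩ E ∪ C ∪ C')) :
    ∃ D ⊆ S, ∃ D' ⊆ T, D.card = ∑ A ∈ F, a A ∧ D'.card = ∑ A ∈ F, b A ∧
      Pack P' (F.biUnion id ∩ E ∪ D ∪ D') F.card := by
  induction F using Finset.induction_on with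
  | empty => exact ⟨∅, by simp, ∅, by simp, by simp, by simp, by simpa using Pack.zero _ _⟩
  | insert A F hA ih =>
    rw [Finset.card_insert_of_notMem hA] at hN
    obtain ⟨D, hD, D', hD', hDc, hDc', hp⟩ := ih (hF.subset (Finset.subset_insert _ _))
      (fun B hB => ha B (Finset.mem_insert_of_mem hB))
      (fun B hB => hb B (Finset.mem_insert_of_mem hB))
      (fun B hB => hFE B (Finset.mem_insert_of_mem hB)) (by omega)
      (fun B hB => hstep B (Finset.mem_insert_of_mem hB))
    have hbound : ∀ c : Finset W → ℕ, (∀ B ∈ insert A F, c B ≤ k) → ∑ B ∈ F, c B ≤ k * N := by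
      intro c hc
      calc ∑ B ∈ F, c B ≤ ∑ _B ∈ F, k :=
            Finset.sum_le_sum fun B hB => hc B (Finset.mem_insert_of_mem hB)
        _ = k * F.card := by simp [mul_comm]
        _ ≤ k * N := Nat.mul_le_mul_left _ (by omega)
    obtain ⟨C, hC, C', hC', hCc, hCc', hcopy⟩ := hstep A (Finset.mem_insert_self _ _) D D'
      (hDc ▸ hbound a ha) (hDc' ▸ hbound b hb)
    have hCS := hC.trans Finset.sdiff_subset
    have hCT := hC'.trans Finset.sdiff_subset
    have hCD : Disjoint C D := Finset.disjoint_of_subset_left hC Finset.sdiff_disjoint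
    have hCD' : Disjoint C' D' := Finset.disjoint_of_subset_left hC' Finset.sdiff_disjoint
    refine ⟨D ∪ C, Finset.union_subset hD hCS, D' ∪ C', Finset.union_subset hD' hCT, ?_, ?_, ?_⟩
    · rw [Finset.card_union_of_disjoint hCD.symm, Finset.sum_insert hA]; omega
    · rw [Finset.card_union_of_disjoint hCD'.symm, Finset.sum_insert hA]; omega
    · have hAF : Disjoint A (F.biUnion id) := by
        rw [Finset.disjoint_biUnion_right]
        intro B hB
        exact hF.disj A (Finset.mem_insert_self _ _) B (Finset.mem_insert_of_mem hB)
          (fun he => hA (he ▸ hB))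
      have hone : Pack P' (A ∩ E ∪ C ∪ C') 1 :=
        Pack.one ((hFE A (Finset.mem_insert_self _ _)).mono
          (Finset.subset_union_left.trans Finset.subset_union_left)) hcopy
      refine hp.add' hone ?_ ?_ ?_ (by rw [Finset.card_insert_of_notMem hA])
      · have e1 : Disjoint (F.biUnion id ∩ E) (A ∩ E) :=
          hAF.symm.mono Finset.inter_subset_left Finset.inter_subset_left
        have e2 : Disjoint (F.biUnion id ∩ E) C :=
          (hSE.symm.mono Finset.inter_subset_right hCS)
        have e3 : Disjoint (F.biUnion id ∩ E) C' :=
          (hTE.symm.mono Finset.inter_subset_right hCT)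
        have e4 : Disjoint D (A ∩ E) := hSE.mono hD Finset.inter_subset_right
        have e5 : Disjoint D C' := hST.mono hD hCT
        have e6 : Disjoint D' (A ∩ E) := hTE.mono hD' Finset.inter_subset_right
        have e7 : Disjoint D' C := (hST.mono hCS hD').symm
        simp only [Finset.disjoint_union_left, Finset.disjoint_union_right]
        exact ⟨⟨⟨⟨e1, e4⟩, e6⟩, ⟨e2, hCD.symm⟩, e7⟩, ⟨e3, e5⟩, hCD'.symm⟩
      · rw [Finset.biUnion_insert]
        intro z hz
        simp only [Finset.mem_union, Finset.mem_inter, id] at hz ⊢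
        tauto
      · rw [Finset.biUnion_insert]
        intro z hz
        simp only [Finset.mem_union, Finset.mem_inter, id] at hz ⊢
        tauto

/-- If a vertex is adjacent to more than 1/32 of the set, pass to its neighbourhood, where the
forbidden clique is one smaller. This happens at most k times, each at the cost of a factor 32. -/
theorem exists_core (G : SimpleGraph W) : ∀ (k : ℕ) (A : Finset W), NoClique G k A →
    ∃ X ⊆ A, A.card ≤ 32 ^ k * X.card ∧
      ∀ v ∈ X, 32 * (X.filter (G.Adj v)).card ≤ X.card := by
  intro k
  induction k with
  | zero =>
    intro A h
    -- The empty set is a 0-clique, so the hypothesis fails for k = 0.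
    exact absurd (h ∅ (by simp)) (by simp [SimpleGraph.isNClique_iff])
  | succ k ih =>
    intro A h
    by_cases hA : ∀ v ∈ A, 32 * (A.filter (G.Adj v)).card ≤ A.card
    · exact ⟨A, Finset.Subset.refl _, Nat.le_mul_of_pos_left _ (by positivity), hA⟩
    · push Not at hA
      obtain ⟨v, hv, hlt⟩ := hA
      obtain ⟨X, hX, hc, hd⟩ := ih (A.filter (G.Adj v)) (fun B hB hc => by
        refine h (insert v B) ?_ (isNClique_insert' hc fun b hb =>
          (Finset.mem_filter.1 (hB hb)).2)
        exact Finset.insert_subset hv (hB.trans (Finset.filter_subset _ _)))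
      refine ⟨X, hX.trans (Finset.filter_subset _ _), ?_, hd⟩
      rw [pow_succ]
      nlinarith

/-! ### Common neighbourhoods and attached independent sets -/

theorem exists_subset_forall_not {r : W → W → Prop} {X Q : Finset W} {θ : ℕ}
    (h : ∀ y ∈ Q, (X.filter (r y)).card ≤ θ) :
    ∃ Z ⊆ X, (∀ x ∈ Z, ∀ y ∈ Q, ¬ r y x) ∧ X.card ≤ Z.card + Q.card * θ := by
  refine ⟨X.filter fun x => ∀ y ∈ Q, ¬ r y x, Finset.filter_subset _ _,
    fun x hx => (Finset.mem_filter.1 hx).2, ?_⟩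
  have hsub : X ⊆ (X.filter fun x => ∀ y ∈ Q, ¬ r y x) ∪ Q.biUnion fun y => X.filter (r y) := by
    intro x hx
    by_cases hc : ∀ y ∈ Q, ¬ r y x
    · exact Finset.mem_union_left _ (Finset.mem_filter.2 ⟨hx, hc⟩)
    · push Not at hc
      obtain ⟨y, hy, hn⟩ := hc
      exact Finset.mem_union_right _ (Finset.mem_biUnion.2 ⟨y, hy, Finset.mem_filter.2 ⟨hx, hn⟩⟩)
  calc X.card ≤ _ := Finset.card_le_card hsub
    _ ≤ _ := Finset.card_union_le _ _
    _ ≤ _ := Nat.add_le_add_left (Finset.card_biUnion_le_card_mul _ _ _ h) _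

theorem card_le_common_add {G : SimpleGraph W} {X Q : Finset W} {θ : ℕ} (hXQ : Disjoint X Q)
    (h : ∀ y ∈ Q, (X.filter (G.Adj y)).card ≤ θ) :
    X.card ≤ (X.filter fun x => ∀ y ∈ Q, Gᶜ.Adj x y).card + Q.card * θ := by
  obtain ⟨Z, hZ, hn, hc⟩ := exists_subset_forall_not h
  refine hc.trans (Nat.add_le_add_right (Finset.card_le_card fun x hx => ?_) _)
  exact Finset.mem_filter.2 ⟨hZ hx, fun y hy => (SimpleGraph.compl_adj G x y).2
    ⟨fun he => Finset.disjoint_left.1 hXQ (hZ hx) (he ▸ hy), fun ha => hn x hx y hy ha.symm⟩⟩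

theorem card_le_common_add_compl {G : SimpleGraph W} {X Q : Finset W} {θ : ℕ}
    (hXQ : Disjoint X Q) (h : ∀ y ∈ Q, (X.filter (Gᶜ.Adj y)).card ≤ θ) :
    X.card ≤ (X.filter fun x => ∀ y ∈ Q, G.Adj x y).card + Q.card * θ := by
  obtain ⟨Z, hZ, hn, hc⟩ := exists_subset_forall_not (r := Gᶜ.Adj)
    (fun y hy => by convert h y hy)
  refine hc.trans (Nat.add_le_add_right (Finset.card_le_card fun x hx => ?_) _)
  refine Finset.mem_filter.2 ⟨hZ hx, fun y hy => ?_⟩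
  by_contra ha
  exact hn x hx y hy ((SimpleGraph.compl_adj G y x).2
    ⟨fun he => Finset.disjoint_left.1 hXQ (hZ hx) (he ▸ hy), fun hb => ha hb.symm⟩)

/-- Each clique of size k - α(H) is completed by α(H) fresh vertices from its common neighbourhood,
greedily and outside `D`; no edges among these vertices are needed. -/
theorem pack_attach_indep [Fintype V] {G : SimpleGraph W} {H : SimpleGraph V}
    {N : Finset W → Finset W} {P D : Finset W}
    (F : Finset (Finset W))
    (hF : IsPacking (G.IsNClique (Fintype.card V - H.indepNum)) F)
    (hNP : ∀ Q ∈ F, N Q ⊆ P) (hN : ∀ Q ∈ F, ∀ x ∈ N Q, ∀ y ∈ Q, G.Adj x y)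
    (hPF : Disjoint P (F.biUnion id)) {m : ℕ} (hm : F.card ≤ m)
    (hc : ∀ Q ∈ F, D.card + H.indepNum * m ≤ (N Q).card) :
    ∃ I ⊆ P, Disjoint I D ∧ I.card = H.indepNum * F.card ∧
      Pack (IsCopy G H) (I ∪ F.biUnion id) F.card := by
  induction F using Finset.induction_on with
  | empty => exact ⟨∅, by simp, by simp, by simp, by simpa using Pack.zero _ _⟩
  | insert Q F hQ ih =>
    rw [Finset.card_insert_of_notMem hQ] at hm ⊢
    rw [Finset.biUnion_insert, id, Finset.disjoint_union_right] at hPF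
    obtain ⟨I, hI, hID, hIc, hp⟩ := ih (hF.subset (Finset.subset_insert _ _))
      (fun B hB => hNP B (Finset.mem_insert_of_mem hB))
      (fun B hB => hN B (Finset.mem_insert_of_mem hB)) hPF.2 (by omega)
      (fun B hB => hc B (Finset.mem_insert_of_mem hB))
    have hQm := Finset.mem_insert_self Q F
    have hcard : H.indepNum ≤ (N Q \ (D ∪ I)).card := by
      have h1 := Finset.le_card_sdiff (D ∪ I) (N Q)
      have h2 := Finset.card_union_le D I
      have h3 := hc Q hQm
      have h4 : H.indepNum * (F.card + 1) ≤ H.indepNum * m := Nat.mul_le_mul_left _ hm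
      rw [mul_add, mul_one] at h4
      omega
    obtain ⟨J, hJ, hJc⟩ := Finset.exists_subset_card_eq hcard
    have hJN : J ⊆ N Q := hJ.trans Finset.sdiff_subset
    have hJP : J ⊆ P := hJN.trans (hNP Q hQm)
    have hJd : Disjoint J (D ∪ I) := Finset.disjoint_of_subset_left hJ Finset.sdiff_disjoint
    rw [Finset.disjoint_union_right] at hJd
    have hQF : Disjoint Q (F.biUnion id) := by
      rw [Finset.disjoint_biUnion_right]
      intro B hB
      exact hF.disj Q hQm B (Finset.mem_insert_of_mem hB) (fun he => hQ (he ▸ hB))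
    have hJQ : Disjoint J Q := hPF.1.mono_left hJP
    refine ⟨I ∪ J, Finset.union_subset hI hJP, ?_, ?_, ?_⟩
    · rw [Finset.disjoint_union_left]; exact ⟨hID, hJd.1⟩
    · rw [Finset.card_union_of_disjoint hJd.2.symm, hIc, hJc, mul_add, mul_one]
    · have hcopy : IsCopy G H (J ∪ Q) := isCopy_of_join H hJQ hJc (hF.prop Q hQm)
        fun x hx y hy => hN Q hQm x (hJN hx) y hy
      have hone : Pack (IsCopy G H) (J ∪ Q) 1 :=
        Pack.one ((hF.nonempty Q hQm).mono Finset.subset_union_right) hcopy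
      refine hp.add' hone ?_ ?_ ?_ le_rfl
      · simp only [Finset.disjoint_union_left, Finset.disjoint_union_right]
        exact ⟨⟨hJd.2.symm, (hPF.2.mono_left hJP).symm⟩, hPF.1.mono_left hI, hQF.symm⟩
      · rw [Finset.biUnion_insert]
        intro z hz
        simp only [Finset.mem_union, id] at hz ⊢
        tauto
      · rw [Finset.biUnion_insert]
        intro z hz
        simp only [Finset.mem_union, id] at hz ⊢
        tauto

theorem IsPacking.sum_card_inter_le {P : Finset W → Prop} {F : Finset (Finset W)}
    (h : IsPacking P F) (S : Finset W) : ∑ A ∈ F, (A ∩ S).card ≤ S.card := by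
  rw [← Finset.card_biUnion]
  · exact Finset.card_le_card (Finset.biUnion_subset.2 fun A _ => Finset.inter_subset_right)
  · intro A hA B hB hne
    exact (h.disj A hA B hB hne).mono Finset.inter_subset_left Finset.inter_subset_left

theorem IsPacking.card_filter_inter_le {P : Finset W → Prop} {F : Finset (Finset W)}
    (h : IsPacking P F) (S : Finset W) :
    (F.filter fun A => (A ∩ S).Nonempty).card ≤ S.card := by
  refine le_trans ?_ ((h.subset (Finset.filter_subset (fun A => (A ∩ S).Nonempty) F)).sum_card_inter_le S)
  rw [Finset.card_eq_sum_ones]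
  exact Finset.sum_le_sum fun A hA => Finset.card_pos.2 (Finset.mem_filter.1 hA).2

/-! ### Edges and copies in the ideal colouring -/

section St
variable {G : SimpleGraph W} {H : SimpleGraph V} {R B E A : Finset W}

theorem st_not_adj_of_mem_left_right (hRB : Disjoint R B) (hRE : Disjoint R E) :
    ∀ x ∈ R, ∀ y ∈ B, ¬ (st G R B E).Adj x y := fun x hx y hy h => by
  have h1 := Finset.disjoint_left.1 hRB hx
  have h2 := Finset.disjoint_left.1 hRE hx
  have h3 := Finset.disjoint_right.1 hRB hy
  rw [st_adj] at h
  tauto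

theorem st_not_adj_of_mem_left (hRB : Disjoint R B) (hRE : Disjoint R E) :
    ∀ x ∈ R, ∀ y ∈ E, ¬ (st G R B E).Adj x y := fun x hx y hy h => by
  have h1 := Finset.disjoint_left.1 hRB hx
  have h2 := Finset.disjoint_left.1 hRE hx
  have h3 := Finset.disjoint_right.1 hRE hy
  rw [st_adj] at h
  tauto

theorem st_not_adj_of_mem_right (hRB : Disjoint R B) (hBE : Disjoint B E) :
    ∀ x ∈ B, ∀ y ∈ B, ¬ (st G R B E).Adj x y := fun x hx y hy h => by
  have h1 := Finset.disjoint_right.1 hRB hx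
  have h2 := Finset.disjoint_left.1 hBE hx
  have h3 := Finset.disjoint_left.1 hBE hy
  rw [st_adj] at h
  tauto

theorem st_adj_of_mem (hRE : Disjoint R E) (hBE : Disjoint B E) :
    ∀ x ∈ E, ∀ y ∈ E, (st G R B E).Adj x y → G.Adj x y := fun x hx y hy h => by
  have h1 := Finset.disjoint_right.1 hRE hx
  have h2 := Finset.disjoint_right.1 hBE hx
  have h3 := Finset.disjoint_right.1 hBE hy
  rw [st_adj] at h
  tauto

theorem st_compl_not_adj_of_mem_left : ∀ x ∈ R, ∀ y ∈ R, ¬ (st G R B E)ᶜ.Adj x y :=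
  fun x hx y hy h => by
    rw [SimpleGraph.compl_adj, st_adj] at h
    exact h.2 ⟨h.1, Or.inl ⟨hx, hy⟩⟩

theorem st_compl_not_adj_of_mem_right : ∀ x ∈ B, ∀ y ∈ E, ¬ (st G R B E)ᶜ.Adj x y :=
  fun x hx y hy h => by
    rw [SimpleGraph.compl_adj, st_adj] at h
    exact h.2 ⟨h.1, Or.inr (Or.inl ⟨hx, hy⟩)⟩

theorem st_compl_adj_of_mem : ∀ x ∈ E, ∀ y ∈ E, (st G R B E)ᶜ.Adj x y → Gᶜ.Adj x y :=
  fun x hx y hy h => by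
    rw [SimpleGraph.compl_adj, st_adj] at h
    exact (SimpleGraph.compl_adj _ _ _).2
      ⟨h.1, fun ha => h.2 ⟨h.1, Or.inr (Or.inr (Or.inr ⟨hx, hy, ha⟩))⟩⟩

/-- Away from `E` all red edges lie inside `R`, and H has no isolated vertices, so no vertex of the
copy can lie in `B`. -/
theorem IsCopy.subset_left (hH : ∀ v, ¬ H.IsIsolated v) (h : IsCopy (st G R B E) H A) (hA : A ⊆ R ∪ B ∪ E)
    (hAE : ¬ (A ∩ E).Nonempty) : A ⊆ R := by
  have hE : ∀ z ∈ A, z ∉ E := fun z hz hzE => hAE ⟨z, Finset.mem_inter.2 ⟨hz, hzE⟩⟩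
  intro x hx
  by_contra hxR
  have hxB : x ∈ B := by
    have h1 := hA hx
    simp only [Finset.mem_union] at h1
    have := hE x hx
    tauto
  obtain ⟨y, hy, hxy⟩ := h.exists_adj hH hx
  have h2 := hE y hy
  have h3 := hE x hx
  rw [st_adj] at hxy
  tauto

theorem IsCopy.card_inter_left_le [Fintype V] (h : IsCopy (st G R B E)ᶜ H A) :
    (A ∩ R).card ≤ H.indepNum :=
  h.card_indep_le Finset.inter_subset_left fun x hx y hy =>
    st_compl_not_adj_of_mem_left x (Finset.mem_inter.1 hx).2 y (Finset.mem_inter.1 hy).2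

theorem card_eq_inter_add (hRB : Disjoint R B) (hRE : Disjoint R E) (hBE : Disjoint B E)
    (hA : A ⊆ R ∪ B ∪ E) : A.card = (A ∩ R).card + (A ∩ B).card + (A ∩ E).card := by
  rw [← Finset.card_union_of_disjoint (hRB.mono Finset.inter_subset_right Finset.inter_subset_right),
    ← Finset.card_union_of_disjoint]
  · rw [← Finset.inter_union_distrib_left, ← Finset.inter_union_distrib_left,
      Finset.inter_eq_left.2 hA]
  · rw [Finset.disjoint_union_left]
    exact ⟨hRE.mono Finset.inter_subset_right Finset.inter_subset_right,
      hBE.mono Finset.inter_subset_right Finset.inter_subset_right⟩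

end St

/-! ### Frames: from the ideal colouring back to the original one -/

/-- Two large pools `X` (almost all edges red) and `Y` (almost all edges blue), with disjoint red
`k`-cliques `FR` and blue `(k - i)`-cliques `FB` on further vertices, and few other vertices,
classified by their degrees to the pools. -/
structure Frame [Fintype V] (G : SimpleGraph W) (H : SimpleGraph V) (X Y : Finset W)
    (FR FB : Finset (Finset W)) (WR WB E : Finset W) (l θ Θ M : ℕ) : Prop where
  freeX : NoClique Gᶜ (Fintype.card V) X
  freeY : NoClique G (Fintype.card V) Y
  degX : ∀ v ∈ X, 32 * (X.filter (Gᶜ.Adj v)).card ≤ X.card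
  degY : ∀ v ∈ Y, 32 * (Y.filter (G.Adj v)).card ≤ Y.card
  packR : IsPacking (G.IsNClique (Fintype.card V)) FR
  packB : IsPacking (Gᶜ.IsNClique (Fintype.card V - H.indepNum)) FB
  disjX : Disjoint X (FR.biUnion id)
  disjXW : Disjoint WR X
  disjRW : Disjoint WR (FR.biUnion id)
  disjY : Disjoint Y (FB.biUnion id)
  disjYW : Disjoint WB Y
  disjBW : Disjoint WB (FB.biUnion id)
  disjRB : Disjoint (X ∪ WR ∪ FR.biUnion id) (Y ∪ WB ∪ FB.biUnion id)
  disjRE : Disjoint (X ∪ WR ∪ FR.biUnion id) E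
  disjBE : Disjoint (Y ∪ WB ∪ FB.biUnion id) E
  cross : ∀ y ∈ Y ∪ FB.biUnion id, ((X ∪ FR.biUnion id).filter (G.Adj y)).card ≤ θ
  degWR : ∀ w ∈ WR, Θ ≤ (X.filter (G.Adj w)).card
  degWB : ∀ w ∈ WB, Θ ≤ (Y.filter (Gᶜ.Adj w)).card
  degWBX : ∀ w ∈ WB, (X.filter (G.Adj w)).card ≤ Θ
  degEX : ∀ w ∈ E, (X.filter (G.Adj w)).card ≤ Θ
  degEY : ∀ w ∈ E, (Y.filter (Gᶜ.Adj w)).card ≤ Θ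
  card_rest : WR.card + WB.card + E.card ≤ l
  le_threshold : 2 * Fintype.card V * l + 2 ^ (2 * Fintype.card V) ≤ Θ
  le_cardX : 2 * Θ ≤ X.card
  le_cardY : 2 * Θ ≤ Y.card
  pow_le_cardX : 2 * 2 ^ (10 * Fintype.card V) ≤ X.card
  pow_le_cardY : 2 * 2 ^ (10 * Fintype.card V) ≤ Y.card
  slackX : l * Θ + Fintype.card V * Θ + 2 * Fintype.card V * l + 2 ^ (2 * Fintype.card V) ≤ X.card
  slackY : l * Θ + Fintype.card V * Θ + 2 * Fintype.card V * l + 2 ^ (2 * Fintype.card V) ≤ Y.card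
  cross_le : θ ≤ Θ
  cardB : (Y ∪ FB.biUnion id).card ≤ (Fintype.card V - H.indepNum) * M
  cardR : H.indepNum * (M + l) + 2 * Fintype.card V * l + Fintype.card V * θ ≤
    (X ∪ FR.biUnion id).card

section Frame
variable [Fintype V] {G : SimpleGraph W} {H : SimpleGraph V} {X Y : Finset W}
  {FR FB : Finset (Finset W)} {WR WB E : Finset W} {l θ Θ M : ℕ}

/-- At most |E| of the copies meet `E`; they keep their trace there and take fresh vertices from the
pools. All others lie in `R`, and as many red k-cliques are found in what is left of `R` by exact
packing. -/
theorem Frame.pack_red [Nonempty V] (hH : ∀ v, ¬ H.IsIsolated v)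
    (f : Frame G H X Y FR FB WR WB E l θ Θ M) {m : ℕ}
    (h : Pack (IsCopy (st G (X ∪ WR ∪ FR.biUnion id) (Y ∪ WB ∪ FB.biUnion id) E) H)
      (X ∪ WR ∪ FR.biUnion id ∪ (Y ∪ WB ∪ FB.biUnion id) ∪ E) m) :
    Pack (IsCopy G H) (X ∪ WR ∪ FR.biUnion id ∪ (Y ∪ WB ∪ FB.biUnion id) ∪ E) m := by
  have hdegEY := f.degEY
  have hrest := f.card_rest
  have hthr := f.le_threshold
  have hslX := f.slackX
  have hslY := f.slackY
  have hRB := f.disjRB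
  have hRE := f.disjRE
  have hBE := f.disjBE
  have hcardk : ∀ {G' : SimpleGraph W} {A}, IsCopy G' H A → A.card = Fintype.card V :=
    fun hA => hA.card
  have hclique := fun {A : Finset W} (hA : G.IsNClique (Fintype.card V) A) => isCopy_of_clique H hA
  have hextras := fun (D : Finset W) => pack_cliques_with_extras (D := D) (T := WR) (F := FR)
    (Θ := Θ) (Fintype.card_pos (α := V)) le_rfl f.freeX f.degX
  set k := Fintype.card V with hk
  set R := X ∪ WR ∪ FR.biUnion id with hR
  set B := Y ∪ WB ∪ FB.biUnion id with hB
  have hXR : X ⊆ R := Finset.subset_union_left.trans Finset.subset_union_left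
  have hYB : Y ⊆ B := Finset.subset_union_left.trans Finset.subset_union_left
  obtain ⟨F, hF, hFU, rfl⟩ := h
  set F1 := F.filter fun A => (A ∩ E).Nonempty with hF1
  set F2 := F.filter fun A => ¬ (A ∩ E).Nonempty with hF2
  have hAU : ∀ A ∈ F, A ⊆ R ∪ B ∪ E := fun A hA => (subset_biUnion_id hA).trans hFU
  have hF1c : F1.card ≤ l := (hF.card_filter_inter_le E).trans (by omega)
  have hkl : k * F1.card ≤ k * l := Nat.mul_le_mul_left _ hF1c
  have hinter : ∀ A ∈ F, ∀ S, (A ∩ S).card ≤ k := fun A hA S =>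
    (Finset.card_le_card Finset.inter_subset_left).trans (hcardk (hF.prop A hA)).le
  obtain ⟨D, hD, D', hD', hDc, hDc', hp⟩ := pack_replace (P' := IsCopy G H) (k := k) (N := l)
    (hRB.mono hXR hYB) (hRE.mono_left hXR) (hBE.mono_left hYB) (fun A => (A ∩ R).card)
    (fun A => (A ∩ B).card) F1 (hF.subset (Finset.filter_subset _ _))
    (fun A hA => hinter A (Finset.mem_filter.1 hA).1 R)
    (fun A hA => hinter A (Finset.mem_filter.1 hA).1 B)
    (fun A hA => (Finset.mem_filter.1 hA).2) hF1c (by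
      intro A hA D D' hD hD'
      have hA' := (Finset.mem_filter.1 hA).1
      have hkΘ : 0 ≤ k * Θ := Nat.zero_le _
      obtain ⟨C, hC, hCq⟩ := (f.freeX.subset Finset.sdiff_subset).exists_clique (A ∩ R).card
        (A := X \ D) (show 2 ^ ((A ∩ R).card + k) ≤ _ by
          have h1 := Finset.le_card_sdiff D X
          have h2 : 2 ^ ((A ∩ R).card + k) ≤ 2 ^ (2 * k) :=
            Nat.pow_le_pow_right (by norm_num) (by have := hinter A hA' R; omega)
          have h3 : 2 * k * l = k * l + k * l := by ring
          omega)
      have hcommon := card_le_common_add_compl (hBE.mono_left hYB) hdegEY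
      -- On `B` the ideal red graph has edges only to `E`, so common red neighbours of `E` in `Y`
      -- are enough.
      obtain ⟨C', hC', hCc'⟩ := Finset.exists_subset_card_eq
        (s := (Y.filter fun x => ∀ y ∈ E, G.Adj x y) \ D') (n := (A ∩ B).card) (by
          have h1 := Finset.le_card_sdiff D' (Y.filter fun x => ∀ y ∈ E, G.Adj x y)
          have h2 := hinter A hA' B
          have h3 : 2 * k * l = k * l + k * l := by ring
          have h4 : E.card * Θ ≤ l * Θ := Nat.mul_le_mul_right _ (by omega)
          have h5 : 2 * k < 2 ^ (2 * k) := Nat.lt_two_pow_self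
          omega)
      have hCX := hC.trans Finset.sdiff_subset
      have hCf := hC'.trans Finset.sdiff_subset
      have hCY := hCf.trans (Finset.filter_subset _ _)
      refine ⟨C, hC, C', hC'.trans (Finset.sdiff_subset_sdiff (Finset.filter_subset _ _)
        (Finset.Subset.refl _)), hCq.2, hCc', ?_⟩
      exact (hF.prop A hA').replace hRB hRE hBE (hAU A hA') hCq.2.symm hCc'.symm
        (hRB.mono (hCX.trans hXR) (hCY.trans hYB)) (hRE.mono_left (hCX.trans hXR))
        (hBE.mono_left (hCY.trans hYB)) (st_adj_of_mem hRE hBE)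
        (Or.inr fun x hx y hy hne => hCq.1 hx hy hne)
        (Or.inl (st_not_adj_of_mem_right hRB hBE))
        (Or.inl (st_not_adj_of_mem_left_right hRB hRE))
        (Or.inl (st_not_adj_of_mem_left hRB hRE))
        (Or.inr fun x hx y hy => (Finset.mem_filter.1 (hCf hx)).2 y hy))
  have hF2R : ∀ A ∈ F2, A ∩ R = A := fun A hA => by
    obtain ⟨hA1, hA2⟩ := Finset.mem_filter.1 hA
    exact Finset.inter_eq_left.2 ((hF.prop A hA1).subset_left hH (hAU A hA1) hA2)
  have hsum := hF.sum_card_inter_le R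
  rw [← Finset.sum_filter_add_sum_filter_not F (fun A => (A ∩ E).Nonempty)] at hsum
  have hsum2 : ∑ A ∈ F2, (A ∩ R).card = k * F2.card := by
    rw [Finset.sum_congr rfl fun A hA => by
      rw [hF2R A hA, hcardk (hF.prop A (Finset.mem_filter.1 hA).1)]]
    simp [mul_comm]
  have hDk : D.card ≤ k * l := by
    rw [hDc]
    refine le_trans (Finset.sum_le_sum (g := fun _ => k) fun A hA =>
      hinter A (Finset.mem_filter.1 hA).1 R) ?_
    simpa [mul_comm] using hkl
  have hRc : R.card = X.card + WR.card + (FR.biUnion id).card := by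
    rw [hR, Finset.card_union_of_disjoint (by
      rw [Finset.disjoint_union_left]; exact ⟨f.disjX, f.disjRW⟩),
      Finset.card_union_of_disjoint f.disjXW.symm]
  -- The count k|F2| ≤ |R| - |D| has no slack, so the clique packing has to be exact up to
  -- divisibility.
  have hcl := hextras D hD f.disjXW (by
      have h3 : 2 * k * l = k * l + k * l := by ring
      have h4 : k * WR.card ≤ k * l := Nat.mul_le_mul_left _ (by omega)
      omega) f.degWR f.le_cardX f.pow_le_cardX f.packR f.disjX f.disjRW (m := F2.card) (by
      have h1 := Finset.le_card_sdiff D X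
      have h2 := Finset.card_le_card hD
      change ∑ A ∈ F1, (A ∩ R).card + ∑ A ∈ F2, (A ∩ R).card ≤ R.card at hsum
      omega)
  have hDB := hD'.trans hYB
  refine hp.add' (hcl.imp fun A hA => hclique hA) ?_ ?_ ?_ ?_
  · have hsub : X \ D ∪ WR ∪ FR.biUnion id ⊆ R :=
      Finset.union_subset_union (Finset.union_subset_union Finset.sdiff_subset
        (Finset.Subset.refl _)) (Finset.Subset.refl _)
    rw [Finset.disjoint_union_left, Finset.disjoint_union_left]
    refine ⟨⟨(hRE.mono hsub Finset.inter_subset_right).symm, ?_⟩,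
      (hRB.mono hsub hDB).symm⟩
    simp only [Finset.disjoint_union_right]
    exact ⟨⟨Finset.disjoint_sdiff, (f.disjXW.mono_right hD).symm⟩, f.disjX.mono_left hD⟩
  · intro z hz
    have h1 := @hD z
    have h2 := @hDB z
    have h3 := @hXR z
    simp only [Finset.mem_union, Finset.mem_inter] at hz ⊢
    tauto
  · intro z hz
    have h3 : z ∈ R := by
      simp only [hR, Finset.mem_union, Finset.mem_sdiff] at hz ⊢
      tauto
    simp only [Finset.mem_union]
    tauto
  · exact (Finset.card_filter_add_card_filter_not (fun A => (A ∩ E).Nonempty)).ge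

end Frame

theorem IsPacking.card_filter_not_disjoint_le {P : Finset W → Prop} {F : Finset (Finset W)}
    (h : IsPacking P F) (S : Finset W) :
    (F.filter fun A => ¬ Disjoint A S).card ≤ S.card := by
  refine le_trans (Finset.card_le_card fun A hA => ?_) (h.card_filter_inter_le S)
  rw [Finset.mem_filter] at hA ⊢
  exact ⟨hA.1, Finset.not_disjoint_iff_nonempty_inter.1 hA.2⟩

section Frame
variable [Fintype V] {G : SimpleGraph W} {H : SimpleGraph V} {X Y : Finset W}
  {FR FB : Finset (Finset W)} {WR WB E : Finset W} {l θ Θ M : ℕ}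

/-- Blue `(k - i)`-cliques on the blue side extend to disjoint blue copies of `H`. -/
theorem Frame.pack_of_cliques [Nonempty V] (f : Frame G H X Y FR FB WR WB E l θ Θ M)
    {D S : Finset W} {m : ℕ} (hDc : D.card ≤ Fintype.card V * l)
    (hi : H.indepNum < Fintype.card V) (hS : S ⊆ Y ∪ WB ∪ FB.biUnion id) (hm : m ≤ M + l)
    (h : Pack (Gᶜ.IsNClique (Fintype.card V - H.indepNum)) S m) :
    Pack (IsCopy Gᶜ H) ((X ∪ FR.biUnion id) \ D ∪ S) m := by
  obtain ⟨F, hF, hFS, rfl⟩ := h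
  have hrest := f.card_rest
  have hslX := f.slackX
  have hcross := f.cross
  have hcle := f.cross_le
  have hcardR := f.cardR
  have hRB := f.disjRB
  set k := Fintype.card V with hk
  set i := H.indepNum with hii
  set R' := X ∪ FR.biUnion id with hR'
  have hXR' : X ⊆ R' := Finset.subset_union_left
  have hR'B : Disjoint R' (Y ∪ WB ∪ FB.biUnion id) := by
    refine hRB.mono_left ?_
    intro z hz
    simp only [hR', Finset.mem_union] at hz ⊢
    tauto
  set F1 := F.filter fun A => ¬ Disjoint A WB with hF1
  set F2 := F.filter fun A => ¬ ¬ Disjoint A WB with hF2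
  have hF1s : F1 ⊆ F := Finset.filter_subset _ _
  have hF2s : F2 ⊆ F := Finset.filter_subset _ _
  have hF1c : F1.card ≤ l := (hF.card_filter_not_disjoint_le WB).trans (by omega)
  have hQB : ∀ Q ∈ F, Q ⊆ Y ∪ WB ∪ FB.biUnion id := fun Q hQ =>
    (subset_biUnion_id hQ).trans (hFS.trans hS)
  have hQk : ∀ Q ∈ F, Q.card ≤ k := fun Q hQ => by rw [(hF.prop Q hQ).2]; omega
  have hpow : 0 < 2 ^ (2 * k) := by positivity
  have hil : i * l ≤ k * l := Nat.mul_le_mul_right _ hi.le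
  have h2kl : 2 * k * l = k * l + k * l := by ring
  -- The few cliques meeting `WB` are served first and from `X` only, since the red degrees of `WB`
  -- are controlled only there.
  obtain ⟨I, hI, hID, hIc, hp⟩ := pack_attach_indep (G := Gᶜ) (H := H) (P := X) (D := D) (m := l)
    (N := fun Q => X.filter fun x => ∀ y ∈ Q, Gᶜ.Adj x y) F1 (hF.subset hF1s)
    (fun Q _ => Finset.filter_subset _ _) (fun Q _ x hx y hy => (Finset.mem_filter.1 hx).2 y hy)
    ((hR'B.mono_left hXR').mono_right
      (Finset.biUnion_subset.2 fun Q hQ => hQB Q (hF1s hQ))) hF1c (by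
      intro Q hQ
      have hQ' := hF1s hQ
      have h1 := card_le_common_add (G := G) (θ := Θ) ((hR'B.mono_left hXR').mono_right
        (hQB Q hQ')) (by
          intro y hy
          have hy' := hQB Q hQ' hy
          by_cases hyW : y ∈ WB
          · exact f.degWBX y hyW
          · refine le_trans (Finset.card_le_card (Finset.filter_subset_filter _ hXR'))
              ((hcross y ?_).trans hcle)
            simp only [Finset.mem_union] at hy' ⊢
            tauto)
      have h2 : Q.card * Θ ≤ k * Θ := Nat.mul_le_mul_right _ (hQk Q hQ')
      change D.card + i * l ≤ _
      omega)
  -- The remaining cliques lie in `Y` and the blocks of `FB`, where `cross` controls red degrees to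
  -- all of `R'`. The core `X` alone might be too small for all of them.
  have hp2 := pack_attach_indep (G := Gᶜ) (H := H) (P := R') (D := D ∪ I) (m := F.card)
    (N := fun Q => R'.filter fun x => ∀ y ∈ Q, Gᶜ.Adj x y) F2 (hF.subset hF2s)
    (fun Q _ => Finset.filter_subset _ _) (fun Q _ x hx y hy => (Finset.mem_filter.1 hx).2 y hy)
    (hR'B.mono_right
      (Finset.biUnion_subset.2 fun Q hQ => hQB Q (hF2s hQ))) (Finset.card_le_card hF2s) (by
      intro Q hQ
      have hQ' := hF2s hQ
      have h1 := card_le_common_add (G := G) (θ := θ) (hR'B.mono_right (hQB Q hQ')) (by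
          intro y hy
          have hy' := hQB Q hQ' hy
          have hyW : y ∉ WB := Finset.disjoint_left.1
            (not_not.1 (Finset.mem_filter.1 hQ).2) hy
          refine hcross y ?_
          simp only [Finset.mem_union] at hy' ⊢
          tauto)
      have h2 : Q.card * θ ≤ k * θ := Nat.mul_le_mul_right _ (hQk Q hQ')
      have h3 := Finset.card_union_le D I
      have h4 : I.card ≤ k * l := by
        rw [hIc]; exact Nat.mul_le_mul hi.le hF1c
      have h5 : i * F.card ≤ i * (M + l) := Nat.mul_le_mul_left _ hm
      change (D ∪ I).card + i * F.card ≤ _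
      omega)
  obtain ⟨J, hJ, hJD, hJc, hp2⟩ := hp2
  have hF12 : Disjoint (F1.biUnion id) (F2.biUnion id) := by
    rw [Finset.disjoint_biUnion_left]
    intro A hA
    rw [Finset.disjoint_biUnion_right]
    intro B hB
    exact hF.disj A (hF1s hA) B (hF2s hB) fun he =>
      (Finset.mem_filter.1 hB).2 (he ▸ (Finset.mem_filter.1 hA).2)
  refine hp.add' hp2 ?_ ?_ ?_ ?_
  · rw [Finset.disjoint_union_right] at hJD
    simp only [Finset.disjoint_union_left, Finset.disjoint_union_right]
    exact ⟨⟨hJD.2.symm, (hR'B.mono hJ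
      (Finset.biUnion_subset.2 fun Q hQ => hQB Q (hF1s hQ))).symm⟩,
      (hR'B.mono (hI.trans hXR') (Finset.biUnion_subset.2 fun Q hQ => hQB Q (hF2s hQ))), hF12⟩
  · refine Finset.union_subset_union ?_ ((Finset.biUnion_subset_biUnion_of_subset_left _ hF1s).trans
      hFS)
    exact Finset.subset_sdiff.2 ⟨hI.trans hXR', hID⟩
  · refine Finset.union_subset_union ?_ ((Finset.biUnion_subset_biUnion_of_subset_left _ hF2s).trans
      hFS)
    exact Finset.subset_sdiff.2 ⟨hJ, (Finset.disjoint_union_right.1 hJD).1⟩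
  · exact (Finset.card_filter_add_card_filter_not (fun A => ¬ Disjoint A WB)).ge

/-- Copies meeting `E` are replaced as in the red case. Every other blue copy has at least k - i
vertices in `B`, because `R` carries no blue edge. So the rest of `B` has room for as many blue (k -
i)-cliques, found by exact packing and then completed on the red side. -/
theorem Frame.pack_blue [Nonempty V] (hi : H.indepNum < Fintype.card V)
    (f : Frame G H X Y FR FB WR WB E l θ Θ M) {m : ℕ}
    (h : Pack (IsCopy (st G (X ∪ WR ∪ FR.biUnion id) (Y ∪ WB ∪ FB.biUnion id) E)ᶜ H)
      (X ∪ WR ∪ FR.biUnion id ∪ (Y ∪ WB ∪ FB.biUnion id) ∪ E) m) :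
    Pack (IsCopy Gᶜ H) (X ∪ WR ∪ FR.biUnion id ∪ (Y ∪ WB ∪ FB.biUnion id) ∪ E) m := by
  have hrest := f.card_rest
  have hthr := f.le_threshold
  have hslX := f.slackX
  have hslY := f.slackY
  have hcross := f.cross
  have hcle := f.cross_le
  have hcardB := f.cardB
  have hRB := f.disjRB
  have hRE := f.disjRE
  have hBE := f.disjBE
  have hcardk : ∀ {G' : SimpleGraph W} {A}, IsCopy G' H A → A.card = Fintype.card V :=
    fun hA => hA.card
  have hleft : ∀ {R B A : Finset W}, IsCopy (st G R B E)ᶜ H A → (A ∩ R).card ≤ H.indepNum :=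
    fun hA => hA.card_inter_left_le
  have hcliques := fun (D S : Finset W) (m : ℕ) hDc hS hm =>
    f.pack_of_cliques (D := D) (S := S) (m := m) hDc hi hS hm
  have hextras := fun (D : Finset W) => pack_cliques_with_extras (G := Gᶜ) (X := Y) (D := D)
    (T := WB) (F := FB) (Θ := Θ) (q := Fintype.card V - H.indepNum) (k := Fintype.card V)
    (by omega) (Nat.sub_le _ _) (by rw [compl_compl]; exact f.freeY)
    (fun v hv => by simpa only [compl_compl] using f.degY v hv)
  set k := Fintype.card V with hk
  set i := H.indepNum with hii
  set R := X ∪ WR ∪ FR.biUnion id with hR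
  set B := Y ∪ WB ∪ FB.biUnion id with hB
  have hXR : X ⊆ R := Finset.subset_union_left.trans Finset.subset_union_left
  have hYB : Y ⊆ B := Finset.subset_union_left.trans Finset.subset_union_left
  obtain ⟨F, hF, hFU, rfl⟩ := h
  set F1 := F.filter fun A => (A ∩ E).Nonempty with hF1
  set F2 := F.filter fun A => ¬ (A ∩ E).Nonempty with hF2
  have hAU : ∀ A ∈ F, A ⊆ R ∪ B ∪ E := fun A hA => (subset_biUnion_id hA).trans hFU
  have hF1c : F1.card ≤ l := (hF.card_filter_inter_le E).trans (by omega)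
  have hkl : k * F1.card ≤ k * l := Nat.mul_le_mul_left _ hF1c
  have hinter : ∀ A ∈ F, ∀ S, (A ∩ S).card ≤ k := fun A hA S =>
    (Finset.card_le_card Finset.inter_subset_left).trans (hcardk (hF.prop A hA)).le
  have h2kl : 2 * k * l = k * l + k * l := by ring
  obtain ⟨D, hD, D', hD', hDc, hDc', hp⟩ := pack_replace (P' := IsCopy Gᶜ H) (k := k) (N := l)
    (hRB.mono hXR hYB) (hRE.mono_left hXR) (hBE.mono_left hYB) (fun A => (A ∩ R).card)
    (fun A => (A ∩ B).card) F1 (hF.subset (Finset.filter_subset _ _))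
    (fun A hA => hinter A (Finset.mem_filter.1 hA).1 R)
    (fun A hA => hinter A (Finset.mem_filter.1 hA).1 B)
    (fun A hA => (Finset.mem_filter.1 hA).2) hF1c (by
      intro A hA D D' hD hD'
      have hA' := (Finset.mem_filter.1 hA).1
      have hkΘ : 0 ≤ k * Θ := Nat.zero_le _
      obtain ⟨C', hC', hCq⟩ := (f.freeY.subset Finset.sdiff_subset).exists_clique'
        (A ∩ B).card (A := Y \ D') (show 2 ^ ((A ∩ B).card + k) ≤ _ by
          have h1 := Finset.le_card_sdiff D' Y
          have h2 : 2 ^ ((A ∩ B).card + k) ≤ 2 ^ (2 * k) :=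
            Nat.pow_le_pow_right (by norm_num) (by have := hinter A hA' B; omega)
          omega)
      have hCY' := hC'.trans Finset.sdiff_subset
      -- The trace on `R` needs no inner blue edges, only blue edges to `E` and to the blue clique
      -- `C'`, which is therefore chosen beforehand.
      have hcommon := card_le_common_add (G := G) (X := X) (Q := E ∪ C') (θ := Θ)
        (Finset.disjoint_union_right.2 ⟨hRE.mono_left hXR, hRB.mono hXR (hCY'.trans hYB)⟩) (by
          intro y hy
          rcases Finset.mem_union.1 hy with hy | hy
          · exact f.degEX y hy
          · exact (Finset.card_le_card (Finset.filter_subset_filter _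
              Finset.subset_union_left)).trans
                ((hcross y (Finset.mem_union_left _ (hCY' hy))).trans hcle))
      obtain ⟨C, hC, hCc⟩ := Finset.exists_subset_card_eq
        (s := (X.filter fun x => ∀ y ∈ E ∪ C', Gᶜ.Adj x y) \ D) (n := (A ∩ R).card) (by
          have h1 := Finset.le_card_sdiff D (X.filter fun x => ∀ y ∈ E ∪ C', Gᶜ.Adj x y)
          have h2 := hinter A hA' R
          have h3 := hinter A hA' B
          have h4 : (E ∪ C').card * Θ ≤ (l + k) * Θ := Nat.mul_le_mul_right _
            ((Finset.card_union_le _ _).trans (by rw [hCq.2]; omega))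
          rw [add_mul] at h4
          have h5 : 2 * k < 2 ^ (2 * k) := Nat.lt_two_pow_self
          omega)
      have hCf := hC.trans Finset.sdiff_subset
      have hCX := hCf.trans (Finset.filter_subset _ _)
      refine ⟨C, hC.trans (Finset.sdiff_subset_sdiff (Finset.filter_subset _ _)
        (Finset.Subset.refl _)), C', hC', hCc, hCq.2, ?_⟩
      exact (hF.prop A hA').replace hRB hRE hBE (hAU A hA') hCc.symm hCq.2.symm
        (hRB.mono (hCX.trans hXR) (hCY'.trans hYB)) (hRE.mono_left (hCX.trans hXR))
        (hBE.mono_left (hCY'.trans hYB)) st_compl_adj_of_mem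
        (Or.inl st_compl_not_adj_of_mem_left)
        (Or.inr fun x hx y hy hne => hCq.1 hx hy hne)
        (Or.inr fun x hx y hy => (Finset.mem_filter.1 (hCf hx)).2 y (Finset.mem_union_right _ hy))
        (Or.inr fun x hx y hy => (Finset.mem_filter.1 (hCf hx)).2 y (Finset.mem_union_left _ hy))
        (Or.inl st_compl_not_adj_of_mem_right))
  have hF2B : ∀ A ∈ F2, k - i ≤ (A ∩ B).card := fun A hA => by
    obtain ⟨hA1, hA2⟩ := Finset.mem_filter.1 hA
    have h1 := card_eq_inter_add hRB hRE hBE (hAU A hA1)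
    have h2 := hleft (hF.prop A hA1)
    have h3 := hcardk (hF.prop A hA1)
    rw [Finset.not_nonempty_iff_eq_empty.1 hA2, Finset.card_empty] at h1
    omega
  have hsum := hF.sum_card_inter_le B
  rw [← Finset.sum_filter_add_sum_filter_not F (fun A => (A ∩ E).Nonempty)] at hsum
  have hsum2 : (k - i) * F2.card ≤ ∑ A ∈ F2, (A ∩ B).card := by
    have := Finset.sum_le_sum hF2B
    simpa [mul_comm] using this
  change ∑ A ∈ F1, (A ∩ B).card + ∑ A ∈ F2, (A ∩ B).card ≤ B.card at hsum
  have hbd : ∀ S, ∑ A ∈ F1, (A ∩ S).card ≤ k * l := fun S => by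
    refine le_trans (Finset.sum_le_sum (g := fun _ => k) fun A hA =>
      hinter A (Finset.mem_filter.1 hA).1 S) ?_
    simpa [mul_comm] using hkl
  have hDk : D.card ≤ k * l := by rw [hDc]; exact hbd R
  have hDk' : D'.card ≤ k * l := by rw [hDc']; exact hbd B
  have hYB' : (Y ∪ FB.biUnion id).card = Y.card + (FB.biUnion id).card :=
    Finset.card_union_of_disjoint f.disjY
  have hBc : B.card = Y.card + WB.card + (FB.biUnion id).card := by
    rw [hB, Finset.card_union_of_disjoint (by
      rw [Finset.disjoint_union_left]; exact ⟨f.disjY, f.disjBW⟩),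
      Finset.card_union_of_disjoint f.disjYW.symm]
  have hcl := hextras D' hD' f.disjYW (by
      have h4 : k * WB.card ≤ k * l := Nat.mul_le_mul_left _ (by omega)
      omega) (fun w hw => by convert f.degWB w hw) f.le_cardY f.pow_le_cardY f.packB f.disjY f.disjBW (m := F2.card) (by
      have h1 := Finset.le_card_sdiff D' Y
      have h2 := Finset.card_le_card hD'
      omega)
  have hsub : Y \ D' ∪ WB ∪ FB.biUnion id ⊆ B :=
    Finset.union_subset_union (Finset.union_subset_union Finset.sdiff_subset
      (Finset.Subset.refl _)) (Finset.Subset.refl _)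
  have hF2c : F2.card ≤ M + l := by
    have h1 : (k - i) * F2.card ≤ (k - i) * (M + l) := by
      have h2 : l ≤ (k - i) * l := Nat.le_mul_of_pos_left _ (by omega)
      rw [mul_add]
      omega
    exact Nat.le_of_mul_le_mul_left h1 (by omega)
  have hfin := hcliques D _ _ hDk hsub hF2c hcl
  have hDB := hD'.trans hYB
  have hDR := hD.trans hXR
  have hR's : (X ∪ FR.biUnion id) \ D ⊆ R := by
    intro z hz
    simp only [hR, Finset.mem_union, Finset.mem_sdiff] at hz ⊢
    tauto
  refine hp.add' hfin ?_ ?_ ?_ ?_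
  · rw [Finset.disjoint_union_left, Finset.disjoint_union_left]
    refine ⟨⟨Disjoint.mono_left Finset.inter_subset_right ?_, ?_⟩, ?_⟩
    · rw [Finset.disjoint_union_right]
      exact ⟨(hRE.mono_left hR's).symm, (hBE.mono_left hsub).symm⟩
    · rw [Finset.disjoint_union_right]
      exact ⟨Finset.disjoint_sdiff, hRB.mono hDR hsub⟩
    · simp only [Finset.disjoint_union_right]
      exact ⟨(hRB.mono hR's hDB).symm, ⟨⟨Finset.disjoint_sdiff,
        (f.disjYW.mono_right hD').symm⟩, f.disjY.mono_left hD'⟩⟩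
  · intro z hz
    have h1 := @hDR z
    have h2 := @hDB z
    simp only [Finset.mem_union, Finset.mem_inter] at hz ⊢
    tauto
  · exact (Finset.union_subset_union hR's hsub).trans Finset.subset_union_left
  · exact (Finset.card_filter_add_card_filter_not (fun A => (A ∩ E).Nonempty)).ge

end Frame

/-! ### Existence of a frame -/

theorem NoClique.exists_core_cover {G : SimpleGraph W} {k q : ℕ} {A : Finset W}
    (h : NoClique Gᶜ k A) (hq : 1 ≤ q) (hqk : q ≤ k) :
    ∃ X F, X ⊆ A ∧ A.card ≤ 32 ^ k * X.card ∧
      (∀ v ∈ X, 32 * (X.filter (Gᶜ.Adj v)).card ≤ X.card) ∧ IsPacking (G.IsNClique q) F ∧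
      F.biUnion id ⊆ A ∧ Disjoint X (F.biUnion id) ∧
      A.card ≤ (X ∪ F.biUnion id).card + 2 ^ (2 * k) := by
  obtain ⟨X, hX, hc, hd⟩ := exists_core Gᶜ k A h
  obtain ⟨F, hF, hFX, hFc⟩ := (h.subset (Finset.sdiff_subset (t := X))).exists_cover hq
  have hdis : Disjoint X (F.biUnion id) := Finset.disjoint_of_subset_right hFX Finset.disjoint_sdiff
  refine ⟨X, F, hX, hc, fun v hv => by convert hd v hv, hF, hFX.trans Finset.sdiff_subset, hdis, ?_⟩
  have h1 : 2 ^ (q + k) ≤ 2 ^ (2 * k) := Nat.pow_le_pow_right (by norm_num) (by omega)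
  have h2 := Finset.card_sdiff_add_card_eq_card hFX
  have h3 := Finset.card_sdiff_add_card_eq_card hX
  have h4 := Finset.card_union_of_disjoint hdis
  omega

/-- Blue (k - i)-cliques are found greedily in `Y`. Each is joined in blue to all but at most kθ
vertices of `X`, from which i fresh ones are taken. -/
theorem pack_blue_of_pools [Fintype V] [Nonempty V] {G : SimpleGraph W} {H : SimpleGraph V}
    (hi : H.indepNum < Fintype.card V) {X Y : Finset W} (hXY : Disjoint X Y)
    (hY : NoClique G (Fintype.card V) Y) {θ ν : ℕ}
    (hθ : ∀ y ∈ Y, (X.filter (G.Adj y)).card ≤ θ)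
    (hYc : (Fintype.card V - H.indepNum) * ν + 2 ^ (2 * Fintype.card V) ≤ Y.card)
    (hXc : H.indepNum * ν + Fintype.card V * θ ≤ X.card) : Pack (IsCopy Gᶜ H) (X ∪ Y) ν := by
  have h1 : 2 ^ (Fintype.card V - H.indepNum + Fintype.card V) ≤ 2 ^ (2 * Fintype.card V) :=
    Nat.pow_le_pow_right (by norm_num) (by omega)
  obtain ⟨F, hF, hFY, rfl⟩ := NoClique.pack (G := Gᶜ) (k := Fintype.card V) (A := Y)
    (by rwa [compl_compl]) (q := Fintype.card V - H.indepNum) (by omega) (m := ν) (by omega)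
  obtain ⟨I, hI, -, -, hp⟩ := pack_attach_indep (G := Gᶜ) (H := H) (P := X) (D := ∅)
    (m := F.card) (N := fun Q => X.filter fun x => ∀ y ∈ Q, Gᶜ.Adj x y) F hF
    (fun Q _ => Finset.filter_subset _ _) (fun Q _ x hx y hy => (Finset.mem_filter.1 hx).2 y hy)
    (hXY.mono_right hFY) le_rfl (by
      intro Q hQ
      have hQY := (subset_biUnion_id hQ).trans hFY
      have h2 := card_le_common_add (G := G) (θ := θ) (hXY.mono_right hQY)
        (fun y hy => hθ y (hQY hy))
      have h3 : Q.card * θ ≤ Fintype.card V * θ := Nat.mul_le_mul_right _ (by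
        rw [(hF.prop Q hQ).2]; omega)
      rw [Finset.card_empty]
      omega)
  exact hp.mono (Finset.union_subset_union hI hFY)

theorem pow_succ_mul_le {k : ℕ} (hk : 2 ≤ k) (a : ℕ) : 4 * 2 ^ (a * k) ≤ 2 ^ ((a + 1) * k) := by
  rw [add_mul, one_mul, pow_add, mul_comm]
  exact Nat.mul_le_mul_left _ ((Nat.pow_le_pow_right (by norm_num) hk : 2 ^ 2 ≤ 2 ^ k))

theorem mul_pow_le (k a : ℕ) : k * 2 ^ (a * k) ≤ 2 ^ ((a + 1) * k) := by
  rw [add_mul, one_mul, pow_add, mul_comm]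
  exact Nat.mul_le_mul_left _ Nat.lt_two_pow_self.le

/-- The colouring `st G R B E` of `R ∪ B ∪ E` contains no `m` disjoint monochromatic copies. -/
def Avoids (G : SimpleGraph W) (H : SimpleGraph V) (R B E : Finset W) (m : ℕ) : Prop :=
  ¬ Pack (IsCopy (st G R B E) H) (R ∪ B ∪ E) m ∧ ¬ Pack (IsCopy (st G R B E)ᶜ H) (R ∪ B ∪ E) m

theorem exists_trisection (L : Finset W) (p q : W → Prop) : ∃ A B E : Finset W,
    A ∪ B ∪ E = L ∧ Disjoint A B ∧ Disjoint A E ∧ Disjoint B E ∧ (∀ w ∈ A, p w) ∧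
      (∀ w ∈ B, ¬ p w ∧ q w) ∧ ∀ w ∈ E, ¬ p w ∧ ¬ q w := by
  refine ⟨L.filter p, L.filter fun w => ¬ p w ∧ q w, L.filter fun w => ¬ p w ∧ ¬ q w,
    ?_, ?_, ?_, ?_, fun w hw => (Finset.mem_filter.1 hw).2, fun w hw => (Finset.mem_filter.1 hw).2,
    fun w hw => (Finset.mem_filter.1 hw).2⟩
  · ext z
    simp only [Finset.mem_union, Finset.mem_filter]
    tauto
  all_goals
    rw [Finset.disjoint_left]
    intro z hz hz'
    rw [Finset.mem_filter] at hz hz'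
    tauto

/-- The scales are separated: pool errors below 2^(11k), red degrees between the pools 2^(12k),
leftover vertices l = 2^(15k), degree threshold 2^(18k), cores at least 2^(54k), M = 2^(60k). In
particular l times the threshold, 2^(33k), is negligible against the cores. -/
theorem Extremal.exists_frame [Fintype W] [Fintype V] [Nonempty V] {G : SimpleGraph W}
    {H : SimpleGraph V} {n k i M l : ℕ} (h : Extremal G H n) (hk : 2 ≤ k)
    (hkV : Fintype.card V = k) (hiH : H.indepNum = i)
    (hM : M = 2 ^ (60 * k)) (hl : l = 2 ^ (15 * k))
    (hP : HasPairs G k (M + 2 ^ (9 * k))) :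
    ∃ (X Y : Finset W) (FR FB : Finset (Finset W)) (WR WB E : Finset W) (s : ℕ),
      Frame G H X Y FR FB WR WB E l (2 ^ (12 * k)) (2 ^ (18 * k)) M ∧ s < n ∧
      (X ∪ WR ∪ FR.biUnion id).card + (Y ∪ WB ∪ FB.biUnion id).card + E.card +
        (2 * k - i) * s = Fintype.card W ∧
      (∀ ν, Pack (IsCopy G H)
        (X ∪ WR ∪ FR.biUnion id ∪ (Y ∪ WB ∪ FB.biUnion id) ∪ E) ν → ν + s < n) ∧
      (∀ ν, Pack (IsCopy Gᶜ H)
        (X ∪ WR ∪ FR.biUnion id ∪ (Y ∪ WB ∪ FB.biUnion id) ∪ E) ν → ν + s < n) ∧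
      (X ∪ FR.biUnion id).card ≤ k * M ∧
      k * M ≤ (X ∪ FR.biUnion id).card + 2 ^ (2 * k) ∧
      (k - i) * M ≤ (Y ∪ FB.biUnion id).card + 2 ^ (11 * k) ∧
      M + s ≤ n + 2 ^ (11 * k) := by
  have hi := h.indep
  have hcover := fun (X : Finset W) (hX : NoClique Gᶜ (Fintype.card V) X) =>
    hX.exists_core_cover (q := Fintype.card V) Fintype.card_pos le_rfl
  have hcover' := fun (X : Finset W) (hX : NoClique Gᶜᶜ (Fintype.card V) X) =>
    hX.exists_core_cover (q := Fintype.card V - H.indepNum) (by omega) (Nat.sub_le _ _)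
  have hred' : ∀ {A : Finset W}, G.IsNClique (Fintype.card V) A → IsCopy G H A :=
    fun hA => isCopy_of_clique H hA
  have hblue' := fun {X Y : Finset W} {θ ν : ℕ} (hXY : Disjoint X Y) hY hθ =>
    pack_blue_of_pools (H := H) (G := G) hi hXY hY (θ := θ) (ν := ν) hθ
  have hreduct := h.reduct
  have hpools := fun hM => h.exists_blue_pools (M := M) hM
  rw [hkV] at hi hcover hcover' hred' hblue' hreduct hpools
  rw [hiH] at hi hcover' hblue' hreduct hpools
  have q2 := pow_succ_mul_le hk 2
  have q3 : 2 ^ (3 * k) ≤ 2 ^ (9 * k) := Nat.pow_le_pow_right (by norm_num) (by omega)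
  have q9 := pow_succ_mul_le hk 9
  have q10 := pow_succ_mul_le hk 10
  have q11 : 2 ^ (11 * k) ≤ 2 ^ (12 * k) := Nat.pow_le_pow_right (by norm_num) (by omega)
  have q12 := pow_succ_mul_le hk 12
  have q13 := pow_succ_mul_le hk 13
  have q14 := pow_succ_mul_le hk 14
  have q15 := pow_succ_mul_le hk 15
  have q16 := pow_succ_mul_le hk 16
  have q17 := pow_succ_mul_le hk 17
  have q18 := pow_succ_mul_le hk 18
  have q19 : 2 ^ (19 * k) ≤ 2 ^ (33 * k) := Nat.pow_le_pow_right (by norm_num) (by omega)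
  have q33 := pow_succ_mul_le hk 33
  have q34 : 2 ^ (34 * k) ≤ 2 ^ (54 * k) := Nat.pow_le_pow_right (by norm_num) (by omega)
  have q54 := pow_succ_mul_le hk 54
  have q55 : 2 ^ (55 * k) ≤ 2 ^ (59 * k) := Nat.pow_le_pow_right (by norm_num) (by omega)
  have q59 := pow_succ_mul_le hk 59
  have r9 := mul_pow_le k 9
  have r12 := mul_pow_le k 12
  have r15 := mul_pow_le k 15
  have r18 := mul_pow_le k 18
  have hpos2 : 0 < 2 ^ (2 * k) := by positivity
  norm_num only at q2 q9 q10 q12 q13 q14 q15 q16 q17 q18 q33 q54 q59 r9 r12 r15 r18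
  obtain ⟨c, rfl⟩ : ∃ c, k = c + i := ⟨k - i, by omega⟩
  set k := c + i with hkdef
  have hkc : k - i = c := by omega
  have hκ : 2 * k - i = k + c := by omega
  have hc1 : 1 ≤ c := by omega
  have hkM : k * M = c * M + i * M := by rw [hkdef, add_mul]
  have hcM : M ≤ c * M := Nat.le_mul_of_pos_left _ hc1
  obtain ⟨X0, Y1, hd0, hX0, hY1, hX0c, hY1c, hY1c', hcr⟩ := hpools (by omega) hP
  obtain ⟨X, FR, hX, hXc, hXd, hFR, hFRX, hdX, hXcov⟩ := hcover X0 hX0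
  obtain ⟨Y, FB, hY, hYc, hYd, hFB, hFBY, hdY, hYcov⟩ := hcover' Y1 (by rwa [compl_compl])
  -- Passing to a core costs at most this factor.
  have h32 : 32 ^ k = 2 ^ (5 * k) := by rw [pow_mul]; norm_num
  have hX55 : 2 ^ (55 * k) ≤ X.card := by
    refine Nat.le_of_mul_le_mul_left (show 2 ^ (5 * k) * _ ≤ 2 ^ (5 * k) * _ from ?_)
      (Nat.two_pow_pos _)
    rw [← pow_add, show 5 * k + 55 * k = 60 * k by ring, ← hM, ← h32]
    omega
  rw [hkc] at hY1c hY1c'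
  have hY54 : 2 ^ (54 * k) ≤ Y.card := by
    refine Nat.le_of_mul_le_mul_left (show 2 ^ (5 * k) * _ ≤ 2 ^ (5 * k) * _ from ?_)
      (Nat.two_pow_pos _)
    rw [← pow_add, show 5 * k + 54 * k = 59 * k by ring, ← h32]
    omega
  set X' := X ∪ FR.biUnion id with hX'
  set Y' := Y ∪ FB.biUnion id with hY'
  have hX'X : X' ⊆ X0 := Finset.union_subset hX hFRX
  have hY'Y : Y' ⊆ Y1 := Finset.union_subset hY hFBY
  have hdXY : Disjoint X' Y' := hd0.mono hX'X hY'Y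
  have hcross : ∀ y ∈ Y', (X'.filter (G.Adj y)).card ≤ 2 ^ (12 * k) := fun y hy =>
    (Finset.card_le_card (Finset.filter_subset_filter _ hX'X)).trans (hcr y (hY'Y hy)).le
  have hX'c := Finset.card_le_card hX'X
  have hY'c := Finset.card_le_card hY'Y
  -- The deficit 2^(11k) absorbs the vertices missing from the pools and the Ramsey remainders.
  obtain ⟨ν, hν⟩ : ∃ ν, M = ν + 2 ^ (11 * k) := ⟨M - 2 ^ (11 * k), by omega⟩
  have hkν : k * M = k * ν + k * 2 ^ (11 * k) := by rw [hν, mul_add]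
  have hcν : c * M = c * ν + c * 2 ^ (11 * k) := by rw [hν, mul_add]
  have hiν : i * M = i * ν + i * 2 ^ (11 * k) := by rw [hν, mul_add]
  have hk11 : 2 ^ (11 * k) ≤ k * 2 ^ (11 * k) := Nat.le_mul_of_pos_left _ (by omega)
  have hc11 : 2 ^ (11 * k) ≤ c * 2 ^ (11 * k) := Nat.le_mul_of_pos_left _ (by omega)
  have hred : Pack (IsCopy G H) (X' ∪ Y') ν := by
    have h1 : Pack (G.IsNClique k) X' ν := by
      refine NoClique.pack (hX0.subset hX'X) (by omega) ?_
      rw [show k + k = 2 * k by ring]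
      omega
    exact (h1.imp fun A hA => hred' hA).mono Finset.subset_union_left
  have hblue : Pack (IsCopy Gᶜ H) (X' ∪ Y') ν := by
    refine hblue' hdXY (hY1.subset hY'Y) hcross ?_ ?_
    · rw [hkc]
      omega
    · omega
  obtain ⟨L, s, hSL, hs, hcard, hnr, hnb, hLc⟩ := hreduct (X' ∪ Y')
  rw [hκ] at hcard hLc
  have hScard : (X' ∪ Y').card = X'.card + Y'.card := Finset.card_union_of_disjoint hdXY
  -- The pools have at most κM vertices and hold M - 2^(11k) copies in each colour, so the counting
  -- bound leaves only about kκ·2^(11k) vertices in `L`.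
  have hLl : L.card ≤ l := by
    have h1 := hLc ν hred hblue
    have h2 : k * (X' ∪ Y').card ≤ k * ((k + c) * M) := Nat.mul_le_mul_left _ (by
      rw [hScard, add_mul]; omega)
    have h3 : k * ((k + c) * M) = k * ((k + c) * ν) + k * ((k + c) * 2 ^ (11 * k)) := by
      rw [hν]; ring
    have h4 : k * ((k + c) * 2 ^ (11 * k)) ≤ 2 * 2 ^ (13 * k) := by
      have e1 : (k + c) * 2 ^ (11 * k) ≤ 2 * (k * 2 ^ (11 * k)) := by
        rw [← mul_assoc]; exact Nat.mul_le_mul_right _ (by omega)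
      have e2 := mul_pow_le k 11
      have e3 := mul_pow_le k 12
      norm_num only at e2 e3
      calc k * ((k + c) * 2 ^ (11 * k)) ≤ k * (2 * 2 ^ (12 * k)) :=
            Nat.mul_le_mul_left _ (by omega)
        _ = 2 * (k * 2 ^ (12 * k)) := by ring
        _ ≤ _ := by omega
    have h5 : (k + c) * 2 ^ (7 * k) ≤ 2 * 2 ^ (8 * k) := by
      have e1 : (k + c) * 2 ^ (7 * k) ≤ 2 * (k * 2 ^ (7 * k)) := by
        rw [← mul_assoc]; exact Nat.mul_le_mul_right _ (by omega)
      have e2 := mul_pow_le k 7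
      norm_num only at e2
      omega
    have h6 : 2 ^ (8 * k) ≤ 2 ^ (13 * k) := Nat.pow_le_pow_right (by norm_num) (by omega)
    omega
  -- The red test comes first. Hence vertices of `WB` send few red edges to `X`, and vertices of `E`
  -- in addition few blue edges to `Y`.
  obtain ⟨WR, WB, E, hL, hdWR, hdWE, hdWBE, hWR, hWB, hE⟩ := exists_trisection L
    (fun w => 2 ^ (18 * k) ≤ (X.filter (G.Adj w)).card)
    (fun w => 2 ^ (18 * k) ≤ (Y.filter (Gᶜ.Adj w)).card)
  have hWRL : WR ⊆ L := by
    rw [← hL]; exact Finset.subset_union_left.trans Finset.subset_union_left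
  have hWBL : WB ⊆ L := by
    rw [← hL]; exact Finset.subset_union_right.trans Finset.subset_union_left
  have hEL : E ⊆ L := by rw [← hL]; exact Finset.subset_union_right
  have hdS1 : ∀ {A : Finset W}, A ⊆ X' → Disjoint A L := fun hA =>
    hSL.mono_left (hA.trans Finset.subset_union_left)
  have hdS2 : ∀ {A : Finset W}, A ⊆ Y' → Disjoint A L := fun hA =>
    hSL.mono_left (hA.trans Finset.subset_union_right)
  have hXX' : X ⊆ X' := Finset.subset_union_left
  have hFX' : FR.biUnion id ⊆ X' := Finset.subset_union_right
  have hYY' : Y ⊆ Y' := Finset.subset_union_left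
  have hFY' : FB.biUnion id ⊆ Y' := Finset.subset_union_right
  have hReq : X ∪ WR ∪ FR.biUnion id = X' ∪ WR := by
    rw [hX', Finset.union_right_comm]
  have hBeq : Y ∪ WB ∪ FB.biUnion id = Y' ∪ WB := by
    rw [hY', Finset.union_right_comm]
  have hLc' : WR.card + WB.card + E.card = L.card := by
    rw [← hL, Finset.card_union_of_disjoint (Finset.disjoint_union_left.2 ⟨hdWE, hdWBE⟩),
      Finset.card_union_of_disjoint hdWR]
  have hUeq : X' ∪ WR ∪ (Y' ∪ WB) ∪ E = X' ∪ Y' ∪ L := by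
    rw [← hL, Finset.union_union_union_comm, Finset.union_assoc]
  have hRB : Disjoint (X' ∪ WR) (Y' ∪ WB) := by
    simp only [Finset.disjoint_union_left, Finset.disjoint_union_right]
    exact ⟨⟨hdXY, ((hdS2 (Finset.Subset.refl _)).mono_right hWRL).symm⟩,
      (hdS1 (Finset.Subset.refl _)).mono_right hWBL, hdWR⟩
  have hRE : Disjoint (X' ∪ WR) E := by
    rw [Finset.disjoint_union_left]
    exact ⟨(hdS1 (Finset.Subset.refl _)).mono_right hEL, hdWE⟩
  have hBE : Disjoint (Y' ∪ WB) E := by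
    rw [Finset.disjoint_union_left]
    exact ⟨(hdS2 (Finset.Subset.refl _)).mono_right hEL, hdWBE⟩
  have hlΘ : l * 2 ^ (18 * k) = 2 ^ (33 * k) := by
    rw [hl, ← pow_add]; congr 1; ring
  have h2kl : 2 * k * l = 2 * (k * 2 ^ (15 * k)) := by rw [hl]; ring
  have hil : i * (M + l) + l ≤ i * M + k * 2 ^ (15 * k) := by
    have : i * l + c * l = k * 2 ^ (15 * k) := by rw [hl, hkdef]; ring
    have h2 : l ≤ c * l := Nat.le_mul_of_pos_left _ hc1
    rw [mul_add]; omega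
  refine ⟨X, Y, FR, FB, WR, WB, E, s, ?_, hs, ?_, ?_, ?_, ?_, ?_, ?_, ?_⟩
  · constructor
    · rw [hkV]; exact hX0.subset hX
    · rw [hkV]; exact hY1.subset hY
    · exact hXd
    · exact fun v hv => by simpa only [compl_compl] using hYd v hv
    · rw [hkV]; exact hFR
    · rw [hkV, hiH]; exact hFB
    · exact hdX
    · exact ((hdS1 hXX').mono_right hWRL).symm
    · exact ((hdS1 hFX').mono_right hWRL).symm
    · exact hdY
    · exact ((hdS2 hYY').mono_right hWBL).symm
    · exact ((hdS2 hFY').mono_right hWBL).symm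
    · rw [hReq, hBeq]; exact hRB
    · rw [hReq]; exact hRE
    · rw [hBeq]; exact hBE
    · exact hcross
    · exact hWR
    · exact fun w hw => (hWB w hw).2
    · exact fun w hw => (not_le.1 (hWB w hw).1).le
    · exact fun w hw => (not_le.1 (hE w hw).1).le
    · exact fun w hw => (not_le.1 (hE w hw).2).le
    · omega
    · rw [hkV]; omega
    · omega
    · omega
    · rw [hkV]; omega
    · rw [hkV]; omega
    · rw [hkV]; omega
    · rw [hkV]; omega
    · omega
    · rw [← hY', hkV, hiH, hkc]; omega
    · rw [← hX', hkV, hiH]; omega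
  · rw [hReq, hBeq, Finset.card_union_of_disjoint ((hdS1 (Finset.Subset.refl _)).mono_right hWRL),
      Finset.card_union_of_disjoint ((hdS2 (Finset.Subset.refl _)).mono_right hWBL), hκ]
    omega
  · rw [hReq, hBeq, hUeq]; exact hnr
  · rw [hReq, hBeq, hUeq]; exact hnb
  · rw [← hX']; omega
  · rw [← hX']; omega
  · rw [← hY', hkc]; omega
  · have := hnr ν (hred.mono Finset.subset_union_left)
    omega

/-! ### Balanced colourings and putting vertices back -/

/-- A colouring `st G R B E` without `m` disjoint monochromatic copies of `H` whose parts have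
sizes which allow to trade vertices of `E` for vertices of `R` and `B`. -/
structure Balanced [Fintype V] (G : SimpleGraph W) (H : SimpleGraph V) (R B E : Finset W) (m : ℕ) :
    Prop where
  disjRB : Disjoint R B
  disjRE : Disjoint R E
  disjBE : Disjoint B E
  avoids : Avoids G H R B E m
  cardE_le : E.card ≤ m
  cardB_lt : B.card + (Fintype.card V - H.indepNum) <
    (m + 1 - E.card) * (Fintype.card V - H.indepNum + 1)
  le_cardB : 3 * Fintype.card V * E.card ≤ B.card
  le_cardR : H.indepNum * m + 2 * Fintype.card V * E.card ≤ R.card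

/-- The count pins m to M up to lower order terms, while |B| is about (k - i)M and |R| about kM ≥ (i
+ 1)M. Each inequality thus has slack of order M, except |E| ≤ m and the lower bound on |B|, which
only compare l-scale terms with M. -/
theorem balanced_bounds {k i M l p x y r b e m s N : ℕ} (hk : 2 ≤ k) (hi : i < k)
    (hM : M = 2 ^ (60 * k)) (hl : l = 2 ^ (15 * k)) (hp : p = 2 ^ (11 * k))
    (hsum : r + b + e ≤ l) (hx : x ≤ k * M) (hx' : k * M ≤ x + 2 ^ (2 * k))
    (hy : y ≤ (k - i) * M) (hy' : (k - i) * M ≤ y + p) (hMm : M ≤ m + p)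
    (hN : (2 * k - i) * (m + s) ≤ N + 2)
    (hcard : x + r + (y + b) + e + (2 * k - i) * s = N) :
    e ≤ m ∧ y + b + (k - i) < (m + 1 - e) * (k - i + 1) ∧ 3 * k * e ≤ y + b ∧
      i * m + 2 * k * e ≤ x + r := by
  have q2 : 2 ^ (2 * k) ≤ 2 ^ (17 * k) := Nat.pow_le_pow_right (by norm_num) (by omega)
  have q11 : 2 ^ (11 * k) ≤ 2 ^ (15 * k) := Nat.pow_le_pow_right (by norm_num) (by omega)
  have q15 := pow_succ_mul_le hk 15
  have q16 := pow_succ_mul_le hk 16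
  have q17 := pow_succ_mul_le hk 17
  have q18 : 2 ^ (18 * k) ≤ 2 ^ (60 * k) := Nat.pow_le_pow_right (by norm_num) (by omega)
  have r15 := mul_pow_le k 15
  have hkp : k ≤ 2 ^ (15 * k) := (Nat.lt_two_pow_self (n := k)).le.trans
    (Nat.pow_le_pow_right (by norm_num) (by omega))
  norm_num only at q15 q16 q17 r15
  rw [← hM] at q18
  rw [← hl] at q11 q15 r15 hkp
  rw [← hp] at q11
  clear hM hl hp
  generalize 2 ^ (18 * k) = p18 at *
  generalize 2 ^ (17 * k) = p17 at *
  generalize 2 ^ (16 * k) = p16 at *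
  generalize 2 ^ (2 * k) = p2 at *
  obtain ⟨c, rfl⟩ : ∃ c, k = c + i := ⟨k - i, by omega⟩
  have hκ : 2 * (c + i) - i = c + i + c := by omega
  rw [Nat.add_sub_cancel] at hy hy' ⊢
  rw [hκ] at hN hcard
  generalize hkk : c + i = k at *
  have hc1 : 1 ≤ c := by omega
  have hkM : k * M = c * M + i * M := by rw [← hkk, add_mul]
  have hcM : M ≤ c * M := Nat.le_mul_of_pos_left _ hc1
  have hkE : k * e ≤ k * l := Nat.mul_le_mul_left _ (by omega)
  refine ⟨by omega, ?_, ?_, ?_⟩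
  · have h1 : (M - p + 1 - l) * (c + 1) ≤ (m + 1 - e) * (c + 1) :=
      Nat.mul_le_mul_right _ (by omega)
    obtain ⟨z, hz⟩ : ∃ z, M + 1 = z + p + l := ⟨M + 1 - p - l, by omega⟩
    have h2 : M - p + 1 - l = z := by omega
    rw [h2] at h1
    have h3 : c * M + c = c * z + c * p + c * l := by
      rw [← mul_add, ← mul_add, ← hz]; ring
    have h4 : c * p ≤ k * l := Nat.mul_le_mul (by omega) q11
    have h5 : c * l ≤ k * l := Nat.mul_le_mul_right _ (by omega)
    have h6 : z * (c + 1) = c * z + z := by ring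
    omega
  · have h1 : 3 * k * e = 3 * (k * e) := by ring
    omega
  · have h1 : (k + c) * (m + s) = (k + c) * m + (k + c) * s := by ring
    have h2 : (k + c) * m ≤ (k + c) * (M + l + 2) := by
      have h3 : (k + c) * M = k * M + c * M := by ring
      have h4 : l + 2 ≤ (k + c) * (l + 2) := Nat.le_mul_of_pos_left _ (by omega)
      have h5 : (k + c) * (M + l + 2) = (k + c) * M + (k + c) * (l + 2) := by ring
      omega
    have h3 : m ≤ M + l + 2 := Nat.le_of_mul_le_mul_left h2 (by omega)
    have h4 : i * m ≤ i * (M + l + 2) := Nat.mul_le_mul_left _ h3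
    have h5 : i * (M + l + 2) = i * M + i * l + 2 * i := by ring
    have h6 : i * l ≤ k * l := Nat.mul_le_mul_right _ (by omega)
    have h7 : 2 * k * e = 2 * (k * e) := by ring
    omega

theorem Extremal.exists_balanced [Fintype W] [Fintype V] [Nonempty V] {G : SimpleGraph W}
    {H : SimpleGraph V} (hH : ∀ v, ¬ H.IsIsolated v) {n : ℕ} (h : Extremal G H n)
    (hk : 2 ≤ Fintype.card V)
    (hP : HasPairs G (Fintype.card V) (2 ^ (60 * Fintype.card V) + 2 ^ (9 * Fintype.card V))) :
    ∃ (R B E : Finset W) (m s : ℕ), Balanced G H R B E m ∧ m + s = n ∧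
      R.card + B.card + E.card + (2 * Fintype.card V - H.indepNum) * s = Fintype.card W := by
  obtain ⟨X, Y, FR, FB, WR, WB, E, s, f, hs, hcard, hnr, hnb, hX1, hX2, hY2, hMs⟩ :=
    h.exists_frame hk rfl rfl rfl rfl hP
  have hRc : (X ∪ WR ∪ FR.biUnion id).card = (X ∪ FR.biUnion id).card + WR.card := by
    rw [Finset.union_right_comm, Finset.card_union_of_disjoint]
    exact Finset.disjoint_union_left.2 ⟨f.disjXW.symm, f.disjRW.symm⟩
  have hBc : (Y ∪ WB ∪ FB.biUnion id).card = (Y ∪ FB.biUnion id).card + WB.card := by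
    rw [Finset.union_right_comm, Finset.card_union_of_disjoint]
    exact Finset.disjoint_union_left.2 ⟨f.disjYW.symm, f.disjBW.symm⟩
  have hcard' := hcard
  rw [hRc, hBc] at hcard'
  obtain ⟨b1, b2, b3, b4⟩ := balanced_bounds (m := n - s) hk h.indep rfl rfl rfl f.card_rest hX1 hX2
    f.cardB hY2 (by omega) (by rw [Nat.sub_add_cancel hs.le]; exact h.card) hcard'
  refine ⟨_, _, E, n - s, s, ⟨f.disjRB, f.disjRE, f.disjBE, ⟨fun hp => ?_, fun hp => ?_⟩,
    b1, ?_, ?_, ?_⟩, by omega, hcard⟩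
  · have := hnr _ (f.pack_red hH hp)
    omega
  · have := hnb _ (f.pack_blue h.indep hp)
    omega
  · rwa [hBc]
  · rwa [hBc]
  · rwa [hRc]

theorem IsPacking.image {P P' : Finset W → Prop} {F : Finset (Finset W)} (hF : IsPacking P F)
    {φ : W → W} (hφ : Set.InjOn φ (F.biUnion id)) (h : ∀ A ∈ F, P' (A.image φ)) :
    Pack P' ((F.biUnion id).image φ) F.card := by
  have hsub : ∀ A ∈ F, ∀ x ∈ A, x ∈ ((F.biUnion id : Finset W) : Set W) := fun A hA x hx =>
    Finset.mem_coe.2 (subset_biUnion_id hA hx)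
  have hdis : ∀ A ∈ F, ∀ B ∈ F, A ≠ B → Disjoint (A.image φ) (B.image φ) := by
    intro A hA B hB hne
    rw [Finset.disjoint_left]
    intro z hz hz'
    obtain ⟨x, hx, rfl⟩ := Finset.mem_image.1 hz
    obtain ⟨y, hy, hxy⟩ := Finset.mem_image.1 hz'
    have := hφ (hsub B hB y hy) (hsub A hA x hx) hxy
    exact Finset.disjoint_left.1 (hF.disj A hA B hB hne) hx (this ▸ hy)
  have h1 := Pack.biUnion (P := P') F (fun A => A.image φ) (fun _ => 1)
    (fun A hA => Pack.one ((hF.nonempty A hA).image φ) (h A hA)) hdis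
  refine (h1.mono ?_).le (by simp)
  exact Finset.biUnion_subset.2 fun A hA => Finset.image_subset_image (subset_biUnion_id hA)

/-- Outside `E` the ideal colouring depends only on the classes of the vertices, so a packing moves
to any classes that are large enough for its traces. The map `f` treats both colours at once. -/
theorem Pack.transfer {G : SimpleGraph W} {H : SimpleGraph V} {R B E R' B' : Finset W}
    (hRB : Disjoint R B) (hRE : Disjoint R E) (hBE : Disjoint B E) (hRB' : Disjoint R' B')
    (hRE' : Disjoint R' E) (hBE' : Disjoint B' E) {f : SimpleGraph W → SimpleGraph W}
    (hf : f = id ∨ f = compl) {F : Finset (Finset W)}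
    (hF : IsPacking (IsCopy (f (st G R B E)) H) F) (hFU : F.biUnion id ⊆ R ∪ B ∪ E)
    (hR : (F.biUnion id ∩ R).card ≤ R'.card) (hB : (F.biUnion id ∩ B).card ≤ B'.card) :
    Pack (IsCopy (f (st G R' B' E)) H) (R' ∪ B' ∪ E) F.card := by
  obtain ⟨C, hC, hCc⟩ := Finset.exists_subset_card_eq hR
  obtain ⟨C', hC', hCc'⟩ := Finset.exists_subset_card_eq hB
  obtain ⟨φ, hφ, hφE, hφR, hφB, him⟩ := exists_transfer hRB hRE hBE hFU hCc.symm hCc'.symm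
    (hRB'.mono hC hC') (hRE'.mono_left hC) (hBE'.mono_left hC')
  have hcase : ∀ x ∈ F.biUnion id, x ∈ R ∨ x ∈ B ∨ x ∈ E := fun x hx => by
    simpa only [Finset.mem_union, or_assoc] using hFU hx
  have hclass : ∀ x ∈ F.biUnion id,
      (φ x ∈ R' ↔ x ∈ R) ∧ (φ x ∈ B' ↔ x ∈ B) ∧ (φ x ∈ E ↔ x ∈ E) := by
    intro x hx
    rw [Finset.disjoint_left] at hRB hRE hBE hRB' hRE' hBE'
    rcases hcase x hx with h | h | h
    · have h' := hC (hφR x hx h)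
      exact ⟨iff_of_true h' h, iff_of_false (hRB' h') (hRB h), iff_of_false (hRE' h') (hRE h)⟩
    · have h' := hC' (hφB x hx h)
      exact ⟨iff_of_false (fun a => hRB' a h') (fun a => hRB a h), iff_of_true h' h,
        iff_of_false (hBE' h') (hBE h)⟩
    · rw [hφE x hx h]
      exact ⟨iff_of_false (fun a => hRE' a h) (fun a => hRE a h),
        iff_of_false (fun a => hBE' a h) (fun a => hBE a h), Iff.rfl⟩
  have hadj : ∀ x ∈ F.biUnion id, ∀ y ∈ F.biUnion id,
      (st G R' B' E).Adj (φ x) (φ y) ↔ (st G R B E).Adj x y := by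
    intro x hx y hy
    obtain ⟨a1, a2, a3⟩ := hclass x hx
    obtain ⟨b1, b2, b3⟩ := hclass y hy
    rw [st_adj, st_adj, a1, a2, a3, b1, b2, b3]
    refine and_congr (hφ.ne_iff hx hy) ?_
    by_cases hxE : x ∈ E
    · by_cases hyE : y ∈ E
      · rw [hφE x hx hxE, hφE y hy hyE]
      · simp [hyE]
    · simp [hxE]
  have hadj' : ∀ x ∈ F.biUnion id, ∀ y ∈ F.biUnion id,
      (f (st G R B E)).Adj x y → (f (st G R' B' E)).Adj (φ x) (φ y) := by
    intro x hx y hy h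
    rcases hf with rfl | rfl
    · exact (hadj x hx y hy).2 h
    · rw [SimpleGraph.compl_adj] at h ⊢
      rw [hadj x hx y hy]
      exact ⟨(hφ.ne_iff hx hy).2 h.1, h.2⟩
  refine (hF.image (P' := IsCopy (f (st G R' B' E)) H) hφ fun A hA => ?_).mono ?_
  · have hsub := subset_biUnion_id hA
    exact (hF.prop A hA).image φ (hφ.mono (by exact_mod_cast hsub))
      fun x hx y hy h => hadj' x (hsub hx) y (hsub hy) h
  · rw [him]
    refine Finset.union_subset (Finset.union_subset ?_ ?_) ?_
    · exact Finset.inter_subset_right.trans Finset.subset_union_right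
    · exact hC.trans (Finset.subset_union_left.trans Finset.subset_union_left)
    · exact hC'.trans (Finset.subset_union_right.trans Finset.subset_union_left)

theorem card_biUnion_inter_add_le {F : Finset (Finset W)} {S D : Finset W} (hSD : ∀ A ∈ F, Disjoint A D) :
    (F.biUnion id ∩ S).card + (S ∩ D).card ≤ S.card := by
  have hd : Disjoint (F.biUnion id) D := by
    rw [Finset.disjoint_biUnion_left]
    exact hSD
  rw [← Finset.card_union_of_disjoint
    (hd.mono Finset.inter_subset_left Finset.inter_subset_right)]
  exact Finset.card_le_card (Finset.union_subset Finset.inter_subset_right Finset.inter_subset_left)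

theorem card_biUnion_inter_le (F : Finset (Finset W)) (S : Finset W) {a : ℕ}
    (h : ∀ A ∈ F, (A ∩ S).card ≤ a) : (F.biUnion id ∩ S).card ≤ F.card * a := by
  rw [Finset.biUnion_inter]
  exact Finset.card_biUnion_le_card_mul _ _ _ h

/-- Among m + 1 disjoint copies in one colour some copy misses `E`. Discarding it leaves m copies
whose traces fit into the old classes, against the assumption. -/
theorem Balanced.succ [Fintype V] [Nonempty V] {G : SimpleGraph W} {H : SimpleGraph V}
    (hH : ∀ v, ¬ H.IsIsolated v) {R B E R' B' : Finset W} {m : ℕ} (h : Balanced G H R B E m)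
    (hi : H.indepNum < Fintype.card V)
    (hRB' : Disjoint R' B') (hRE' : Disjoint R' E) (hBE' : Disjoint B' E)
    (hR : R'.card = R.card + Fintype.card V)
    (hB : B'.card = B.card + (Fintype.card V - H.indepNum)) : Balanced G H R' B' E (m + 1) := by
  have hEm := h.cardE_le
  have hlt := h.cardB_lt
  have hB3 := h.le_cardB
  have hR2 := h.le_cardR
  have hcardk : ∀ {G' : SimpleGraph W} {A}, IsCopy G' H A → A.card = Fintype.card V :=
    fun hA => hA.card
  refine ⟨hRB', hRE', hBE', ⟨?_, ?_⟩, by omega, ?_, by omega, ?_⟩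
  · rintro ⟨F, hF, hFU, hFc⟩
    have hAU : ∀ A ∈ F, A ⊆ R' ∪ B' ∪ E := fun A hA => (subset_biUnion_id hA).trans hFU
    have ht := hF.card_filter_inter_le E
    have hex : ∃ A ∈ F, ¬ (A ∩ E).Nonempty := by
      by_contra hne
      push Not at hne
      rw [Finset.filter_true_of_mem hne] at ht
      omega
    obtain ⟨A, hA, hAE⟩ := hex
    have hAR := (hF.prop A hA).subset_left hH (hAU A hA) hAE
    have hF0 := hF.subset (Finset.erase_subset A F)
    -- The discarded copy frees k vertices of `R'`. Only copies meeting `E` touch `B'`, and these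
    -- use at most k|E| ≤ |B| vertices.
    have hp := Pack.transfer hRB' hRE' hBE' h.disjRB h.disjRE h.disjBE (f := id) (Or.inl rfl)
      hF0 ((Finset.biUnion_subset_biUnion_of_subset_left _ (Finset.erase_subset _ _)).trans hFU)
      (by
        have h1 := card_biUnion_inter_add_le (F := F.erase A) (S := R') (D := A) fun A' hA' =>
          hF.disj A' (Finset.mem_of_mem_erase hA') A hA (Finset.ne_of_mem_erase hA')
        rw [Finset.inter_eq_right.2 hAR, hcardk (hF.prop A hA)] at h1
        omega)
      (by
        have h1 : (F.erase A).biUnion id ∩ B' ⊆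
            ((F.filter fun A => (A ∩ E).Nonempty).biUnion id) ∩ B' := by
          intro z hz
          obtain ⟨hz1, hz2⟩ := Finset.mem_inter.1 hz
          obtain ⟨A', hA', hzA⟩ := Finset.mem_biUnion.1 hz1
          have hA'F := Finset.mem_of_mem_erase hA'
          refine Finset.mem_inter.2 ⟨Finset.mem_biUnion.2 ⟨A', Finset.mem_filter.2 ⟨hA'F, ?_⟩,
            hzA⟩, hz2⟩
          by_contra hn
          exact Finset.disjoint_right.1 hRB' hz2
            ((hF.prop A' hA'F).subset_left hH (hAU A' hA'F) hn hzA)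
        have h2 := card_biUnion_inter_le (F.filter fun A => (A ∩ E).Nonempty) B'
          (a := Fintype.card V) fun A' hA' =>
            (Finset.card_le_card Finset.inter_subset_left).trans
              (hcardk (hF.prop A' (Finset.mem_filter.1 hA').1)).le
        have h3 := Finset.card_le_card h1
        have h4 := Nat.mul_le_mul_right (Fintype.card V) ht
        have h5 : 3 * Fintype.card V * E.card = 3 * (E.card * Fintype.card V) := by ring
        omega)
    rw [Finset.card_erase_of_mem hA, hFc] at hp
    exact h.avoids.1 hp
  · rintro ⟨F, hF, hFU, hFc⟩
    have hAU : ∀ A ∈ F, A ⊆ R' ∪ B' ∪ E := fun A hA => (subset_biUnion_id hA).trans hFU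
    have ht := hF.card_filter_inter_le E
    have hnt := Finset.card_filter_add_card_filter_not (s := F) (fun A => (A ∩ E).Nonempty)
    -- At least m + 1 - |E| copies miss `E`; if each had more than k - i vertices in `B'`, they
    -- would not fit there, by `cardB_lt`.
    have hex : ∃ A ∈ F.filter (fun A => ¬ (A ∩ E).Nonempty),
        (A ∩ B').card ≤ Fintype.card V - H.indepNum := by
      by_contra hne
      have hne' : ∀ A ∈ F.filter (fun A => ¬ (A ∩ E).Nonempty),
          Fintype.card V - H.indepNum + 1 ≤ (A ∩ B').card := fun A hA => by
        by_contra hlt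
        exact hne ⟨A, hA, by omega⟩
      have h1 := (hF.subset (Finset.filter_subset
        (fun A => ¬ (A ∩ E).Nonempty) F)).sum_card_inter_le B'
      have h2 := Finset.sum_le_sum hne'
      rw [Finset.sum_const, smul_eq_mul] at h2
      have h3 : (m + 1 - E.card) * (Fintype.card V - H.indepNum + 1) ≤
          (F.filter (fun A => ¬ (A ∩ E).Nonempty)).card *
            (Fintype.card V - H.indepNum + 1) := Nat.mul_le_mul_right _ (by omega)
      omega
    obtain ⟨A, hA', hAB⟩ := hex
    obtain ⟨hA, hAE⟩ := Finset.mem_filter.1 hA'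
    have hAB' : Fintype.card V - H.indepNum ≤ (A ∩ B').card := by
      have h1 := card_eq_inter_add hRB' hRE' hBE' (hAU A hA)
      have h2 := (hF.prop A hA).card_inter_left_le
      have h3 := hcardk (hF.prop A hA)
      rw [Finset.not_nonempty_iff_eq_empty.1 hAE, Finset.card_empty] at h1
      omega
    have hF0 := hF.subset (Finset.erase_subset A F)
    -- The m remaining copies have at most i vertices each in `R'`, and im ≤ |R|; the discarded one
    -- frees k - i vertices of `B'`.
    have hp := Pack.transfer hRB' hRE' hBE' h.disjRB h.disjRE h.disjBE (f := compl) (Or.inr rfl)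
      hF0 ((Finset.biUnion_subset_biUnion_of_subset_left _ (Finset.erase_subset _ _)).trans hFU)
      (by
        have h1 := card_biUnion_inter_le (F.erase A) R' (a := H.indepNum) fun A' hA' =>
          (hF0.prop A' hA').card_inter_left_le
        rw [Finset.card_erase_of_mem hA, hFc, Nat.add_sub_cancel, mul_comm] at h1
        omega)
      (by
        have h1 := card_biUnion_inter_add_le (F := F.erase A) (S := B') (D := A) fun A' hA' =>
          hF.disj A' (Finset.mem_of_mem_erase hA') A hA (Finset.ne_of_mem_erase hA')
        rw [Finset.inter_comm B' A] at h1
        omega)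
    rw [Finset.card_erase_of_mem hA, hFc] at hp
    exact h.avoids.2 hp
  · have h1 : m + 1 + 1 - E.card = (m + 1 - E.card) + 1 := by omega
    rw [h1, add_mul]
    omega
  · rw [mul_add]
    omega

/-- The unused vertices come in s groups of 2k - i = k + (k - i), the size of a tie; each group is
divided between `R` and `B`. -/
theorem Balanced.extend [Fintype W] [Fintype V] [Nonempty V] {G : SimpleGraph W}
    {H : SimpleGraph V} (hH : ∀ v, ¬ H.IsIsolated v) (hi : H.indepNum < Fintype.card V)
    {E : Finset W} (s : ℕ) : ∀ {R B : Finset W} {m : ℕ}, Balanced G H R B E m →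
      R.card + B.card + E.card + (2 * Fintype.card V - H.indepNum) * s = Fintype.card W →
      ∃ R' B', Balanced G H R' B' E (m + s) ∧ R' ∪ B' ∪ E = Finset.univ := by
  induction s with
  | zero =>
    intro R B m h hc
    refine ⟨R, B, h, ?_⟩
    rw [← Finset.card_eq_iff_eq_univ, Finset.card_union_of_disjoint
      (Finset.disjoint_union_left.2 ⟨h.disjRE, h.disjBE⟩), Finset.card_union_of_disjoint h.disjRB]
    omega
  | succ s ih =>
    intro R B m h hc
    have hcard : (R ∪ B ∪ E).card = R.card + B.card + E.card := by
      rw [Finset.card_union_of_disjoint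
        (Finset.disjoint_union_left.2 ⟨h.disjRE, h.disjBE⟩), Finset.card_union_of_disjoint h.disjRB]
    have hcompl := Finset.card_compl_add_card (R ∪ B ∪ E)
    rw [mul_add, mul_one] at hc
    obtain ⟨T, hT, hTc⟩ := Finset.exists_subset_card_eq (s := (R ∪ B ∪ E)ᶜ)
      (n := 2 * Fintype.card V - H.indepNum) (by omega)
    obtain ⟨T1, hT1, hT1c⟩ := Finset.exists_subset_card_eq (s := T) (n := Fintype.card V) (by omega)
    have hT2c := Finset.card_sdiff_add_card_eq_card hT1
    have hTd : Disjoint T (R ∪ B ∪ E) :=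
      Finset.disjoint_of_subset_left hT disjoint_compl_left
    rw [Finset.disjoint_union_right, Finset.disjoint_union_right] at hTd
    obtain ⟨⟨hTR, hTB⟩, hTE⟩ := hTd
    have hT2 : T \ T1 ⊆ T := Finset.sdiff_subset
    have hR : (R ∪ T1).card = R.card + Fintype.card V := by
      rw [Finset.card_union_of_disjoint (hTR.mono_left hT1).symm, hT1c]
    have hB : (B ∪ T \ T1).card = B.card + (Fintype.card V - H.indepNum) := by
      rw [Finset.card_union_of_disjoint (hTB.mono_left hT2).symm]
      omega
    have h' := h.succ hH hi (R' := R ∪ T1) (B' := B ∪ T \ T1) (by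
        simp only [Finset.disjoint_union_left, Finset.disjoint_union_right]
        exact ⟨⟨h.disjRB, hTB.mono_left hT1⟩, (hTR.mono_left hT2).symm, Finset.disjoint_sdiff⟩)
      (Finset.disjoint_union_left.2 ⟨h.disjRE, hTE.mono_left hT1⟩)
      (Finset.disjoint_union_left.2 ⟨h.disjBE, hTE.mono_left hT2⟩) hR hB
    have h2 := ih h' (by omega)
    rwa [add_right_comm m 1 s] at h2

/-! ### Eliminating ties that meet the exceptional set -/

theorem st_sdiff_adj {G : SimpleGraph W} {R B E T : Finset W} {x y : W}
    (hx : x ∉ T) (hy : y ∉ T) : (st G (R \ T) (B \ T) (E \ T)).Adj x y ↔ (st G R B E).Adj x y := by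
  simp [st_adj, hx, hy]

/-- A tie contains a copy in each colour, so outside it one copy fewer is avoided. `R` and `B` lose
fewer than 2k vertices, while |E| drops by at least one; the multiples of k|E| in the size
conditions pay for this. -/
theorem Balanced.sdiff_tie [Fintype V] [Nonempty V] {G : SimpleGraph W} {H : SimpleGraph V}
    {R B E T : Finset W} {n : ℕ} (hi : H.indepNum < Fintype.card V)
    (h : Balanced G H R B E (n + 1)) (hTU : T ⊆ R ∪ B ∪ E)
    (hT : IsTieSet (st G R B E) H T) (hTE : (T ∩ E).Nonempty) :
    Balanced G H (R \ T) (B \ T) (E \ T) n := by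
  have hsub : R \ T ∪ B \ T ∪ E \ T = (R ∪ B ∪ E) \ T := by
    rw [Finset.union_sdiff_distrib, Finset.union_sdiff_distrib]
  have hpack : ∀ G' G'' : SimpleGraph W, (∀ x ∉ T, ∀ y ∉ T, G'.Adj x y → G''.Adj x y) →
      (∃ A ⊆ T, IsCopy G'' H A) → Pack (IsCopy G' H) (R \ T ∪ B \ T ∪ E \ T) n →
      Pack (IsCopy G'' H) (R ∪ B ∪ E) (n + 1) := by
    rintro G' G'' hG ⟨A, hA, hAc⟩ ⟨F, hF, hFU, rfl⟩
    rw [hsub] at hFU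
    have hFd : Disjoint (F.biUnion id) T :=
      Finset.disjoint_of_subset_left hFU Finset.sdiff_disjoint
    have hF' : IsPacking (IsCopy G'' H) F := ⟨hF.nonempty, fun A' hA' =>
      (hF.prop A' hA').congr fun x hx y hy => hG x
        (Finset.disjoint_left.1 hFd (subset_biUnion_id hA' hx)) y
        (Finset.disjoint_left.1 hFd (subset_biUnion_id hA' hy)), hF.disj⟩
    exact hF'.pack.add' (Pack.one hAc.nonempty hAc) (hFd.mono_right hA)
      (hFU.trans Finset.sdiff_subset) (hA.trans hTU) le_rfl
  have hEm := h.cardE_le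
  have hlt := h.cardB_lt
  have hB3 := h.le_cardB
  have hR2 := h.le_cardR
  have hTc := hT.1
  have hTE' := Finset.card_pos.2 hTE
  have hsplit := card_eq_inter_add h.disjRB h.disjRE h.disjBE hTU
  have cR := Finset.card_sdiff_add_card_inter R T
  have cB := Finset.card_sdiff_add_card_inter B T
  have cE := Finset.card_sdiff_add_card_inter E T
  rw [Finset.inter_comm] at cR cB cE
  have hk2 : Fintype.card V * ((E \ T).card + 1) ≤ Fintype.card V * E.card :=
    Nat.mul_le_mul_left _ (by omega)
  rw [mul_add, mul_one] at hk2
  refine ⟨h.disjRB.mono Finset.sdiff_subset Finset.sdiff_subset,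
    h.disjRE.mono Finset.sdiff_subset Finset.sdiff_subset,
    h.disjBE.mono Finset.sdiff_subset Finset.sdiff_subset, ⟨fun hp => h.avoids.1 ?_,
      fun hp => h.avoids.2 ?_⟩, by omega, ?_, ?_, ?_⟩
  · exact hpack _ _ (fun x hx y hy => (st_sdiff_adj hx hy).1) hT.2.1 hp
  · refine hpack _ _ (fun x hx y hy hxy => ?_) hT.2.2 hp
    rw [SimpleGraph.compl_adj] at hxy ⊢
    rwa [st_sdiff_adj hx hy] at hxy
  · have h1 : (n + 1 + 1 - E.card) * (Fintype.card V - H.indepNum + 1) ≤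
        (n + 1 - (E \ T).card) * (Fintype.card V - H.indepNum + 1) :=
      Nat.mul_le_mul_right _ (by omega)
    omega
  · have h1 : 3 * Fintype.card V * (E \ T).card = 3 * (Fintype.card V * (E \ T).card) := by ring
    have h2 : 3 * Fintype.card V * E.card = 3 * (Fintype.card V * E.card) := by ring
    omega
  · have h1 : 2 * Fintype.card V * (E \ T).card = 2 * (Fintype.card V * (E \ T).card) := by ring
    have h2 : 2 * Fintype.card V * E.card = 2 * (Fintype.card V * E.card) := by ring
    rw [mul_add] at hR2
    omega

/-- Induction on |E|: a tie meeting `E` is deleted and its vertices are returned to `R` and `B`,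
which restores the number of vertices and n with a smaller `E`. -/
theorem Extremal.exists_structure_of_hasPairs [Fintype W] [Fintype V] [Nonempty V]
    {G : SimpleGraph W} {H : SimpleGraph V} (hH : ∀ v, ¬ H.IsIsolated v) {n : ℕ}
    (h : Extremal G H n) (hk : 2 ≤ Fintype.card V)
    (hP : HasPairs G (Fintype.card V) (2 ^ (60 * Fintype.card V) + 2 ^ (9 * Fintype.card V))) :
    ∃ R B E : Finset W, Disjoint R B ∧ Disjoint R E ∧ Disjoint B E ∧ R ∪ B ∪ E = Finset.univ ∧
      Avoids G H R B E n ∧ ∀ T, IsTieSet (st G R B E) H T → Disjoint T E := by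
  obtain ⟨R0, B0, E0, m, s, hb, rfl, hc⟩ := h.exists_balanced hH hk hP
  obtain ⟨R1, B1, hb1, hu1⟩ := hb.extend hH h.indep s hc
  obtain ⟨e, he⟩ : ∃ e, E0.card ≤ e := ⟨_, le_rfl⟩
  clear hb hc
  induction e using Nat.strong_induction_on generalizing R1 B1 E0 with
  | _ e ih =>
    by_cases hties : ∀ T, IsTieSet (st G R1 B1 E0) H T → Disjoint T E0
    · exact ⟨R1, B1, E0, hb1.disjRB, hb1.disjRE, hb1.disjBE, hu1, hb1.avoids, hties⟩
    · push Not at hties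
      obtain ⟨T, hT, hTE⟩ := hties
      rw [Finset.not_disjoint_iff_nonempty_inter] at hTE
      have hTE' := Finset.card_pos.2 hTE
      have hEm := hb1.cardE_le
      have hsub : T ∩ E0 ⊆ E0 := Finset.inter_subset_right
      have hle := Finset.card_le_card hsub
      -- As `E` is non-empty here, |E| ≤ m + s makes m + s positive.
      obtain ⟨q, hq⟩ : ∃ q, m + s = q + 1 := ⟨m + s - 1, by omega⟩
      rw [hq] at hb1 ih h ⊢
      have hTU : T ⊆ R1 ∪ B1 ∪ E0 := hu1 ▸ Finset.subset_univ T
      have hb2 := hb1.sdiff_tie h.indep hTU hT hTE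
      have hsplit := card_eq_inter_add hb1.disjRB hb1.disjRE hb1.disjBE hTU
      have cR := Finset.card_sdiff_add_card_inter R1 T
      have cB := Finset.card_sdiff_add_card_inter B1 T
      have cE := Finset.card_sdiff_add_card_inter E0 T
      rw [Finset.inter_comm] at cR cB cE
      have hcard : R1.card + B1.card + E0.card = Fintype.card W := by
        rw [← Finset.card_univ, ← hu1, Finset.card_union_of_disjoint
          (Finset.disjoint_union_left.2 ⟨hb1.disjRE, hb1.disjBE⟩),
          Finset.card_union_of_disjoint hb1.disjRB]
      have hTc := hT.1
      obtain ⟨R2, B2, hb3, hu3⟩ := hb2.extend hH h.indep 1 (by omega)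
      exact ih (E0 \ T).card (by omega) (E0 \ T) R2 B2 hb3 hu3 le_rfl

/-! ### Structured colourings and exchange of the colours -/

/-- The structure of the colouring with red graph `G`. -/
structure IsStructured [Fintype V] (G : SimpleGraph W) (H : SimpleGraph V) (R B E : Finset W) :
    Prop where
  disjRB : Disjoint R B
  disjRE : Disjoint R E
  disjBE : Disjoint B E
  cover : ∀ x, x ∈ R ∨ x ∈ B ∨ x ∈ E
  adjR : ∀ x ∈ R, ∀ y ∈ R, x ≠ y → G.Adj x y
  adjB : ∀ x ∈ B, ∀ y ∈ B, x ≠ y → Gᶜ.Adj x y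
  adjRB : (∀ x ∈ R, ∀ y ∈ B, G.Adj x y) ∨ ∀ x ∈ R, ∀ y ∈ B, Gᶜ.Adj x y
  adjRE : ∀ x ∈ R, ∀ y ∈ E, Gᶜ.Adj x y
  adjBE : ∀ x ∈ B, ∀ y ∈ E, G.Adj x y
  tie : ∀ T, IsTieSet G H T → ∀ x ∈ E, x ∉ T

theorem compl_adj_of_disjoint {G : SimpleGraph W} {A B : Finset W} (h : Disjoint A B)
    (hG : ∀ x ∈ A, ∀ y ∈ B, ¬ G.Adj x y) : ∀ x ∈ A, ∀ y ∈ B, Gᶜ.Adj x y := fun x hx y hy =>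
  (SimpleGraph.compl_adj _ _ _).2
    ⟨fun he => Finset.disjoint_left.1 h hx (he ▸ hy), hG x hx y hy⟩

theorem st_isStructured [Fintype W] [Fintype V] {G : SimpleGraph W} {H : SimpleGraph V}
    {R B E : Finset W} (hRB : Disjoint R B) (hRE : Disjoint R E) (hBE : Disjoint B E)
    (hU : R ∪ B ∪ E = Finset.univ) (hT : ∀ T, IsTieSet (st G R B E) H T → Disjoint T E) :
    IsStructured (st G R B E) H R B E where
  disjRB := hRB
  disjRE := hRE
  disjBE := hBE
  cover x := by
    have h := Finset.mem_univ x
    rw [← hU] at h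
    simpa only [Finset.mem_union, or_assoc] using h
  adjR x hx y hy hne := ⟨hne, Or.inl ⟨hx, hy⟩⟩
  adjB x hx y hy hne := (SimpleGraph.compl_adj _ _ _).2
    ⟨hne, st_not_adj_of_mem_right hRB hBE x hx y hy⟩
  adjRB := Or.inr (compl_adj_of_disjoint hRB (st_not_adj_of_mem_left_right hRB hRE))
  adjRE := compl_adj_of_disjoint hRE (st_not_adj_of_mem_left hRB hRE)
  adjBE x hx y hy := ⟨fun he => Finset.disjoint_left.1 hBE hx (he ▸ hy), Or.inr (Or.inl ⟨hx, hy⟩)⟩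
  tie T h x hx hxT := Finset.disjoint_left.1 (hT T h) hxT hx

theorem IsStructured.compl [Fintype V] {G : SimpleGraph W} {H : SimpleGraph V}
    {R B E : Finset W} (h : IsStructured G H R B E) : IsStructured Gᶜ H B R E where
  disjRB := h.disjRB.symm
  disjRE := h.disjBE
  disjBE := h.disjRE
  cover x := by have := h.cover x; tauto
  adjR := h.adjB
  adjB := by rw [compl_compl]; exact h.adjR
  adjRB := by
    rw [compl_compl]
    exact h.adjRB.symm.imp (fun a x hx y hy => (a y hy x hx).symm)
      fun a x hx y hy => (a y hy x hx).symm
  adjRE := by rw [compl_compl]; exact h.adjBE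
  adjBE := h.adjRE
  tie T hT := h.tie T (by simpa only [compl_compl] using hT.compl)

/-- If the majority of pairs is joined in red, the argument runs in the complement, and the result
is complemented back with `R` and `B` exchanged. The edges between `R` and `B` are then red, hence
the alternative in `adjRB`. -/
theorem Extremal.exists_isStructured [Fintype W] [Fintype V] [Nonempty V] {G : SimpleGraph W}
    {H : SimpleGraph V} (hH : ∀ v, ¬ H.IsIsolated v) {n : ℕ} (h : Extremal G H n)
    (hk : 2 ≤ Fintype.card V) (hn : 2 ^ (100 * Fintype.card V) ≤ n) :
    ∃ (G' : SimpleGraph W) (R B E : Finset W), ¬ Pack (IsCopy G' H) Finset.univ n ∧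
      ¬ Pack (IsCopy G'ᶜ H) Finset.univ n ∧ IsStructured G' H R B E := by
  have hmain : ∀ G₀ : SimpleGraph W, Extremal G₀ H n →
      HasPairs G₀ (Fintype.card V) (2 ^ (60 * Fintype.card V) + 2 ^ (9 * Fintype.card V)) →
      ∃ (G' : SimpleGraph W) (R B E : Finset W), ¬ Pack (IsCopy G' H) Finset.univ n ∧
        ¬ Pack (IsCopy G'ᶜ H) Finset.univ n ∧ IsStructured G' H R B E := by
    intro G₀ h₀ hP
    obtain ⟨R, B, E, hRB, hRE, hBE, hU, hA, hT⟩ := h₀.exists_structure_of_hasPairs hH hk hP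
    unfold Avoids at hA
    rw [hU] at hA
    exact ⟨st G₀ R B E, R, B, E, hA.1, hA.2, st_isStructured hRB hRE hBE hU hT⟩
  rcases h.hasPairs hk (M := 2 ^ (60 * Fintype.card V) + 2 ^ (9 * Fintype.card V)) (by
      generalize Fintype.card V = k at *
      have h1 : 2 ^ (5 * k) ≤ 2 ^ (61 * k) := Nat.pow_le_pow_right (by norm_num) (by omega)
      have h2 : 2 ^ (9 * k) ≤ 2 ^ (60 * k) := Nat.pow_le_pow_right (by norm_num) (by omega)
      have h3 := mul_pow_le k 60
      have h4 := pow_succ_mul_le hk 61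
      have h5 := pow_succ_mul_le hk 62
      have h6 : 2 ^ (63 * k) ≤ 2 ^ (100 * k) := Nat.pow_le_pow_right (by norm_num) (by omega)
      norm_num only at h3 h4 h5
      have h7 : 4 * k * (2 ^ (60 * k) + 2 ^ (9 * k)) ≤ 4 * k * (2 ^ (60 * k) + 2 ^ (60 * k)) :=
        Nat.mul_le_mul_left _ (by omega)
      have h8 : 4 * k * (2 ^ (60 * k) + 2 ^ (60 * k)) = 8 * (k * 2 ^ (60 * k)) := by ring
      omega) with hP | hP
  · exact hmain G h hP
  · obtain ⟨G', R, B, E, h1, h2, h3⟩ := hmain Gᶜ h.compl hP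
    exact ⟨G'ᶜ, B, R, E, h2, by rwa [compl_compl], h3.compl⟩

/-! ### The lower bound on the Ramsey number and the translation to colourings -/

theorem avoids_of_card_lt [Fintype V] {G : SimpleGraph W} {H : SimpleGraph V}
    (hH : ∀ v, ¬ H.IsIsolated v) {R B : Finset W} (hRB : Disjoint R B) {n : ℕ}
    (hR : R.card < Fintype.card V * n) (hB : B.card < (Fintype.card V - H.indepNum) * n) :
    Avoids G H R B ∅ n := by
  have hE : ∀ A : Finset W, ¬ (A ∩ ∅).Nonempty := by simp
  constructor
  · rintro ⟨F, hF, hFU, rfl⟩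
    have h1 := hF.card_biUnion_eq fun A hA => (hF.prop A hA).card
    have h2 : F.biUnion id ⊆ R := Finset.biUnion_subset.2 fun A hA =>
      (hF.prop A hA).subset_left hH ((subset_biUnion_id hA).trans hFU) (hE A)
    have h3 := Finset.card_le_card h2
    omega
  · rintro ⟨F, hF, hFU, rfl⟩
    have h1 := hF.sum_card_inter_le B
    -- A blue copy has at most α(H) vertices in the red clique, so at least k - α(H) in `B`.
    have h2 : ∑ _A ∈ F, (Fintype.card V - H.indepNum) ≤ ∑ A ∈ F, (A ∩ B).card := by
      refine Finset.sum_le_sum fun A hA => ?_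
      have e1 := card_eq_inter_add hRB (Finset.disjoint_empty_right _)
        (Finset.disjoint_empty_right _) ((subset_biUnion_id hA).trans hFU)
      have e2 := (hF.prop A hA).card_inter_left_le
      have e3 := (hF.prop A hA).card
      rw [Finset.inter_empty, Finset.card_empty] at e1
      omega
    rw [Finset.sum_const, smul_eq_mul, mul_comm] at h2
    omega

theorem isCopy_image [Fintype V] {G : SimpleGraph W} {H : SimpleGraph V} {f : V → W}
    (hf : Function.Injective f) (hG : ∀ u v, H.Adj u v → G.Adj (f u) (f v)) :
    IsCopy G H (Finset.univ.image f) := ⟨f, hf, hG, fun w => by simp⟩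

theorem copies_isContained_iff [Fintype W] [Fintype V] [Nonempty V] {G : SimpleGraph W}
    {H : SimpleGraph V} {n : ℕ} : copies n H ⊑ G ↔ Pack (IsCopy G H) Finset.univ n := by
  constructor
  · rintro ⟨f⟩
    have hinj := f.injective
    have h := Pack.biUnion (P := IsCopy G H) Finset.univ
      (fun j : Fin n => Finset.univ.image fun v => f (j, v)) (fun _ => 1)
      (fun j _ => by
        refine Pack.one ⟨f (j, Classical.arbitrary V), by simp⟩ (isCopy_image ?_ ?_)
        · exact fun u v huv => (Prod.mk.inj (hinj huv)).2
        · exact fun u v huv => f.toHom.map_adj ⟨rfl, huv⟩)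
      (fun j _ j' _ hne => by
        rw [Finset.disjoint_left]
        intro z hz hz'
        simp only [Finset.mem_image, Finset.mem_univ, true_and] at hz hz'
        obtain ⟨v, rfl⟩ := hz
        obtain ⟨v', hv'⟩ := hz'
        exact hne (Prod.mk.inj (hinj hv')).1.symm)
    exact (h.mono (Finset.subset_univ _)).le (by simp)
  · rintro ⟨F, hF, -, hFc⟩
    have e : Fin n ≃ F := (Fintype.equivFinOfCardEq (by simp [hFc])).symm
    choose g hginj hgadj hgmem using fun A : F => hF.prop A.1 A.2
    have hmem : ∀ A v, g A v ∈ A.1 := fun A v => (hgmem A _).2 ⟨v, rfl⟩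
    refine ⟨⟨⟨fun x => g (e x.1) x.2, ?_⟩, ?_⟩⟩
    · rintro ⟨j, u⟩ ⟨j', v⟩ ⟨hj, huv⟩
      simp only at hj huv
      subst hj
      exact hgadj _ _ _ huv
    · rintro ⟨j, u⟩ ⟨j', v⟩ huv
      have huv' : g (e j) u = g (e j') v := huv
      have hjj : j = j' := by
        by_contra hne
        have hd := hF.disj _ (e j).2 _ (e j').2 fun he => hne (e.injective (Subtype.ext he))
        exact Finset.disjoint_left.1 hd (hmem _ u) (huv' ▸ hmem _ v)
      subst hjj
      rw [hginj _ huv']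

/-- The colouring with red graph `G`. -/
noncomputable def colouringOf (G : SimpleGraph W) : TwoColouring W :=
  SimpleGraph.EdgeLabeling.mk (fun x y _ => if G.Adj x y then Colour.red else Colour.blue)
    (fun x y _ => by simp [G.adj_comm])

theorem redGraph_colouringOf (G : SimpleGraph W) : (colouringOf G).redGraph = G := by
  ext x y
  rw [SimpleGraph.TopEdgeLabeling.labelGraph_adj]
  simp only [colouringOf, SimpleGraph.EdgeLabeling.get_mk]
  constructor
  · rintro ⟨-, h⟩
    by_contra hn
    simp [hn] at h
  · exact fun h => ⟨h.ne, by simp [h]⟩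

theorem blueGraph_eq (c : TwoColouring W) : c.blueGraph = c.redGraphᶜ := by
  ext x y
  rw [SimpleGraph.compl_adj, SimpleGraph.TopEdgeLabeling.labelGraph_adj,
    SimpleGraph.TopEdgeLabeling.labelGraph_adj]
  constructor
  · rintro ⟨hne, h⟩
    exact ⟨hne, fun ⟨_, h'⟩ => by rw [h] at h'; cases h'⟩
  · rintro ⟨hne, h⟩
    refine ⟨hne, ?_⟩
    cases hc : c.get x y hne with
    | red => exact absurd ⟨hne, hc⟩ h
    | blue => rfl

theorem hasMonochromatic_iff [Fintype W] [Fintype V] [Nonempty V] {c : TwoColouring W}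
    {H : SimpleGraph V} {n : ℕ} : c.HasMonochromatic (copies n H) ↔
      Pack (IsCopy c.redGraph H) Finset.univ n ∨ Pack (IsCopy c.redGraphᶜ H) Finset.univ n := by
  unfold TwoColouring.HasMonochromatic
  rw [blueGraph_eq, copies_isContained_iff, copies_isContained_iff]

theorem isTieSet_of_isTie [Fintype V] {c : TwoColouring W} {H : SimpleGraph V} {S : Finset W}
    (h : c.IsTie H S) : IsTieSet c.redGraph H S := by
  have hcopy : ∀ G : SimpleGraph W, H ⊑ G.induce (S : Set W) → ∃ A ⊆ S, IsCopy G H A := by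
    rintro G ⟨f⟩
    refine ⟨Finset.univ.image fun v => (f v : W), ?_, isCopy_image ?_ ?_⟩
    · intro w hw
      obtain ⟨v, -, rfl⟩ := Finset.mem_image.1 hw
      exact (f v).2
    · exact fun u v huv => f.injective (Subtype.ext huv)
    · exact fun u v huv => f.toHom.map_adj huv
  refine ⟨h.1, hcopy _ h.2.1, hcopy _ ?_⟩
  rw [← blueGraph_eq]
  exact h.2.2

theorem two_le_card [Fintype V] [Nonempty V] {H : SimpleGraph V} (hH : ∀ v, ¬ H.IsIsolated v) :
    2 ≤ Fintype.card V := by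
  have h := hH (Classical.arbitrary V)
  unfold SimpleGraph.IsIsolated at h
  push Not at h
  obtain ⟨w, hw⟩ := h
  exact Fintype.one_lt_card_iff.2 ⟨_, w, hw.ne⟩

/-- The colouring of `K_N` with a red clique on `|H| n - 1` vertices and all other edges blue. -/
theorem exists_avoiding_colouring [Fintype V] [Nonempty V] {H : SimpleGraph V}
    (hH : ∀ v, ¬ H.IsIsolated v) {n N : ℕ} (hn : 0 < n)
    (hN : N + 2 ≤ (2 * Fintype.card V - H.indepNum) * n) :
    ∃ c : TwoColouring (Fin N), ¬ c.HasMonochromatic (copies n H) := by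
  have hi := indepNum_lt_card hH
  set a := Fintype.card V * n - 1 with ha
  have hpos : 0 < Fintype.card V * n := Nat.mul_pos Fintype.card_pos hn
  set R : Finset (Fin N) := Finset.univ.filter fun x => x.val < a with hR
  have hRc : R.card ≤ a := by
    have h := Finset.card_le_card_of_injOn (s := R) (t := Finset.range a) (fun x => x.val)
      (fun x hx => by simpa [hR] using hx) (fun x _ y _ h => Fin.ext h)
    simpa using h
  have hBc : Rᶜ.card ≤ N - a := by
    have h := Finset.card_le_card_of_injOn (s := Rᶜ) (t := Finset.range (N - a))
      (fun x => x.val - a) (fun x hx => by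
        have h1 := x.2
        have h2 : a ≤ x.val := by simpa [hR] using hx
        simp only [Finset.coe_range, Set.mem_Iio]
        omega) (fun x hx y hy h => by
        have h1 : a ≤ x.val := by simpa [hR] using hx
        have h2 : a ≤ y.val := by simpa [hR] using hy
        simp only at h
        exact Fin.ext (by omega))
    simpa using h
  have hsplit : (2 * Fintype.card V - H.indepNum) * n =
      Fintype.card V * n + (Fintype.card V - H.indepNum) * n := by
    rw [← add_mul]; congr 1; omega
  have hpos' : 0 < (Fintype.card V - H.indepNum) * n := Nat.mul_pos (by omega) hn
  have h := avoids_of_card_lt (G := ⊥) (H := H) hH (R := R) (B := Rᶜ) disjoint_compl_right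
    (n := n) (by omega) (by omega)
  refine ⟨colouringOf (st ⊥ R Rᶜ ∅), fun hm => ?_⟩
  rw [hasMonochromatic_iff, redGraph_colouringOf] at hm
  have hU : ∀ x ∈ (Finset.univ : Finset (Fin N)), x ∈ R ∪ Rᶜ ∪ ∅ := fun x _ => by
    simp only [Finset.mem_union, Finset.mem_compl]
    tauto
  refine hm.elim (fun hp => h.1 (hp.mono fun x hx => ?_)) fun hp => h.2 (hp.mono fun x hx => ?_)
  all_goals
    have := hU x hx
    simp only [Finset.mem_union] at this ⊢
    exact this

theorem isContained_of_isNClique {U : Type*} [Fintype U] {K : SimpleGraph U} {G : SimpleGraph W}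
    {A : Finset W} (hA : G.IsNClique (Fintype.card U) A) : K ⊑ G := by
  have e : U ≃ A := Fintype.equivOfCardEq (by rw [Fintype.card_coe, hA.2])
  have hinj : Function.Injective fun u => (e u : W) := fun u v h => e.injective (Subtype.ext h)
  exact ⟨⟨⟨fun u => e u, fun {u v} huv => hA.1 (e u).2 (e v).2 (hinj.ne huv.ne)⟩, hinj⟩⟩

/-- Needed for the infimum defining the Ramsey number to be attained, as `sInf ∅` would be 0. -/
theorem exists_forall_hasMonochromatic {U : Type*} [Fintype U] (K : SimpleGraph U) :
    ∃ N, ∀ c : TwoColouring (Fin N), c.HasMonochromatic K := by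
  refine ⟨2 ^ (Fintype.card U + Fintype.card U), fun c => ?_⟩
  unfold TwoColouring.HasMonochromatic
  rw [blueGraph_eq]
  rcases ramsey c.redGraph _ (Fintype.card U) (Fintype.card U) rfl Finset.univ (by simp) with
    ⟨B, -, hB⟩ | ⟨B, -, hB⟩
  · exact Or.inl (isContained_of_isNClique hB)
  · exact Or.inr (isContained_of_isNClique hB)

/-- The model colouring gives r(nH) ≥ κn - 1 with κ = 2k - α(H); passing to r(nH) - 1 vertices loses
one more, hence the 2 in `Extremal.card`. -/
theorem exists_extremal [Fintype V] [Nonempty V] {H : SimpleGraph V}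
    (hH : ∀ v, ¬ H.IsIsolated v) {n : ℕ} (hn : 0 < n) :
    ∃ G : SimpleGraph (Fin (ramseyNumber (copies n H) - 1)), Extremal G H n := by
  have hmem : ∀ c : TwoColouring (Fin (ramseyNumber (copies n H))),
      c.HasMonochromatic (copies n H) := Nat.sInf_mem (exists_forall_hasMonochromatic (copies n H))
  have hi := indepNum_lt_card hH
  have hlow : (2 * Fintype.card V - H.indepNum) * n < ramseyNumber (copies n H) + 2 := by
    by_contra hlt
    obtain ⟨c, hc⟩ := exists_avoiding_colouring hH hn (N := ramseyNumber (copies n H)) (by omega)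
    exact hc (hmem c)
  -- Makes r(nH) positive, so that the truncated r(nH) - 1 lies strictly below the infimum.
  have hpos : 2 ≤ (2 * Fintype.card V - H.indepNum) * n :=
    (Nat.le_mul_of_pos_right _ hn).trans' (by have := two_le_card hH; omega)
  have hnot : ramseyNumber (copies n H) - 1 ∉
      {N : ℕ | ∀ c : TwoColouring (Fin N), c.HasMonochromatic (copies n H)} :=
    Nat.notMem_of_lt_sInf (show ramseyNumber (copies n H) - 1 < ramseyNumber (copies n H) by omega)
  rw [Set.mem_ofPred_eq] at hnot
  push Not at hnot
  obtain ⟨c, hc⟩ := hnot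
  rw [hasMonochromatic_iff] at hc
  push Not at hc
  refine ⟨c.redGraph, hc.1, hc.2, ?_, hi⟩
  rw [Fintype.card_fin]
  omega

end MultiRamsey

theorem theorem4p3 :
    ∃ C : ℝ, 0 < C ∧
      ∀ (V : Type*) [Fintype V] [Nonempty V] (H : SimpleGraph V),
        (∀ v : V, ¬ H.IsIsolated v) →
        ∀ n : ℕ, (2 : ℝ) ^ (C * (Fintype.card V : ℝ)) ≤ (n : ℝ) →
          ∃ c : TwoColouring (Fin (ramseyNumber (copies n H) - 1)),
            ¬ c.HasMonochromatic (copies n H) ∧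
            ∃ R B E : Finset (Fin (ramseyNumber (copies n H) - 1)),
              -- the three sets partition the vertex set
              (Disjoint R B ∧ Disjoint R E ∧ Disjoint B E ∧ R ∪ B ∪ E = Finset.univ) ∧
              -- inside `R` everything is red, inside `B` everything is blue
              (∀ x ∈ R, ∀ y ∈ R, x ≠ y → c.redGraph.Adj x y) ∧
              (∀ x ∈ B, ∀ y ∈ B, x ≠ y → c.blueGraph.Adj x y) ∧
              -- all edges between `R` and `B` have the same colour
              ((∀ x ∈ R, ∀ y ∈ B, c.redGraph.Adj x y) ∨
                (∀ x ∈ R, ∀ y ∈ B, c.blueGraph.Adj x y)) ∧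
              (∀ x ∈ R, ∀ y ∈ E, c.blueGraph.Adj x y) ∧
              (∀ x ∈ B, ∀ y ∈ E, c.redGraph.Adj x y) ∧
              -- no `H`-tie contains a vertex of `E`
              (∀ S : Finset (Fin (ramseyNumber (copies n H) - 1)),
                c.IsTie H S → ∀ x ∈ E, x ∉ S) := by
  -- The only demand on n beyond positivity is room for about 2^(60k) pairs of cliques, that is
  -- 2^(5k) + 4k(2^(60k) + 2^(9k)) ≤ n; 100 is generous.
  refine ⟨100, by norm_num, fun V _ _ H hH n hn => ?_⟩
  have hn' : 2 ^ (100 * Fintype.card V) ≤ n := by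
    rw [← Nat.cast_ofNat (R := ℝ) (n := 100), ← Nat.cast_mul, Real.rpow_natCast] at hn
    exact_mod_cast hn
  have hn0 : 0 < n := lt_of_lt_of_le (Nat.two_pow_pos _) hn'
  obtain ⟨G, hG⟩ := MultiRamsey.exists_extremal hH hn0
  obtain ⟨G', R, B, E, h1, h2, h⟩ :=
    hG.exists_isStructured hH (MultiRamsey.two_le_card hH) hn'
  have hr := MultiRamsey.redGraph_colouringOf G'
  have hb : (MultiRamsey.colouringOf G').blueGraph = G'ᶜ := by
    rw [MultiRamsey.blueGraph_eq, hr]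
  refine ⟨MultiRamsey.colouringOf G', ?_, R, B, E, ⟨h.disjRB, h.disjRE, h.disjBE, ?_⟩, ?_⟩
  · rw [MultiRamsey.hasMonochromatic_iff, hr]
    exact fun hm => hm.elim h1 h2
  · ext x
    simpa only [Finset.mem_union, or_assoc, Finset.mem_univ, iff_true] using h.cover x
  · rw [hr, hb]
    refine ⟨h.adjR, h.adjB, h.adjRB, h.adjRE, h.adjBE, fun S hS => h.tie S ?_⟩
    have := MultiRamsey.isTieSet_of_isTie hS
    rwa [hr] at this
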